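/- **Conventions.** Let $p=2\ell+1$ be an odd prime. For a partition $\lambda$ let $\lambda'$ be its conjugate, $h(\lambda)$ its number of positive parts, and let $a_\lambda\in\{0,1\}$ be the parity of the number of its positive even parts. For partitions $\lambda,\mu^1,\dots,\mu^r$ let $c(\lambda;\mu^1,\dots,\mu^r)$ be the Littlewood–Richardson coefficient, i.e. the coefficient of the Schur function $s_\lambda$ in $s_{\mu^1}\cdots s_{\mu^r}$, and let $K^{-1}_{\lambda\sigma}(t)$ be the inverse Kostka polynomial, i.e. the coefficient of $s_\sigma$ in the Hall–Littlewood symmetric function $P_\lambda(x;t)$. A partition is *strict* if it has no repeated positive parts, and *$p$-strict* if its repeated parts are divisible by $p$. A $p$-strict partition $\lambda$ is *restricted* if for all $r$ either $\lambda_r-\lambda_{r+1}<p$, or $\lambda_r-\lambda_{r+1}=p$ and $p\nmid\lambda_r$. Removing a *$p$-bar* from a $p$-strict partition $\lambda$ means replacing a part $\lambda_r\ge p$ with $\lambda_r-p$ and reordering (where $p\mid\lambda_r$ or $\lambda_r-p$ is not a part of $\lambda$), or deleting two parts with sum $p$. The *$p$-bar-core* of $\lambda$ is the partition reached by removing $p$-bars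 until this is no longer possible, and the *$p$-bar-weight* of $\lambda$ is the number of $p$-bars removed. Let $d\ge1$, and let $\rho$ be a $p$-bar-core which is *$d$-Rouquier*: if $r_i(\rho)$ is the number of parts of $\rho$ congruent to $i$ modulo $p$, then $r_1(\rho)\ge d$ and $r_i(\rho)\ge r_{i-1}(\rho)+d-1$ for $2\le i\le\ell$. Let $\mathscr S$ (resp. $\mathscr R$) be the set of strict (resp. restricted $p$-strict) partitions with $p$-bar-core $\rho$ and $p$-bar-weight $d$. The *$p$-bar-quotient* $(\lambda^{(0)},\dots,\lambda^{(\ell)})$ of a $p$-strict partition $\lambda$ with $p$-bar-core $\rho$ and $p$-bar-weight $d$ is defined as follows. The parts of $\lambda^{(0)}$ are the parts of $\lambda$ divisible by $p$, divided by $p$. For $1\le i\le\ell$, if $\lambda_{k_1}>\dots>\lambda_{k_r}$ are the parts of $\lambda$ congruent to $i$ modulo $p$, then $\lambda^{(i)}$ has parts $(\lambda_{k_j}-(r-j)p-i)/p$ for $1\le j\le r$. For $\lambda\in\mathscr S$ and $\mu\in\mathscr R$ put $$S_{\lambda\mu}=\sum K^{-1}_{\lambda^{(0)}\sigma^{(0)}}(-1)\prod_{i=1}^{\ell}c(\lambda^{(i)};\sigma^{(i)},\tau^{(i)})\,c(\mu^{(i-1)};\sigma^{(i-1)},{\tau^{(i)}}'),$$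 the sum being over all partitions $\sigma^{(0)},\dots,\sigma^{(\ell-1)},\tau^{(1)},\dots,\tau^{(\ell)}$, with $\sigma^{(\ell)}$ read as $\varnothing$, and $$D_{\lambda\mu}=2^{\lfloor\frac12(h(\lambda^{(0)})+1-a_\lambda)\rfloor}S_{\lambda\mu},\qquad D^\circ_{\lambda\mu}=2^{\lfloor\frac12(h(\lambda^{(0)})+a_\lambda)\rfloor}S_{\lambda\mu}.$$ **Proposition.** For all $\mu,\nu\in\mathscr R$, $$\sum_{\lambda\in\mathscr S}D^\circ_{\lambda\mu}D_{\lambda\nu}=\sum\prod_{i=0}^{\ell-1}c\big(\mu^{(i)};\varphi^{(i)},\chi^{(i)},{\psi^{(i+1)}}',\omega^{(i)}\big)\,c\big(\nu^{(i)};\varphi^{(i)},\psi^{(i)},{\chi^{(i+1)}}',\omega^{(i)}\big),$$ where the sum on the right is over all partitions $\varphi^{(i)},\psi^{(i)},\chi^{(i)},\omega^{(i)}$ ($0\le i\le\ell-1$) such that $\chi^{(0)}={\psi^{(0)}}'$, with $\chi^{(\ell)}$ and $\psi^{(\ell)}$ read as $\varnothing$; only finitely many of its terms are nonzero. -/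

import Mathlib

/-! Partitions are represented by their Young diagrams: the parts of `κ` are
`κ.rowLen 0 ≥ κ.rowLen 1 ≥ …`, the positive ones being listed in `κ.rowLens`; the conjugate
partition is `κ.transpose`, and the empty partition is `⊥`. -/

namespace SpinRoCK

noncomputable section

/-! ### Symmetric functions -/

/-- The field of rational functions in `N` variables with coefficients in (the field of fractions
of) `R`. -/
abbrev RatFun (R : Type) [CommRing R] (N : ℕ) : Type := FractionRing (MvPolynomial (Fin N) R)

/-- The alternant `a_{κ+δ} = det (x_i ^ (κ_j + N - j))`, with rows and columns `1, …, N`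
(here numbered `0, …, N - 1`). -/
def alternant (R : Type) [CommRing R] (N : ℕ) (κ : YoungDiagram) : MvPolynomial (Fin N) R :=
  (Matrix.of fun i j : Fin N =>
    (MvPolynomial.X i : MvPolynomial (Fin N) R) ^ (κ.rowLen j + (N - 1 - (j : ℕ)))).det

/-- The Schur polynomial `s_κ(x_1, …, x_N) = a_{κ+δ} / a_δ` (for `N` at least the number of
positive parts of `κ`). -/
def schur (R : Type) [CommRing R] [IsDomain R] (N : ℕ) (κ : YoungDiagram) : RatFun R N :=
  algebraMap (MvPolynomial (Fin N) R) (RatFun R N) (alternant R N κ) /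
    algebraMap (MvPolynomial (Fin N) R) (RatFun R N) (alternant R N ⊥)

/-- The `i`-th variable, as a rational function. -/
def var (R : Type) [CommRing R] (N : ℕ) (i : Fin N) : RatFun R N :=
  algebraMap (MvPolynomial (Fin N) R) (RatFun R N) (MvPolynomial.X i)

/-- The Hall–Littlewood polynomial
`P_κ(x_1, …, x_N; t) = ∑_{w ∈ S_N / S_N^κ} w (x^κ ∏_{κ_i > κ_j} (x_i - t x_j) / (x_i - x_j))`
(for `N` at least the number of positive parts of `κ`). The cosets of the stabilizer `S_N^κ` of
`(κ_1, …, κ_N)` correspond to the distinct rearrangements `α` of this sequence. -/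
def hallLittlewoodP (R : Type) [CommRing R] [IsDomain R] (t : R) (N : ℕ) (κ : YoungDiagram) :
    RatFun R N :=
  ∑ α ∈ Finset.univ.image (fun (w : Equiv.Perm (Fin N)) (i : Fin N) => κ.rowLen (w i)),
    (∏ i, var R N i ^ α i) *
      ∏ ij ∈ Finset.univ.filter (fun ij : Fin N × Fin N => α ij.2 < α ij.1),
        (var R N ij.1 - algebraMap R (RatFun R N) t * var R N ij.2) /
          (var R N ij.1 - var R N ij.2)

/-- A symmetric function is given through its specializations `f N` to the variables
`x_1, …, x_N`, and an identity of symmetric functions is an identity of these specializations for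
all large `N`. The finitely supported family `c` is the family of coefficients of `f` in the basis
of Schur functions: `f = ∑_κ c_κ s_κ`. -/
def IsSchurExpansion {R : Type} [CommRing R] [IsDomain R] (f : (N : ℕ) → RatFun R N)
    (c : YoungDiagram →₀ R) : Prop :=
  ∃ N₀ : ℕ, ∀ N ≥ N₀, f N = c.sum fun κ a => algebraMap R (RatFun R N) a * schur R N κ

theorem coeff_alternant {R : Type} [CommRing R] (N : ℕ) (κ η : YoungDiagram) :
    (alternant R N κ).coeff
        (∑ i : Fin N, Finsupp.single i (η.rowLen i + (N - 1 - (i : ℕ)))) =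
      if ∀ i : Fin N, κ.rowLen i = η.rowLen i then 1 else 0 := by
  classical
  have hprod : ∀ (g : Fin N → ℕ) (w : Equiv.Perm (Fin N)),
      (∏ i : Fin N, (MvPolynomial.X (w i) : MvPolynomial (Fin N) R) ^ g i) =
        MvPolynomial.monomial (∑ i, Finsupp.single (w i) (g i)) 1 := by
    intro g w
    rw [MvPolynomial.monomial_sum_one]
    exact Finset.prod_congr rfl fun i _ => by rw [MvPolynomial.X_pow_eq_monomial]
  have heq : ∀ w : Equiv.Perm (Fin N),
      (∑ i : Fin N, Finsupp.single (w i) (κ.rowLen i + (N - 1 - (i : ℕ))) =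
        ∑ i : Fin N, Finsupp.single i (η.rowLen i + (N - 1 - (i : ℕ)))) ↔
      (w = 1 ∧ ∀ i : Fin N, κ.rowLen i = η.rowLen i) := by
    intro w
    constructor
    · intro h
      have h1 : ∀ i : Fin N, κ.rowLen i + (N - 1 - (i : ℕ)) =
          η.rowLen (w i) + (N - 1 - ((w i : Fin N) : ℕ)) := by
        intro i
        have := DFunLike.congr_fun h (w i)
        rw [Finsupp.finsetSum_apply, Finsupp.finsetSum_apply,
          Finset.sum_eq_single i (fun j _ hj => Finsupp.single_eq_of_ne'
            (fun hh => hj (w.injective hh))) (by simp),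
          Finset.sum_eq_single (w i) (fun j _ hj => Finsupp.single_eq_of_ne' hj) (by simp),
          Finsupp.single_eq_same, Finsupp.single_eq_same] at this
        exact this
      have hw : StrictMono w := by
        intro i j hij
        by_contra hcon
        have hlt : w j ≤ w i := not_lt.mp hcon
        have a1 := κ.rowLen_anti i j (Fin.le_def.mp hij.le)
        have a2 := η.rowLen_anti (w j) (w i) (Fin.le_def.mp hlt)
        have b1 := h1 i
        have b2 := h1 j
        have := i.2
        have := j.2
        have := Fin.lt_def.mp hij
        have := Fin.le_def.mp hlt
        omega
      have hw1 : w = 1 := by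
        have : hw.orderIsoOfSurjective w w.surjective = OrderIso.refl _ := Subsingleton.elim _ _
        exact Equiv.ext fun i => DFunLike.congr_fun this i
      refine ⟨hw1, fun i => ?_⟩
      have := h1 i
      rw [hw1] at this
      simpa using this
    · rintro ⟨rfl, h⟩
      exact Finset.sum_congr rfl fun i _ => by simp [h i]
  rw [alternant, Matrix.det_apply, MvPolynomial.coeff_sum]
  simp only [Matrix.of_apply, hprod, MvPolynomial.coeff_smul, MvPolynomial.coeff_monomial, heq]
  by_cases h : ∀ i : Fin N, κ.rowLen i = η.rowLen i
  · simp [h]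
  · simp [h]

/-- The coefficients of a Schur expansion are unique. -/
theorem IsSchurExpansion.unique {R : Type} [CommRing R] [IsDomain R]
    {f : (N : ℕ) → RatFun R N} {c c' : YoungDiagram →₀ R}
    (h : IsSchurExpansion f c) (h' : IsSchurExpansion f c') : c = c' := by
  classical
  obtain ⟨N₁, h₁⟩ := h
  obtain ⟨N₂, h₂⟩ := h'
  ext η
  set S := c.support ∪ c'.support with hS
  set N := N₁ + N₂ + η.colLen 0 + ∑ κ ∈ S, κ.colLen 0 with hN
  have e := (h₁ N (by omega)).symm.trans (h₂ N (by omega))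
  rw [Finsupp.sum_of_support_subset c (s := S) Finset.subset_union_left _ (by simp),
    Finsupp.sum_of_support_subset c' (s := S) Finset.subset_union_right _ (by simp)] at e
  have hne : (algebraMap (MvPolynomial (Fin N) R) (RatFun R N)) (alternant R N ⊥) ≠ 0 := by
    intro h0
    have h1 := (IsFractionRing.injective (MvPolynomial (Fin N) R) (RatFun R N))
      (h0.trans (map_zero _).symm)
    have h2 := coeff_alternant (R := R) N ⊥ ⊥
    rw [h1] at h2
    simp at h2
  have key : ∀ d : YoungDiagram →₀ R,
      (∑ κ ∈ S, algebraMap R (RatFun R N) (d κ) * schur R N κ) *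
        algebraMap (MvPolynomial (Fin N) R) (RatFun R N) (alternant R N ⊥) =
      algebraMap (MvPolynomial (Fin N) R) (RatFun R N)
        (∑ κ ∈ S, MvPolynomial.C (d κ) * alternant R N κ) := by
    intro d
    rw [map_sum, Finset.sum_mul]
    refine Finset.sum_congr rfl fun κ _ => ?_
    rw [schur, mul_assoc, div_mul_cancel₀ _ hne, map_mul,
      IsScalarTower.algebraMap_apply R (MvPolynomial (Fin N) R) (RatFun R N)]
    rfl
  have e2 := congrArg (· * algebraMap (MvPolynomial (Fin N) R) (RatFun R N) (alternant R N ⊥)) e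
  simp only [key] at e2
  have e3 := (IsFractionRing.injective (MvPolynomial (Fin N) R) (RatFun R N)) e2
  have hcol : ∀ κ ∈ S, κ.colLen 0 ≤ N := fun κ hκ => by
    have := Finset.single_le_sum (f := fun κ : YoungDiagram => κ.colLen 0)
      (fun _ _ => Nat.zero_le _) hκ
    exact this.trans (by omega)
  have hiff : ∀ κ ∈ S, (∀ i : Fin N, κ.rowLen i = η.rowLen i) ↔ κ = η := by
    intro κ hκ
    refine ⟨fun h => ?_, fun h i => by rw [h]⟩
    have hz : ∀ (ζ : YoungDiagram) (i : ℕ), ζ.colLen 0 ≤ i → ζ.rowLen i = 0 := by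
      intro ζ i hi
      by_contra hpos
      have : (i, 0) ∈ ζ := YoungDiagram.mem_iff_lt_rowLen.mpr (Nat.pos_of_ne_zero hpos)
      exact absurd (YoungDiagram.mem_iff_lt_colLen.mp this) (by omega)
    have hall : ∀ i, κ.rowLen i = η.rowLen i := by
      intro i
      by_cases hi : i < N
      · exact h ⟨i, hi⟩
      · rw [hz κ i ((hcol κ hκ).trans (not_lt.mp hi)), hz η i (by omega)]
    apply SetLike.ext
    rintro ⟨i, j⟩
    rw [YoungDiagram.mem_iff_lt_rowLen, YoungDiagram.mem_iff_lt_rowLen, hall]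
  have hc : ∀ d : YoungDiagram →₀ R, d.support ⊆ S →
      (∑ κ ∈ S, MvPolynomial.C (d κ) * alternant R N κ).coeff
        (∑ i : Fin N, Finsupp.single i (η.rowLen i + (N - 1 - (i : ℕ)))) = d η := by
    intro d hd
    rw [MvPolynomial.coeff_sum]
    simp only [MvPolynomial.coeff_C_mul, coeff_alternant]
    rw [Finset.sum_congr rfl fun κ hκ => by rw [if_congr (hiff κ hκ) rfl rfl]]
    simp only [mul_ite, mul_one, mul_zero, Finset.sum_ite_eq']
    split_ifs with hη
    · rfl
    · exact (Finsupp.notMem_support_iff.mp fun h => hη (hd h)).symm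
  rw [← hc c Finset.subset_union_left, e3, hc c' Finset.subset_union_right]

open Classical in
/-- The coefficient of the Schur function `s_κ` in the symmetric function `f` (which is unique
when `f` is a combination of Schur functions). -/
def schurCoeff {R : Type} [CommRing R] [IsDomain R] (f : (N : ℕ) → RatFun R N)
    (κ : YoungDiagram) : R :=
  if h : ∃ c, IsSchurExpansion f c then h.choose κ else 0

/-- The Littlewood–Richardson coefficient of `κ` and a multiset `M` of partitions: the coefficient
of `s_κ` in the product of the Schur functions `s_η`, `η ∈ M`. -/
def lr (κ : YoungDiagram) (M : Multiset YoungDiagram) : ℤ :=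
  schurCoeff (fun N => (M.map (schur ℤ N)).prod) κ

/-- The inverse Kostka polynomial `K⁻¹_{κη}(t)`: the coefficient of `s_η` in the Hall–Littlewood
function `P_κ(x; t)`, where `t` is an indeterminate. -/
def invKostka (κ η : YoungDiagram) : Polynomial ℤ :=
  schurCoeff (fun N => hallLittlewoodP (Polynomial ℤ) Polynomial.X N κ) η

/-! ### Bar-cores and bar-quotients -/

/-- The multiset of positive parts of a partition. -/
def parts (κ : YoungDiagram) : Multiset ℕ := (κ.rowLens : Multiset ℕ)

/-- The partition with a given multiset of parts (zero parts being ignored). -/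
def ofParts (m : Multiset ℕ) : YoungDiagram :=
  YoungDiagram.ofRowLens (m.sort (· ≥ ·)) (m.pairwise_sort (· ≥ ·)).sortedGE

/-- No repeated positive parts. -/
def IsStrict (κ : YoungDiagram) : Prop := (parts κ).Nodup

/-- Repeated parts are divisible by `p`. -/
def IsPStrict (p : ℕ) (κ : YoungDiagram) : Prop :=
  ∀ a ∈ parts κ, 2 ≤ (parts κ).count a → p ∣ a

/-- For all `r`, either `κ_r - κ_{r+1} < p`, or `κ_r - κ_{r+1} = p` and `p ∤ κ_r`. -/
def IsRestricted (p : ℕ) (κ : YoungDiagram) : Prop :=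
  ∀ r : ℕ, κ.rowLen r - κ.rowLen (r + 1) < p ∨
    (κ.rowLen r - κ.rowLen (r + 1) = p ∧ ¬ p ∣ κ.rowLen r)

/-- `η` is obtained from the `p`-strict partition `κ` by removing one `p`-bar: either a part
`a ≥ p` is replaced with `a - p`, where `p ∣ a` or `a - p` is not a part of `κ`, or two parts
with sum `p` are deleted. -/
def RemovesBar (p : ℕ) (κ η : YoungDiagram) : Prop :=
  (∃ a ∈ parts κ, p ≤ a ∧ (p ∣ a ∨ a - p ∉ parts κ) ∧
      η = ofParts ((a - p) ::ₘ (parts κ).erase a)) ∨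
    ∃ a b : ℕ, a + b = p ∧ ({a, b} : Multiset ℕ) ≤ parts κ ∧ η = ofParts (parts κ - {a, b})

/-- `η` is obtained from `κ` by successively removing `d` `p`-bars. -/
def RemovesBars (p : ℕ) : ℕ → YoungDiagram → YoungDiagram → Prop
  | 0, κ, η => κ = η
  | d + 1, κ, η => ∃ ζ, RemovesBar p κ ζ ∧ RemovesBars p d ζ η

/-- A `p`-bar-core: a `p`-strict partition from which no `p`-bar can be removed. -/
def IsBarCore (p : ℕ) (ρ : YoungDiagram) : Prop :=
  IsPStrict p ρ ∧ ∀ η, ¬ RemovesBar p ρ η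

/-- The set of `p`-strict partitions with `p`-bar-core `ρ` and `p`-bar-weight `d`. -/
def pStrictPartitions (p : ℕ) (ρ : YoungDiagram) (d : ℕ) : Set YoungDiagram :=
  {κ | IsPStrict p κ ∧ RemovesBars p d κ ρ ∧ IsBarCore p ρ}

/-- The strict partitions among them. -/
def strictPartitions (p : ℕ) (ρ : YoungDiagram) (d : ℕ) : Set YoungDiagram :=
  {κ | κ ∈ pStrictPartitions p ρ d ∧ IsStrict κ}

/-- The restricted partitions among them. -/
def restrictedPartitions (p : ℕ) (ρ : YoungDiagram) (d : ℕ) : Set YoungDiagram :=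
  {κ | κ ∈ pStrictPartitions p ρ d ∧ IsRestricted p κ}

/-- The parts of `κ` congruent to `i` modulo `p`. -/
def residueParts (p i : ℕ) (κ : YoungDiagram) : Multiset ℕ :=
  (parts κ).filter fun a => a ≡ i [MOD p]

/-- The `p`-bar-core `ρ` is `d`-Rouquier: `r_1(ρ) ≥ d`, and `r_i(ρ) ≥ r_{i-1}(ρ) + d - 1` for
`2 ≤ i ≤ ℓ`, where `p = 2ℓ + 1` and `r_i(ρ)` is the number of parts congruent to `i` modulo `p`. -/
def IsRouquier (p d : ℕ) (ρ : YoungDiagram) : Prop :=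
  d ≤ (residueParts p 1 ρ).card ∧
    ∀ i : ℕ, 2 ≤ i → i ≤ p / 2 →
      (residueParts p (i - 1) ρ).card + d - 1 ≤ (residueParts p i ρ).card

/-- The component `κ^{(i)}` of the `p`-bar-quotient, `0 ≤ i ≤ ℓ`. For `i = 0`, the parts divisible
by `p` are divided by `p`. For `i ≥ 1`, if `κ_{k_1} > … > κ_{k_r}` are the parts congruent to `i`,
then `κ^{(i)}` has the parts `(κ_{k_j} - (r - j) p - i) / p` for `j = 1, …, r`; here `r - j` is the
number of parts congruent to `i` that are smaller than `κ_{k_j}`. -/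
def barQuotient (p : ℕ) (κ : YoungDiagram) (i : ℕ) : YoungDiagram :=
  if i = 0 then ofParts ((residueParts p 0 κ).map fun a => a / p)
  else ofParts ((residueParts p i κ).map fun a =>
    (a - ((residueParts p i κ).filter (· < a)).card * p - i) / p)

/-- The number of positive parts. -/
def height (κ : YoungDiagram) : ℕ := (parts κ).card

/-- `0` or `1` according as the number of positive even parts is even or odd. -/
def parity (κ : YoungDiagram) : ℕ := ((parts κ).filter Even).card % 2

/-! ### The unadjusted Cartan matrix -/

/-- A sequence `f^{(0)}, …, f^{(n-1)}` of partitions, where `f^{(i)}` is read as the empty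
partition for `i ≥ n`. -/
def ext {n : ℕ} (f : Fin n → YoungDiagram) (i : ℕ) : YoungDiagram :=
  if h : i < n then f ⟨i, h⟩ else ⊥

/-- The sum
`∑ K⁻¹_{λ^{(0)} σ^{(0)}}(-1) ∏_{i=1}^ℓ c(λ^{(i)}; σ^{(i)}, τ^{(i)}) c(μ^{(i-1)}; σ^{(i-1)}, τ^{(i)}')`
over all partitions `σ^{(0)}, …, σ^{(ℓ-1)}, τ^{(1)}, …, τ^{(ℓ)}`, where `σ^{(ℓ)}` is read as the
empty partition. The value of the variable `τ` at `i` is `τ^{(i+1)}`. -/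
def decompSum (p : ℕ) (lam mu : YoungDiagram) : ℤ :=
  ∑ᶠ στ : (Fin (p / 2) → YoungDiagram) × (Fin (p / 2) → YoungDiagram),
    (invKostka (barQuotient p lam 0) (ext στ.1 0)).eval (-1) *
      ∏ i : Fin (p / 2),
        (lr (barQuotient p lam (i + 1)) {ext στ.1 (i + 1), στ.2 i} *
          lr (barQuotient p mu i) {στ.1 i, (στ.2 i).transpose})

/-- The integer `D_{λμ}`. -/
def D (p : ℕ) (lam mu : YoungDiagram) : ℤ :=
  2 ^ ((height (barQuotient p lam 0) + 1 - parity lam) / 2) * decompSum p lam mu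

/-- The integer `D°_{λμ}`. -/
def Dcirc (p : ℕ) (lam mu : YoungDiagram) : ℤ :=
  2 ^ ((height (barQuotient p lam 0) + parity lam) / 2) * decompSum p lam mu

/-- The unadjusted Cartan matrix entry `∑_λ D°_{λμ} D_{λν}`, summed over the strict partitions `λ`
with `p`-bar-core `ρ` and `p`-bar-weight `d`. -/
def unadjustedCartan (p : ℕ) (ρ : YoungDiagram) (d : ℕ) (mu nu : YoungDiagram) : ℤ :=
  ∑ᶠ lam ∈ strictPartitions p ρ d, Dcirc p lam mu * D p lam nu

/-- Four sequences `φ^{(i)}, ψ^{(i)}, χ^{(i)}, ω^{(i)}`, `0 ≤ i ≤ n - 1`, of partitions. -/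
structure PartitionQuad (n : ℕ) where
  φ : Fin n → YoungDiagram
  ψ : Fin n → YoungDiagram
  χ : Fin n → YoungDiagram
  ω : Fin n → YoungDiagram

end

end SpinRoCK

/-!
The entry of the Cartan matrix is computed by summing over `λ` first.

*The block on the abacus.* A `p`-bar moves a part down its runner (residue class modulo `p`) or
deletes two parts on complementary runners. Because `ρ` is `d`-Rouquier, adding `d` bars to `ρ` can
only move parts along the runners `0, …, ℓ` (`mem_pStrictPartitions_iff`). Hence `λ` is determined
by its bar-quotient, the bar-quotient of a strict `λ` is an arbitrary sequence of partitions of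
total size `d` with a strict zeroth member (`exists_barQuotient_eq`), and for a restricted `μ` its
last member is empty (`barQuotient_eq_bot_of_restricted`). Moreover `D°_{λμ} D_{λν}` is
`2 ^ h(λ^{(0)}) S_{λμ} S_{λν}`, so that the sum over `λ` is a product of independent sums over the
members of the bar-quotient.

*The sums over the members.* For `i ≥ 1` the sum over `λ^{(i)}` is the scalar product of
`s_σ s_τ` and `s_σ' s_τ'`, which the coproduct expresses in terms of Littlewood–Richardson
coefficients (`sum_lr_mul_lr`). For `i = 0` it is
`∑_κ 2 ^ h(κ) K⁻¹_{κσ}(-1) K⁻¹_{κτ}(-1)`, the sum being over strict `κ`. At `t = -1` the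
Hall–Littlewood function of a strict partition is a Schur P-function (`hlAt_neg_one_eq_pfun`), and
by the Cauchy identity `∑_κ 2 ^ h(κ) P_κ(x) P_κ(y) = ∏ (1 + x_i y_j) / (1 - x_i y_j)`
(`sum_strictSets_pfun`) this sum is the coefficient of `s_σ(x) s_τ(y)` in the product on the right;
expanding that product by the ordinary and the dual Cauchy identity gives
`∑_{α, β} c(σ; α', β) c(τ; α, β)` (`sum_strict_invKostka`).

*The right-hand side.* Splitting each coefficient `c(μ^{(i)}; φ, χ, ψ', ω)` as a sum of products of
three coefficients with two partitions each (`lr_four_eq`) leads to the same expression,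
`pairingSum`.

Symmetric functions are handled through Jacobi–Trudi determinants: `jt H κ` is the determinant in
the coefficients of a power series `H`, and Schur polynomials are the case
`H = ∏ 1 / (1 - x_i T)`. Conjugation then amounts to replacing `1 / (1 - xT)` with `1 + xT`
(`jt_prod_linear`), and the expansion of a symmetric polynomial is obtained from its product with
the Vandermonde determinant, which is alternating (`exists_stable_expansion`). The Cauchy identity
for Schur P-functions is proved by induction on the number of variables `y`, from the branching rule
`pfun_insert_eq_sum`.
-/

namespace SpinRoCK

/-! ### Young diagrams of bounded size and strips -/

theorem youngDiagram_ext_rowLen {κ η : YoungDiagram} (h : ∀ i, κ.rowLen i = η.rowLen i) :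
    κ = η := by
  apply SetLike.ext
  rintro ⟨i, j⟩
  rw [YoungDiagram.mem_iff_lt_rowLen, YoungDiagram.mem_iff_lt_rowLen, h]

/-- The partition with parts `f 0 ≥ f 1 ≥ …`, where `f` vanishes from `N` on. -/
def ofAntitone (f : ℕ → ℕ) (hf : Antitone f) (N : ℕ) : YoungDiagram where
  cells := (Finset.range N ×ˢ Finset.range (f 0)).filter fun c => c.2 < f c.1
  isLowerSet := by
    rintro ⟨i, j⟩ ⟨i', j'⟩ hle h
    obtain ⟨h1, h2⟩ : i' ≤ i ∧ j' ≤ j := hle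
    simp only [Finset.coe_filter, Finset.mem_product, Finset.mem_range, Set.mem_ofPred_eq] at h ⊢
    have := hf h1
    omega

theorem rowLen_ofAntitone {f : ℕ → ℕ} (hf : Antitone f) {N : ℕ} (hN : f N = 0) (i : ℕ) :
    (ofAntitone f hf N).rowLen i = f i := by
  have key : ∀ j, j < (ofAntitone f hf N).rowLen i ↔ j < f i := by
    intro j
    rw [← YoungDiagram.mem_iff_lt_rowLen, ← YoungDiagram.mem_cells]
    simp only [ofAntitone, Finset.mem_filter, Finset.mem_product, Finset.mem_range]
    have h0 := hf (Nat.zero_le i)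
    refine ⟨fun h => h.2, fun h => ⟨⟨?_, by omega⟩, h⟩⟩
    by_contra hc
    have := hf (not_lt.mp hc)
    omega
  have h1 := key (f i)
  have h2 := key ((ofAntitone f hf N).rowLen i)
  omega

theorem rowLen_eq_zero_iff {κ : YoungDiagram} {i : ℕ} : κ.rowLen i = 0 ↔ κ.colLen 0 ≤ i := by
  have h1 : (i, 0) ∈ κ ↔ 0 < κ.rowLen i := YoungDiagram.mem_iff_lt_rowLen
  have h2 : (i, 0) ∈ κ ↔ i < κ.colLen 0 := YoungDiagram.mem_iff_lt_colLen
  have := h1.symm.trans h2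
  omega

theorem card_eq_sum_rowLen {κ : YoungDiagram} {N : ℕ} (h : κ.colLen 0 ≤ N) :
    κ.card = ∑ i : Fin N, κ.rowLen i := by
  rw [Fin.sum_univ_eq_sum_range (fun i => κ.rowLen i) N, YoungDiagram.card,
    Finset.card_eq_sum_card_fiberwise (f := Prod.fst) (t := Finset.range N)]
  · refine Finset.sum_congr rfl fun i _ => ?_
    rw [YoungDiagram.rowLen_eq_card]
    rfl
  · rintro ⟨i, j⟩ hc
    have h1 : (i, j) ∈ κ := hc
    have h2 := κ.up_left_mem le_rfl (Nat.zero_le j) h1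
    rw [YoungDiagram.mem_iff_lt_colLen] at h2
    simp only [Finset.coe_range, Set.mem_Iio]
    omega

theorem colLen_le_card (κ : YoungDiagram) : κ.colLen 0 ≤ κ.card := by
  rw [YoungDiagram.colLen_eq_card]
  exact Finset.card_le_card (Finset.filter_subset _ _)

theorem card_transpose (κ : YoungDiagram) : κ.transpose.card = κ.card := by
  unfold YoungDiagram.card
  refine Finset.card_bij (fun c _ => c.swap) ?_ ?_ ?_
  · intro c hc
    exact YoungDiagram.mem_transpose.mp hc
  · intro a _ b _ h
    exact Prod.swap_injective h
  · intro b hb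
    exact ⟨b.swap, YoungDiagram.mem_transpose.mpr (by simpa using hb), by simp⟩

theorem card_mono {κ η : YoungDiagram} (h : κ ≤ η) : κ.card ≤ η.card :=
  Finset.card_le_card (YoungDiagram.cells_subset_iff.mpr h)

theorem card_eq_zero_iff {κ : YoungDiagram} : κ.card = 0 ↔ κ = ⊥ := by
  rw [YoungDiagram.card, Finset.card_eq_zero]
  refine ⟨fun h => YoungDiagram.ext (by simpa using h), fun h => by simp [h]⟩

theorem card_bot : (⊥ : YoungDiagram).card = 0 := card_eq_zero_iff.mpr rfl

theorem rowLen_bot (i : ℕ) : (⊥ : YoungDiagram).rowLen i = 0 := by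
  by_contra h
  exact YoungDiagram.notMem_bot (i, 0) (YoungDiagram.mem_iff_lt_rowLen.mpr (Nat.pos_of_ne_zero h))

theorem transpose_bot : (⊥ : YoungDiagram).transpose = ⊥ := by
  rw [← card_eq_zero_iff, card_transpose, card_bot]

theorem finite_card_le (m : ℕ) : {κ : YoungDiagram | κ.card ≤ m}.Finite := by
  have hf := Finset.finite_toSet ((Finset.range (m + 1) ×ˢ Finset.range (m + 1)).powerset)
  refine Set.Finite.of_finite_image (f := YoungDiagram.cells) (hf.subset ?_)
    fun a _ b _ h => YoungDiagram.ext h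
  rintro _ ⟨κ, hκ, rfl⟩
  simp only [Finset.coe_powerset, Set.mem_preimage, Set.mem_powerset_iff, Finset.coe_subset]
  rintro ⟨i, j⟩ hc
  have hc' : (i, j) ∈ κ := hc
  have h1 := κ.up_left_mem le_rfl (Nat.zero_le j) hc'
  have h2 := κ.up_left_mem (Nat.zero_le i) le_rfl hc'
  rw [YoungDiagram.mem_iff_lt_colLen] at h1
  rw [YoungDiagram.mem_iff_lt_rowLen, ← YoungDiagram.colLen_transpose] at h2
  have h3 := colLen_le_card κ
  have h4 := colLen_le_card κ.transpose
  rw [card_transpose] at h4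
  have : κ.card ≤ m := hκ
  simp only [Finset.mem_product, Finset.mem_range]
  omega

/-- The partitions of size at most `m`. -/
noncomputable def partitionsLE (m : ℕ) : Finset YoungDiagram := (finite_card_le m).toFinset

@[simp] theorem mem_partitionsLE {m : ℕ} {κ : YoungDiagram} :
    κ ∈ partitionsLE m ↔ κ.card ≤ m := by
  simp [partitionsLE]

/-- `κ / η` is a vertical strip: at most one box in each row. -/
def IsVertStrip (κ η : YoungDiagram) : Prop :=
  η ≤ κ ∧ ∀ i j, (i, j + 1) ∈ κ → (i, j) ∈ η

/-- `κ / η` is a horizontal strip: at most one box in each column. -/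
def IsHorizStrip (κ η : YoungDiagram) : Prop :=
  η ≤ κ ∧ ∀ i j, (i + 1, j) ∈ κ → (i, j) ∈ η

theorem isHorizStrip_transpose {κ η : YoungDiagram} :
    IsHorizStrip κ.transpose η.transpose ↔ IsVertStrip κ η := by
  simp only [IsHorizStrip, IsVertStrip, YoungDiagram.transpose_le_iff, YoungDiagram.mem_transpose,
    Prod.swap_prod_mk]
  exact and_congr_right fun _ => forall_comm

theorem le_iff_rowLen {κ η : YoungDiagram} : η ≤ κ ↔ ∀ i, η.rowLen i ≤ κ.rowLen i := by
  constructor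
  · intro h i
    by_contra hc
    have h1 : (i, κ.rowLen i) ∈ η := YoungDiagram.mem_iff_lt_rowLen.mpr (not_le.mp hc)
    have h2 : (i, κ.rowLen i) ∈ κ := h h1
    rw [YoungDiagram.mem_iff_lt_rowLen] at h2
    omega
  · rintro h ⟨i, j⟩ hc
    have h1 : (i, j) ∈ η := hc
    change (i, j) ∈ κ
    rw [YoungDiagram.mem_iff_lt_rowLen] at h1 ⊢
    have := h i
    omega

theorem isVertStrip_iff {κ η : YoungDiagram} :
    IsVertStrip κ η ↔ ∀ i, η.rowLen i ≤ κ.rowLen i ∧ κ.rowLen i ≤ η.rowLen i + 1 := by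
  rw [IsVertStrip, le_iff_rowLen, forall_and]
  refine and_congr_right fun _ => ?_
  simp only [YoungDiagram.mem_iff_lt_rowLen]
  refine ⟨fun h i => ?_, fun h i j hj => by have := h i; omega⟩
  have := h i (κ.rowLen i - 2)
  omega

/-- Horizontal strips on top of vertical strips cancel: the box at the end of the lowest row of
`η` that differs from the row of `κ` can be moved between the two strips. -/
theorem sum_horizStrip_vertStrip (m : ℕ) (κ η : YoungDiagram) (hκ : κ.card ≤ m) :
    (∑ ζ ∈ partitionsLE m, open Classical in
      if IsHorizStrip κ ζ ∧ IsVertStrip ζ η then (-1 : ℤ) ^ (ζ.card + η.card) else 0) =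
      open Classical in if κ = η then 1 else 0 := by
  classical
  by_cases hκη : κ = η
  · subst hκη
    rw [if_pos rfl, Finset.sum_eq_single κ]
    · rw [if_pos ⟨⟨le_rfl, fun i j h => κ.up_left_mem (Nat.le_succ i) le_rfl h⟩,
        ⟨le_rfl, fun i j h => κ.up_left_mem le_rfl (Nat.le_succ j) h⟩⟩, ← two_mul, pow_mul]
      simp
    · intro ζ _ hne
      refine if_neg fun h => hne (le_antisymm h.1.1 h.2.1)
    · intro h
      exact absurd (mem_partitionsLE.mpr hκ) h
  rw [if_neg hκη]
  by_cases hle : η ≤ κ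
  swap
  · exact Finset.sum_eq_zero fun ζ _ => if_neg fun h => hle (h.2.1.trans h.1.1)
  -- the lowest row in which `κ` and `η` differ
  obtain ⟨i, hi, himax⟩ : ∃ i, η.rowLen i < κ.rowLen i ∧
      ∀ i', i < i' → κ.rowLen i' = η.rowLen i' := by
    have hr := le_iff_rowLen.mp hle
    set s := (Finset.range (κ.colLen 0)).filter fun i => η.rowLen i < κ.rowLen i with hs
    have hne : s.Nonempty := by
      by_contra hemp
      rw [Finset.not_nonempty_iff_eq_empty] at hemp
      refine hκη (youngDiagram_ext_rowLen fun i => ?_)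
      by_contra hne
      have : i ∈ s := by
        rw [hs, Finset.mem_filter, Finset.mem_range]
        have h1 := hr i
        refine ⟨?_, by omega⟩
        by_contra hc
        have := rowLen_eq_zero_iff.mpr (not_lt.mp hc)
        omega
      simp [hemp] at this
    refine ⟨s.max' hne, (Finset.mem_filter.mp (s.max'_mem hne)).2, fun i' hi' => ?_⟩
    by_contra hc
    have h1 := hr i'
    have : i' ∈ s := by
      rw [hs, Finset.mem_filter, Finset.mem_range]
      refine ⟨?_, by omega⟩
      by_contra hc
      have := rowLen_eq_zero_iff.mpr (not_lt.mp hc)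
      omega
    exact absurd (s.le_max' i' this) (not_le.mpr hi')
  -- the box to be moved: the leftmost box of `κ / η` in that row
  set c : ℕ × ℕ := (i, η.rowLen i) with hc
  have hcκ : c ∈ κ := YoungDiagram.mem_iff_lt_rowLen.mpr hi
  have hcη : c ∉ η := by
    rw [hc, YoungDiagram.mem_iff_lt_rowLen]
    omega
  have hbelow : ∀ i' j', i < i' → ((i', j') ∈ κ ↔ (i', j') ∈ η) := fun i' j' h => by
    rw [YoungDiagram.mem_iff_lt_rowLen, YoungDiagram.mem_iff_lt_rowLen, himax i' h]
  have hlow : ∀ ζ : YoungDiagram, IsHorizStrip κ ζ ∧ IsVertStrip ζ η → c ∉ ζ →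
      IsLowerSet ((insert c ζ.cells : Finset (ℕ × ℕ)) : Set (ℕ × ℕ)) := by
    rintro ζ ⟨h1, h2⟩ _ ⟨a, b⟩ ⟨a', b'⟩ hle' hab
    obtain ⟨ha, hb⟩ : a' ≤ a ∧ b' ≤ b := hle'
    simp only [Finset.coe_insert, Set.mem_insert_iff, Finset.mem_coe, YoungDiagram.mem_cells]
      at hab ⊢
    rcases hab with hab | hab
    · rw [hc, Prod.mk.injEq] at hab
      obtain ⟨rfl, rfl⟩ := hab
      rcases ha.lt_or_eq with ha | rfl
      · exact Or.inr (h1.2 a' b' (κ.up_left_mem (Nat.succ_le_of_lt ha) hb hcκ))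
      · rcases hb.lt_or_eq with hb | rfl
        · exact Or.inr (h2.1 (YoungDiagram.mem_iff_lt_rowLen.mpr hb))
        · exact Or.inl rfl
    · exact Or.inr (ζ.up_left_mem ha hb hab)
  have hlow' : ∀ ζ : YoungDiagram, IsHorizStrip κ ζ ∧ IsVertStrip ζ η →
      IsLowerSet ((ζ.cells.erase c : Finset (ℕ × ℕ)) : Set (ℕ × ℕ)) := by
    rintro ζ ⟨h1, h2⟩ ⟨a, b⟩ ⟨a', b'⟩ hle' hab
    obtain ⟨ha, hb⟩ : a' ≤ a ∧ b' ≤ b := hle'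
    simp only [Finset.coe_erase, Set.mem_sdiff, Finset.mem_coe, YoungDiagram.mem_cells,
      Set.mem_singleton_iff] at hab ⊢
    refine ⟨ζ.up_left_mem ha hb hab.1, ?_⟩
    intro hcc
    rw [hc, Prod.mk.injEq] at hcc
    obtain ⟨rfl, rfl⟩ := hcc
    rcases ha.lt_or_eq with ha | rfl
    · have h3 : (a, b) ∈ η := (hbelow a b ha).mp (h1.1 hab.1)
      exact hcη (η.up_left_mem ha.le hb h3)
    · have hb' : η.rowLen a' < b := lt_of_le_of_ne hb fun h => hab.2 (by rw [hc, h])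
      exact hcη (h2.2 a' _ (ζ.up_left_mem le_rfl (Nat.succ_le_of_lt hb') hab.1))
  -- the sign-reversing involution: add `c` to `ζ`, or remove it
  let g : YoungDiagram → YoungDiagram := fun ζ =>
    if h : IsHorizStrip κ ζ ∧ IsVertStrip ζ η then
      if h' : c ∈ ζ then ⟨ζ.cells.erase c, hlow' ζ h⟩ else ⟨insert c ζ.cells, hlow ζ h h'⟩
    else ζ
  have hmem : ∀ ζ (_ : IsHorizStrip κ ζ ∧ IsVertStrip ζ η) x,
      x ∈ g ζ ↔ if x = c then c ∉ ζ else x ∈ ζ := by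
    intro ζ h x
    by_cases h' : c ∈ ζ
    · simp only [g, dif_pos h, dif_pos h', YoungDiagram.mem_mk, Finset.mem_erase,
        YoungDiagram.mem_cells]
      split_ifs with hx <;> simp [hx, h']
    · simp only [g, dif_pos h, dif_neg h', YoungDiagram.mem_mk, Finset.mem_insert,
        YoungDiagram.mem_cells]
      split_ifs with hx <;> simp [hx, h']
  have hgood : ∀ ζ, IsHorizStrip κ ζ ∧ IsVertStrip ζ η →
      IsHorizStrip κ (g ζ) ∧ IsVertStrip (g ζ) η := by
    intro ζ h
    refine ⟨⟨fun x hx => ?_, fun a b hab => ?_⟩, ⟨fun x hx => ?_, fun a b hab => ?_⟩⟩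
    · have hx' := (hmem ζ h x).mp hx
      split_ifs at hx' with hxc
      · rw [hxc]; exact hcκ
      · exact h.1.1 hx'
    · rw [hmem ζ h]
      split_ifs with hxc
      · rw [hc, Prod.mk.injEq] at hxc
        obtain ⟨rfl, rfl⟩ := hxc
        exact absurd (η.up_left_mem (Nat.le_succ _) le_rfl
          ((hbelow _ _ (Nat.lt_succ_self _)).mp hab)) hcη
      · exact h.1.2 a b hab
    · rw [hmem ζ h]
      have hx' : x ∈ η := hx
      rw [if_neg fun hxc : x = c => hcη (hxc ▸ hx')]
      exact h.2.1 hx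
    · rw [hmem ζ h] at hab
      split_ifs at hab with hxc
      · rw [hc, Prod.mk.injEq] at hxc
        obtain ⟨rfl, h3⟩ := hxc
        rw [YoungDiagram.mem_iff_lt_rowLen]
        omega
      · exact h.2.2 a b hab
  have hcardg : ∀ ζ, IsHorizStrip κ ζ ∧ IsVertStrip ζ η →
      (g ζ).card = ζ.card + 1 ∨ (g ζ).card + 1 = ζ.card := by
    intro ζ h
    by_cases h' : c ∈ ζ
    · right
      simp only [g, dif_pos h, dif_pos h']
      exact Finset.card_erase_add_one h'
    · left
      simp only [g, dif_pos h, dif_neg h']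
      exact Finset.card_insert_of_notMem h'
  refine Finset.sum_involution (fun ζ _ => g ζ) ?_ ?_ ?_ ?_
  · intro ζ _
    by_cases h : IsHorizStrip κ ζ ∧ IsVertStrip ζ η
    · rw [if_pos h, if_pos (hgood ζ h)]
      rcases hcardg ζ h with h1 | h1
      · rw [h1]; ring
      · rw [← h1]; ring
    · have : g ζ = ζ := dif_neg h
      rw [this, if_neg h, add_zero]
  · intro ζ _ hne heq
    by_cases h : IsHorizStrip κ ζ ∧ IsVertStrip ζ η
    · have := hcardg ζ h
      rw [heq] at this
      omega
    · exact hne (if_neg h)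
  · intro ζ hζ
    by_cases h : IsHorizStrip κ ζ ∧ IsVertStrip ζ η
    · exact mem_partitionsLE.mpr ((card_mono (hgood ζ h).1.1).trans hκ)
    · have : g ζ = ζ := dif_neg h
      rwa [this]
  · intro ζ _
    by_cases h : IsHorizStrip κ ζ ∧ IsVertStrip ζ η
    · apply SetLike.ext
      intro x
      rw [hmem _ (hgood ζ h)]
      split_ifs with hx
      · rw [hmem ζ h, if_pos rfl, not_not, hx]
      · rw [hmem ζ h, if_neg hx]
    · have : g ζ = ζ := dif_neg h
      rw [this, this]

/-! ### Schur functions of a specialization -/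

section JacobiTrudi

variable {A : Type*} [CommRing A]

/-- The coefficients of a power series, indexed by all integers. -/
noncomputable def intCoeff (H : PowerSeries A) (k : ℤ) : A :=
  if 0 ≤ k then PowerSeries.coeff k.toNat H else 0

theorem intCoeff_natCast (H : PowerSeries A) (k : ℕ) :
    intCoeff H (k : ℤ) = PowerSeries.coeff k H := by
  simp [intCoeff]

theorem intCoeff_of_neg (H : PowerSeries A) {k : ℤ} (hk : k < 0) : intCoeff H k = 0 := by
  rw [intCoeff, if_neg (not_le.mpr hk)]

/-- The Jacobi–Trudi matrix `(h_{f_i - i + j})` where the `h_k` are the coefficients of `H`. -/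
noncomputable def jtMatrix (H : PowerSeries A) (N : ℕ) (f : ℕ → ℤ) : Matrix (Fin N) (Fin N) A :=
  Matrix.of fun i j => intCoeff H (f i - i + j)

/-- The value of the Schur function `s_κ` at the specialization which sends the complete symmetric
functions `h_k` to the coefficients of `H`, given by the Jacobi–Trudi determinant. -/
noncomputable def jt (H : PowerSeries A) (κ : YoungDiagram) : A :=
  (jtMatrix H (κ.colLen 0) fun i => κ.rowLen i).det

theorem det_jtMatrix_succ {H : PowerSeries A} (h0 : PowerSeries.coeff 0 H = 1) {N : ℕ}
    {f : ℕ → ℤ} (hf : f N = 0) :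
    (jtMatrix H (N + 1) f).det = (jtMatrix H N f).det := by
  have hlast : ∀ j : Fin (N + 1), j ≠ Fin.last N → jtMatrix H (N + 1) f (Fin.last N) j = 0 := by
    intro j hj
    have : (j : ℕ) < N := by
      have := j.2
      have : (j : ℕ) ≠ N := fun h => hj (Fin.ext h)
      omega
    simp only [jtMatrix, Matrix.of_apply, Fin.val_last, hf]
    exact intCoeff_of_neg H (by omega)
  rw [Matrix.det_succ_row _ (Fin.last N), Finset.sum_eq_single (Fin.last N)]
  · have h1 : jtMatrix H (N + 1) f (Fin.last N) (Fin.last N) = 1 := by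
      simp only [jtMatrix, Matrix.of_apply, Fin.val_last, hf]
      rw [show (0 : ℤ) - N + N = ((0 : ℕ) : ℤ) by simp, intCoeff_natCast, h0]
    rw [h1, ← two_mul, pow_mul]
    simp only [even_two, Even.neg_pow, one_pow, mul_one, one_mul]
    congr 1
    ext i j
    simp [jtMatrix, Fin.succAbove_last]
  · intro j _ hj
    rw [hlast j hj]
    ring
  · simp

theorem jt_eq_det {H : PowerSeries A} (h0 : PowerSeries.coeff 0 H = 1) {κ : YoungDiagram} {N : ℕ}
    (hN : κ.colLen 0 ≤ N) : jt H κ = (jtMatrix H N fun i => κ.rowLen i).det := by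
  induction N, hN using Nat.le_induction with
  | base => rfl
  | succ n hn ih =>
    rw [ih, det_jtMatrix_succ h0]
    simpa using rowLen_eq_zero_iff.mpr hn

theorem jt_bot (H : PowerSeries A) : jt H ⊥ = 1 := by
  have h : (⊥ : YoungDiagram).colLen 0 = 0 := by
    have := colLen_le_card ⊥
    rw [card_bot] at this
    omega
  rw [jt]
  have : IsEmpty (Fin ((⊥ : YoungDiagram).colLen 0)) := by rw [h]; infer_instance
  exact Matrix.det_isEmpty

theorem intCoeff_map {B : Type*} [CommRing B] (φ : A →+* B) (H : PowerSeries A) (k : ℤ) :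
    intCoeff (PowerSeries.map φ H) k = φ (intCoeff H k) := by
  unfold intCoeff
  split_ifs <;> simp

theorem jt_map {B : Type*} [CommRing B] (φ : A →+* B) (H : PowerSeries A) (κ : YoungDiagram) :
    jt (PowerSeries.map φ H) κ = φ (jt H κ) := by
  rw [jt, jt, RingHom.map_det]
  congr 1
  ext i j
  simp [jtMatrix, intCoeff_map]

/-- The geometric series `1 / (1 - aT)`. -/
noncomputable def geo (a : A) : PowerSeries A := PowerSeries.mk fun n => a ^ n

@[simp] theorem coeff_geo (a : A) (n : ℕ) : PowerSeries.coeff n (geo a) = a ^ n := by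
  simp [geo]

theorem geo_mul (a : A) : geo a * (1 + PowerSeries.C (-a) * PowerSeries.X) = 1 := by
  ext n
  rw [mul_add, mul_one, map_add, ← mul_assoc]
  cases n with
  | zero => simp
  | succ n =>
    rw [PowerSeries.coeff_succ_mul_X, PowerSeries.coeff_mul_C, coeff_geo, coeff_geo,
      PowerSeries.coeff_one, if_neg (Nat.succ_ne_zero n)]
    ring

theorem map_geo {B : Type*} [CommRing B] (φ : A →+* B) (a : A) :
    PowerSeries.map φ (geo a) = geo (φ a) := by
  ext n
  simp

theorem coeff_zero_geo (a : A) : PowerSeries.coeff 0 (geo a) = 1 := by simp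

theorem coeff_zero_prod_geo {ι : Type*} (s : Finset ι) (y : ι → A) :
    PowerSeries.coeff 0 (∏ i ∈ s, geo (y i)) = 1 := by
  rw [PowerSeries.coeff_zero_eq_constantCoeff, map_prod]
  exact Finset.prod_eq_one fun i _ => by simp [← PowerSeries.coeff_zero_eq_constantCoeff_apply]

theorem coeff_prod_linear_eq_zero {ι : Type*} (s : Finset ι) (y : ι → A) {n : ℕ}
    (hn : s.card < n) :
    PowerSeries.coeff n (∏ i ∈ s, (1 + PowerSeries.C (y i) * PowerSeries.X)) = 0 := by
  classical
  induction s using Finset.induction_on generalizing n with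
  | empty =>
    rw [Finset.prod_empty, PowerSeries.coeff_one, if_neg]
    rintro rfl
    simp at hn
  | insert i s hi ih =>
    rw [Finset.card_insert_of_notMem hi] at hn
    obtain ⟨n, rfl⟩ : ∃ k, n = k + 1 := ⟨n - 1, by omega⟩
    rw [Finset.prod_insert hi, add_mul, one_mul, map_add, ih (by omega), zero_add,
      mul_right_comm, PowerSeries.coeff_succ_mul_X, PowerSeries.coeff_C_mul, ih (by omega),
      mul_zero]

/-- The alternant of `κ` at the elements `x_1, …, x_N` of a commutative ring. -/
noncomputable def altAt {N : ℕ} (x : Fin N → A) (κ : YoungDiagram) : A :=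
  (Matrix.of fun i j : Fin N => x i ^ (κ.rowLen j + (N - 1 - (j : ℕ)))).det

/-- The Jacobi–Trudi identity: a bialternant is a Jacobi–Trudi determinant. It holds because
`y_i ^ α = ∑_k h_{α - N + 1 + k} c_{k,i}`, where `c_{k,i}` does not depend on `α`. -/
theorem altAt_eq_mul_jt {N : ℕ} (y : Fin N → A) {κ : YoungDiagram} (hκ : κ.colLen 0 ≤ N) :
    altAt y κ = altAt y ⊥ * jt (∏ j, geo (y j)) κ := by
  classical
  set H : PowerSeries A := ∏ j, geo (y j) with hH
  -- `E i` generates the elementary symmetric functions of the other elements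
  set E : Fin N → PowerSeries A := fun i =>
    ∏ j ∈ Finset.univ.erase i, (1 + PowerSeries.C (-y j) * PowerSeries.X) with hE
  have hHE : ∀ i, H * E i = geo (y i) := by
    intro i
    rw [hH, ← Finset.mul_prod_erase _ _ (Finset.mem_univ i), mul_assoc, hE,
      ← Finset.prod_mul_distrib, Finset.prod_eq_one fun j _ => geo_mul (y j), mul_one]
  have hE0 : ∀ i b, N ≤ b → PowerSeries.coeff b (E i) = 0 := by
    intro i b hb
    refine coeff_prod_linear_eq_zero _ (fun j => -y j) ?_
    rw [Finset.card_erase_of_mem (Finset.mem_univ i), Finset.card_univ, Fintype.card_fin]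
    have := i.2
    omega
  have hpow : ∀ i (a : ℕ), y i ^ a = ∑ k : Fin N,
      intCoeff H (a - (N - 1 : ℕ) + k) * PowerSeries.coeff (N - 1 - (k : ℕ)) (E i) := by
    intro i a
    have h1 : y i ^ a = ∑ b ∈ Finset.range (a + 1),
        intCoeff H (a - b) * PowerSeries.coeff b (E i) := by
      rw [← coeff_geo, ← hHE i, PowerSeries.coeff_mul,
        Finset.Nat.sum_antidiagonal_eq_sum_range_succ_mk, ← Finset.sum_range_reflect]
      refine Finset.sum_congr rfl fun b hb => ?_
      have hb' := Finset.mem_range.mp hb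
      rw [← Nat.cast_sub (by omega), intCoeff_natCast]
      congr 3
      omega
    have h2 : ∑ k : Fin N,
        intCoeff H (a - (N - 1 : ℕ) + k) * PowerSeries.coeff (N - 1 - (k : ℕ)) (E i) =
        ∑ b ∈ Finset.range N, intCoeff H (a - b) * PowerSeries.coeff b (E i) := by
      rw [Fin.sum_univ_eq_sum_range (fun k => intCoeff H (a - (N - 1 : ℕ) + k) *
        PowerSeries.coeff (N - 1 - k) (E i)) N, ← Finset.sum_range_reflect]
      refine Finset.sum_congr rfl fun b hb => ?_
      have hb' := Finset.mem_range.mp hb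
      congr 2
      · omega
      · congr 1
        omega
    rw [h1, h2]
    have h3 : ∀ M, N ≤ M → a + 1 ≤ M → ∑ b ∈ Finset.range (a + 1),
        intCoeff H (a - b) * PowerSeries.coeff b (E i) = ∑ b ∈ Finset.range M,
        intCoeff H (a - b) * PowerSeries.coeff b (E i) := by
      intro M _ hM
      refine Finset.sum_subset (Finset.range_mono hM) fun b _ hb => ?_
      rw [Finset.mem_range] at hb
      rw [intCoeff_of_neg H (by omega), zero_mul]
    rw [h3 (N + a + 1) (by omega) (by omega)]
    refine (Finset.sum_subset (Finset.range_mono (by omega)) fun b _ hb => ?_).symm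
    rw [Finset.mem_range] at hb
    rw [hE0 i b (by omega), mul_zero]
  set M : Matrix (Fin N) (Fin N) A :=
    Matrix.of fun k i => PowerSeries.coeff (N - 1 - (k : ℕ)) (E i) with hM
  have hH0 : PowerSeries.coeff 0 H = 1 := coeff_zero_prod_geo _ _
  have key : ∀ η : YoungDiagram, η.colLen 0 ≤ N → altAt y η = jt H η * M.det := by
    intro η hη
    rw [jt_eq_det hH0 hη, ← Matrix.det_mul, ← Matrix.det_transpose, altAt]
    congr 1
    ext i j
    rw [Matrix.of_apply, Matrix.transpose_apply, Matrix.mul_apply, hpow]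
    refine Finset.sum_congr rfl fun k _ => ?_
    simp only [jtMatrix, hM, Matrix.of_apply]
    congr 2
    have := j.2
    push_cast
    omega
  have hbot : (⊥ : YoungDiagram).colLen 0 ≤ N := by
    have := colLen_le_card ⊥
    rw [card_bot] at this
    omega
  rw [key κ hκ, key ⊥ hbot, jt_bot]
  ring

/-! ### Adding one variable to a specialization -/

theorem intCoeff_mul_linear (H : PowerSeries A) (u : A) (k : ℤ) :
    intCoeff (H * (1 + PowerSeries.C u * PowerSeries.X)) k =
      intCoeff H k + u * intCoeff H (k - 1) := by
  rcases lt_or_ge k 0 with hk | hk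
  · rw [intCoeff_of_neg _ hk, intCoeff_of_neg _ hk, intCoeff_of_neg _ (by omega)]
    ring
  obtain ⟨k, rfl⟩ := Int.eq_ofNat_of_zero_le hk
  rw [intCoeff_natCast, intCoeff_natCast, mul_add, mul_one, map_add, ← mul_assoc]
  cases k with
  | zero =>
    rw [intCoeff_of_neg _ (by simp)]
    simp [PowerSeries.coeff_zero_mul_X]
  | succ k =>
    rw [PowerSeries.coeff_succ_mul_X, PowerSeries.coeff_mul_C, mul_comm u,
      show ((k + 1 : ℕ) : ℤ) - 1 = (k : ℕ) by push_cast; ring, intCoeff_natCast]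

open Classical in
/-- Multiplying the specialization by `1 + uT` adds vertical strips. The determinant is expanded
in its rows; a choice of one summand in each row gives two equal rows, or a zero row, unless the
chosen boxes form a vertical strip. -/
theorem jt_mul_linear {H : PowerSeries A} (h0 : PowerSeries.coeff 0 H = 1) (u : A)
    (κ : YoungDiagram) {m : ℕ} (hm : κ.card ≤ m) :
    jt (H * (1 + PowerSeries.C u * PowerSeries.X)) κ = ∑ η ∈ partitionsLE m,
      if IsVertStrip κ η then u ^ (κ.card - η.card) * jt H η else 0 := by
  set N := κ.colLen 0 with hN
  have h0' : PowerSeries.coeff 0 (H * (1 + PowerSeries.C u * PowerSeries.X)) = 1 := by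
    have := intCoeff_mul_linear H u ((0 : ℕ) : ℤ)
    rw [intCoeff_natCast, intCoeff_natCast, intCoeff_of_neg _ (by simp), h0] at this
    rw [this]
    ring
  -- the rows of `κ` outside `s` lose a box
  let f : Finset (Fin N) → ℕ → ℤ := fun s i =>
    if h : i < N then κ.rowLen i - (if (⟨i, h⟩ : Fin N) ∈ s then 0 else 1) else 0
  have hf : ∀ s (i : Fin N), f s i = κ.rowLen i - (if i ∈ s then 0 else 1) := by
    intro s i
    simp only [f, dif_pos i.2]
  have hexp : jt (H * (1 + PowerSeries.C u * PowerSeries.X)) κ =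
      ∑ s : Finset (Fin N), (∏ i, if i ∈ s then 1 else u) * (jtMatrix H N (f s)).det := by
    rw [jt_eq_det h0' le_rfl, ← hN]
    have hrow : jtMatrix (H * (1 + PowerSeries.C u * PowerSeries.X)) N (fun i => κ.rowLen i) =
        (fun i : Fin N => (fun j : Fin N => intCoeff H ((κ.rowLen i : ℤ) - (i : ℕ) + j))) +
        (fun i : Fin N =>
          u • (fun j : Fin N => intCoeff H ((κ.rowLen i : ℤ) - (i : ℕ) + j - 1))) := by
      ext i j
      simp only [jtMatrix, Matrix.of_apply, intCoeff_mul_linear, Pi.add_apply, Pi.smul_apply,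
        smul_eq_mul]
    rw [hrow]
    refine ((Matrix.detRowAlternating
      (R := A) (n := Fin N)).toMultilinearMap.map_add_univ _ _).trans
        (Finset.sum_congr rfl fun s _ => ?_)
    have hpw : s.piecewise
        (fun i : Fin N => (fun j : Fin N => intCoeff H ((κ.rowLen i : ℤ) - (i : ℕ) + j)))
        (fun i : Fin N => u • (fun j : Fin N => intCoeff H ((κ.rowLen i : ℤ) - (i : ℕ) + j - 1))) =
        fun i => (if i ∈ s then 1 else u) • (jtMatrix H N (f s) i) := by
      ext i j
      simp only [Finset.piecewise, jtMatrix, Pi.smul_apply, smul_eq_mul, Matrix.of_apply, hf]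
      split_ifs
      · simp
      · simp only [Pi.smul_apply, smul_eq_mul]
        congr 2
        ring
    rw [hpw]
    exact (Matrix.detRowAlternating (R := A) (n := Fin N)).toMultilinearMap.map_smul_univ _ _
  rw [hexp, ← Finset.sum_filter]
  symm
  have hrl : ∀ η, IsVertStrip κ η → ∀ i, N ≤ i → η.rowLen i = 0 := by
    intro η hη i hi
    have h1 := (isVertStrip_iff.mp hη i).1
    have h2 := rowLen_eq_zero_iff.mpr hi
    omega
  let e : YoungDiagram → Finset (Fin N) := fun η =>
    Finset.univ.filter fun i : Fin N => η.rowLen i = κ.rowLen i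
  have hfe : ∀ η, IsVertStrip κ η → ∀ i : Fin N, f (e η) i = η.rowLen i := by
    intro η hη i
    have := isVertStrip_iff.mp hη i
    rw [hf]
    simp only [e, Finset.mem_filter, Finset.mem_univ, true_and]
    split_ifs <;> omega
  refine Finset.sum_of_injOn e ?_ (fun _ _ => Finset.mem_coe.mpr (Finset.mem_univ _)) ?_ ?_
  · intro η hη ζ hζ heq
    simp only [Finset.coe_filter, Set.mem_ofPred_eq] at hη hζ
    refine youngDiagram_ext_rowLen fun i => ?_
    by_cases hi : i < N
    · have h1 := hfe η hη.2 ⟨i, hi⟩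
      have h2 := hfe ζ hζ.2 ⟨i, hi⟩
      rw [heq, h2] at h1
      exact_mod_cast h1.symm
    · rw [hrl η hη.2 i (not_lt.mp hi), hrl ζ hζ.2 i (not_lt.mp hi)]
  · intro s _ hs
    suffices (jtMatrix H N (f s)).det = 0 by rw [this, mul_zero]
    -- if `f s` increases, then by exactly one, and two rows of the matrix coincide
    by_cases hbad : ∃ i, i + 1 < N ∧ f s i < f s (i + 1)
    · obtain ⟨i, hi, hlt⟩ := hbad
      have h1 := hf s ⟨i, by omega⟩
      have h2 := hf s ⟨i + 1, hi⟩
      have h3 := κ.rowLen_anti i (i + 1) (Nat.le_succ i)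
      simp only at h1 h2
      refine Matrix.det_zero_of_row_eq (i := (⟨i, by omega⟩ : Fin N)) (j := ⟨i + 1, hi⟩) ?_ ?_
      · simp
      · ext j
        simp only [jtMatrix, Matrix.of_apply]
        congr 1
        push_cast
        split_ifs at h1 h2 <;> omega
    -- if `f s` has a negative value, its last value is negative and the last row vanishes
    by_cases hneg : ∃ i, i < N ∧ f s i < 0
    · obtain ⟨i, hi, hlt⟩ := hneg
      have hanti : ∀ k, i ≤ k → k < N → f s k < 0 := by
        intro k hk
        induction k, hk using Nat.le_induction with
        | base => exact fun _ => hlt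
        | succ k hk ih =>
          intro hkN
          have h1 := ih (by omega)
          by_contra hc
          exact hbad ⟨k, hkN, by omega⟩
      have hlast := hanti (N - 1) (by omega) (by omega)
      refine Matrix.det_eq_zero_of_row_eq_zero (⟨N - 1, by omega⟩ : Fin N) fun j => ?_
      simp only [jtMatrix, Matrix.of_apply]
      refine intCoeff_of_neg H ?_
      have := j.2
      omega
    push Not at hbad hneg
    exfalso
    have hanti : Antitone fun i => (f s i).toNat := by
      refine antitone_nat_of_succ_le fun i => ?_
      by_cases hi : i + 1 < N
      · have := hbad i hi
        omega
      · simp only [f, dif_neg hi]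
        simp
    have hz : (fun i => (f s i).toNat) N = 0 := by simp [f]
    refine hs ⟨ofAntitone _ hanti N, ?_, ?_⟩
    · simp only [Finset.coe_filter, Set.mem_ofPred_eq]
      have hv : IsVertStrip κ (ofAntitone _ hanti N) := by
        rw [isVertStrip_iff]
        intro i
        rw [rowLen_ofAntitone hanti hz]
        by_cases hi : i < N
        · have h1 := hf s ⟨i, hi⟩
          have h2 := hneg i hi
          simp only at h1
          split_ifs at h1 <;> omega
        · have := rowLen_eq_zero_iff.mpr (not_lt.mp hi)
          simp [f, dif_neg hi, this]
      exact ⟨mem_partitionsLE.mpr ((card_mono hv.1).trans hm), hv⟩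
    · ext i
      simp only [e, Finset.mem_filter, Finset.mem_univ, true_and]
      rw [rowLen_ofAntitone hanti hz]
      have h1 := hf s i
      have h2 := hneg i i.2
      split_ifs at h1 with h <;> simp only [h, iff_true, iff_false] <;> omega
  · intro η hη
    rw [Finset.mem_filter] at hη
    have hcol : η.colLen 0 ≤ N := rowLen_eq_zero_iff.mp (hrl η hη.2 N le_rfl)
    congr 1
    · have h1 : κ.card - η.card = ∑ i : Fin N, (κ.rowLen i - η.rowLen i) := by
        rw [card_eq_sum_rowLen (le_refl N), card_eq_sum_rowLen hcol, Finset.sum_tsub_distrib]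
        exact fun i _ => (isVertStrip_iff.mp hη.2 i).1
      rw [h1, ← Finset.prod_pow_eq_pow_sum]
      refine Finset.prod_congr rfl fun i _ => ?_
      have := isVertStrip_iff.mp hη.2 i
      simp only [e, Finset.mem_filter, Finset.mem_univ, true_and]
      split_ifs with h
      · rw [h]; simp
      · rw [show κ.rowLen i - η.rowLen i = 1 by omega, pow_one]
    · rw [jt_eq_det h0 hcol]
      congr 1
      ext i j
      simp only [jtMatrix, Matrix.of_apply, hfe η hη.2]

open Classical in
/-- Multiplying the specialization by `1 / (1 - uT)` adds horizontal strips. -/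
theorem jt_mul_geo {H : PowerSeries A} (h0 : PowerSeries.coeff 0 H = 1) (u : A)
    (κ : YoungDiagram) {m : ℕ} (hm : κ.card ≤ m) :
    jt (H * geo u) κ = ∑ η ∈ partitionsLE m,
      if IsHorizStrip κ η then u ^ (κ.card - η.card) * jt H η else 0 := by
  have h0' : PowerSeries.coeff 0 (H * geo u) = 1 := by
    rw [PowerSeries.coeff_zero_eq_constantCoeff] at h0 ⊢
    rw [map_mul, h0, ← PowerSeries.coeff_zero_eq_constantCoeff, coeff_zero_geo, one_mul]
  have hH : ∀ ζ ∈ partitionsLE m, jt H ζ = ∑ η ∈ partitionsLE m,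
      if IsVertStrip ζ η then (-u) ^ (ζ.card - η.card) * jt (H * geo u) η else 0 := by
    intro ζ hζ
    rw [← jt_mul_linear h0' (-u) ζ (mem_partitionsLE.mp hζ), mul_assoc, geo_mul, mul_one]
  have hstep : ∀ ζ ∈ partitionsLE m,
      (if IsHorizStrip κ ζ then u ^ (κ.card - ζ.card) * jt H ζ else 0) =
      ∑ η ∈ partitionsLE m, u ^ (κ.card - η.card) * jt (H * geo u) η *
        ((if IsHorizStrip κ ζ ∧ IsVertStrip ζ η then (-1 : ℤ) ^ (ζ.card + η.card) else 0 : ℤ) :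
          A) := by
    intro ζ hζ
    by_cases h1 : IsHorizStrip κ ζ
    · rw [if_pos h1, hH ζ hζ, Finset.mul_sum]
      refine Finset.sum_congr rfl fun η _ => ?_
      by_cases h2 : IsVertStrip ζ η
      · rw [if_pos h2, if_pos ⟨h1, h2⟩]
        have e1 := card_mono h1.1
        have e2 := card_mono h2.1
        rw [show ζ.card + η.card = (ζ.card - η.card) + 2 * η.card by omega, pow_add, pow_mul,
          show κ.card - η.card = (κ.card - ζ.card) + (ζ.card - η.card) by omega, pow_add,
          neg_pow u]
        push_cast
        ring
      · rw [if_neg h2, if_neg fun h => h2 h.2]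
        simp
    · rw [if_neg h1]
      refine (Finset.sum_eq_zero fun η _ => ?_).symm
      rw [if_neg fun h => h1 h.1]
      simp
  rw [Finset.sum_congr rfl hstep, Finset.sum_comm]
  simp only [← Finset.mul_sum, ← Int.cast_sum]
  rw [Finset.sum_eq_single κ]
  · rw [sum_horizStrip_vertStrip m κ κ hm]
    simp
  · intro η _ hne
    rw [sum_horizStrip_vertStrip m κ η hm, if_neg hne.symm]
    simp
  · exact fun h => absurd (mem_partitionsLE.mpr hm) h

theorem jt_one (κ : YoungDiagram) (hκ : κ ≠ ⊥) : jt (1 : PowerSeries A) κ = 0 := by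
  have hpos : 0 < κ.colLen 0 := by
    by_contra hc
    refine hκ (youngDiagram_ext_rowLen fun i => ?_)
    rw [rowLen_bot, rowLen_eq_zero_iff]
    omega
  rw [jt]
  refine Matrix.det_eq_zero_of_row_eq_zero (⟨0, hpos⟩ : Fin (κ.colLen 0)) fun j => ?_
  have h1 : 0 < κ.rowLen 0 := by
    have : ¬ κ.rowLen 0 = 0 := by rw [rowLen_eq_zero_iff]; omega
    omega
  simp only [jtMatrix, Matrix.of_apply]
  rw [show (κ.rowLen 0 : ℤ) - (0 : ℕ) + (j : ℕ) = ((κ.rowLen 0 + j : ℕ) : ℤ) by push_cast; ring,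
    intCoeff_natCast, PowerSeries.coeff_one, if_neg (by omega)]

theorem coeff_zero_prod_linear {ι : Type*} (s : Finset ι) (y : ι → A) :
    PowerSeries.coeff 0 (∏ i ∈ s, (1 + PowerSeries.C (y i) * PowerSeries.X)) = 1 := by
  rw [PowerSeries.coeff_zero_eq_constantCoeff, map_prod]
  exact Finset.prod_eq_one fun i _ => by simp

/-- Duality: replacing the complete by the elementary symmetric functions conjugates the partition.
Both sides have the same branching rule, as conjugation exchanges vertical and horizontal
strips. -/
theorem jt_prod_linear {ι : Type*} (s : Finset ι) (y : ι → A) (κ : YoungDiagram) :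
    jt (∏ i ∈ s, (1 + PowerSeries.C (y i) * PowerSeries.X)) κ =
      jt (∏ i ∈ s, geo (y i)) κ.transpose := by
  classical
  induction s using Finset.induction_on generalizing κ with
  | empty =>
    simp only [Finset.prod_empty]
    by_cases h : κ = ⊥
    · rw [h, transpose_bot]
    · rw [jt_one κ h, jt_one]
      intro h'
      rw [← YoungDiagram.transpose_transpose κ, h', transpose_bot] at h
      exact h rfl
  | insert i s hi ih =>
    rw [Finset.prod_insert hi, Finset.prod_insert hi, mul_comm, mul_comm (geo (y i)),
      jt_mul_linear (coeff_zero_prod_linear s y) _ _ le_rfl,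
      jt_mul_geo (coeff_zero_prod_geo s y) _ _ (card_transpose κ).le]
    refine Finset.sum_bij' (fun η _ => η.transpose) (fun η _ => η.transpose) ?_ ?_ ?_ ?_ ?_
    · intro η hη
      simpa [card_transpose] using hη
    · intro η hη
      simpa [card_transpose] using hη
    · intro η _
      exact η.transpose_transpose
    · intro η _
      exact η.transpose_transpose
    · intro η _
      simp only [isHorizStrip_transpose, card_transpose, ih]

end JacobiTrudi

/-! ### Alternating polynomials -/

section Alternating

variable {A : Type} [CommRing A] {N : ℕ}

/-- The exponent `κ + δ`, where `δ = (N - 1, …, 1, 0)`. -/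
noncomputable def deltaExp (N : ℕ) (κ : YoungDiagram) : Fin N →₀ ℕ :=
  ∑ i : Fin N, Finsupp.single i (κ.rowLen i + (N - 1 - (i : ℕ)))

theorem deltaExp_apply (κ : YoungDiagram) (i : Fin N) :
    deltaExp N κ i = κ.rowLen i + (N - 1 - (i : ℕ)) := by
  rw [deltaExp, Finsupp.finsetSum_apply, Finset.sum_eq_single i]
  · simp
  · intro j _ hj
    exact Finsupp.single_eq_of_ne' hj
  · simp

theorem sum_deltaExp {κ : YoungDiagram} (hκ : κ.colLen 0 ≤ N) :
    ∑ i, deltaExp N κ i = κ.card + ∑ i : Fin N, (N - 1 - (i : ℕ)) := by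
  simp only [deltaExp_apply, Finset.sum_add_distrib, card_eq_sum_rowLen hκ]

/-- A polynomial which changes by the sign of a permutation of its variables. -/
def IsAlternating (g : MvPolynomial (Fin N) A) : Prop :=
  ∀ w : Equiv.Perm (Fin N), MvPolynomial.rename w g = (Equiv.Perm.sign w : ℤ) • g

theorem isAlternating_alternant (κ : YoungDiagram) : IsAlternating (alternant A N κ) := by
  intro w
  have h := Matrix.det_permute w (Matrix.of fun i j : Fin N =>
    (MvPolynomial.X i : MvPolynomial (Fin N) A) ^ (κ.rowLen j + (N - 1 - (j : ℕ))))
  rw [alternant, zsmul_eq_mul, ← h]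
  change (MvPolynomial.rename w).toRingHom _ = _
  rw [RingHom.map_det]
  congr 1
  ext i j
  simp

theorem IsAlternating.mul {g s : MvPolynomial (Fin N) A} (hg : IsAlternating g)
    (hs : ∀ w : Equiv.Perm (Fin N), MvPolynomial.rename w s = s) : IsAlternating (g * s) := by
  intro w
  rw [map_mul, hg w, hs w, smul_mul_assoc]

variable [IsDomain A] [CharZero A]

theorem IsAlternating.eq_zero {g : MvPolynomial (Fin N) A} (hg : IsAlternating g)
    (h0 : ∀ κ : YoungDiagram, κ.colLen 0 ≤ N → g.coeff (deltaExp N κ) = 0) : g = 0 := by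
  have hcoeff : ∀ (w : Equiv.Perm (Fin N)) (m : Fin N →₀ ℕ),
      (Equiv.Perm.sign w : ℤ) • g.coeff (m.mapDomain w) = g.coeff m := by
    intro w m
    rw [← MvPolynomial.coeff_smul, ← hg w,
      MvPolynomial.coeff_rename_mapDomain _ w.injective]
  ext m
  rw [MvPolynomial.coeff_zero]
  by_cases hinj : Function.Injective m
  swap
  · obtain ⟨i, j, hij, hne⟩ : ∃ i j, m i = m j ∧ i ≠ j := by
      simpa [Function.Injective] using hinj
    have h1 := hcoeff (Equiv.swap i j) m
    have h2 : m.mapDomain (Equiv.swap i j) = m := by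
      ext k
      rw [← Equiv.swap_apply_left i j] at hij
      obtain ⟨k, rfl⟩ := (Equiv.swap i j).surjective k
      rw [Finsupp.mapDomain_apply (Equiv.swap i j).injective]
      rw [Equiv.swap_apply_left] at hij
      rcases eq_or_ne k i with rfl | hki
      · rw [Equiv.swap_apply_left, hij]
      rcases eq_or_ne k j with rfl | hkj
      · rw [Equiv.swap_apply_right, hij]
      rw [Equiv.swap_apply_of_ne_of_ne hki hkj]
    rw [h2, Equiv.Perm.sign_swap hne] at h1
    simp only [Units.val_neg, Units.val_one, neg_smul, one_smul] at h1
    exact self_eq_neg.mp h1.symm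
  -- sort the exponents into decreasing order
  set w : Equiv.Perm (Fin N) := Tuple.sort fun i => OrderDual.toDual (m i) with hw
  have hanti : ∀ i j : Fin N, i < j → m (w j) < m (w i) := by
    intro i j hij
    have h1 : m (w j) ≤ m (w i) := Tuple.monotone_sort (fun i => OrderDual.toDual (m i)) hij.le
    refine lt_of_le_of_ne h1 fun h => ?_
    exact hij.ne' (w.injective (hinj h))
  let f : ℕ → ℕ := fun i => if h : i < N then m (w ⟨i, h⟩) - (N - 1 - i) else 0
  have hge : ∀ k (hk : k < N), k ≤ m (w ⟨N - 1 - k, by omega⟩) := by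
    intro k
    induction k with
    | zero => exact fun _ => Nat.zero_le _
    | succ k ih =>
      intro hk
      have h1 := ih (by omega)
      have h2 := hanti ⟨N - 1 - (k + 1), by omega⟩ ⟨N - 1 - k, by omega⟩
        (by simp only [Fin.mk_lt_mk]; omega)
      omega
  have hge' : ∀ i : Fin N, N - 1 - (i : ℕ) ≤ m (w i) := by
    intro i
    have := hge (N - 1 - i) (by have := i.2; omega)
    have hi : (⟨N - 1 - (N - 1 - (i : ℕ)), by have := i.2; omega⟩ : Fin N) = i := by
      ext
      have := i.2
      simp only
      omega
    rwa [hi] at this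
  have hf : Antitone f := by
    refine antitone_nat_of_succ_le fun i => ?_
    by_cases hi : i + 1 < N
    · simp only [f, dif_pos hi, dif_pos (show i < N by omega)]
      have h1 := hanti ⟨i, by omega⟩ ⟨i + 1, hi⟩ (by simp)
      have h2 := hge' ⟨i, by omega⟩
      have h3 := hge' ⟨i + 1, hi⟩
      simp only at h2 h3
      omega
    · simp [f, dif_neg hi]
  have hfN : f N = 0 := by simp [f]
  set κ := ofAntitone f hf N with hκ
  have hcol : κ.colLen 0 ≤ N := rowLen_eq_zero_iff.mp (by rw [hκ, rowLen_ofAntitone hf hfN, hfN])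
  have hm : m = (deltaExp N κ).mapDomain w := by
    ext i
    obtain ⟨i, rfl⟩ := w.surjective i
    rw [Finsupp.mapDomain_apply w.injective, deltaExp_apply, hκ, rowLen_ofAntitone hf hfN]
    simp only [f, dif_pos i.2]
    have := hge' i
    simp only [Fin.eta]
    omega
  have h1 := hcoeff w (deltaExp N κ)
  rw [← hm, h0 κ hcol] at h1
  have hu : (Equiv.Perm.sign w : ℤ) ≠ 0 := Units.ne_zero _
  rcases smul_eq_zero.mp h1 with h | h
  · exact absurd h hu
  · exact h

omit [IsDomain A] [CharZero A] in
theorem coeff_alternant_deltaExp {κ η : YoungDiagram} (hκ : κ.colLen 0 ≤ N)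
    (hη : η.colLen 0 ≤ N) :
    (alternant A N κ).coeff (deltaExp N η) = open Classical in if κ = η then 1 else 0 := by
  rw [deltaExp, coeff_alternant]
  congr 1
  refine propext ⟨fun h => youngDiagram_ext_rowLen fun i => ?_, fun h i => by rw [h]⟩
  by_cases hi : i < N
  · exact h ⟨i, hi⟩
  · rw [rowLen_eq_zero_iff.mpr (hκ.trans (not_lt.mp hi)),
      rowLen_eq_zero_iff.mpr (hη.trans (not_lt.mp hi))]

omit [IsDomain A] [CharZero A] in
theorem coeff_sum_alternant {B : Finset YoungDiagram} (hB : ∀ κ ∈ B, κ.colLen 0 ≤ N)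
    (c : YoungDiagram → A) {η : YoungDiagram} (hη : η.colLen 0 ≤ N) :
    (∑ κ ∈ B, MvPolynomial.C (c κ) * alternant A N κ).coeff (deltaExp N η) =
      open Classical in if η ∈ B then c η else 0 := by
  classical
  rw [MvPolynomial.coeff_sum, ← Finset.sum_ite_eq' B η c]
  refine Finset.sum_congr rfl fun κ hκ => ?_
  rw [MvPolynomial.coeff_C_mul, coeff_alternant_deltaExp (hB κ hκ) hη]
  split_ifs <;> simp

/-- An alternating polynomial is the combination of alternants given by its coefficients at
strictly decreasing exponents. -/
theorem IsAlternating.eq_sum {g : MvPolynomial (Fin N) A} (hg : IsAlternating g)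
    {B : Finset YoungDiagram} (hB : ∀ κ ∈ B, κ.colLen 0 ≤ N)
    (hgB : ∀ κ : YoungDiagram, κ.colLen 0 ≤ N → g.coeff (deltaExp N κ) ≠ 0 → κ ∈ B) :
    g = ∑ κ ∈ B, MvPolynomial.C (g.coeff (deltaExp N κ)) * alternant A N κ := by
  rw [← sub_eq_zero]
  refine IsAlternating.eq_zero ?_ fun κ hκ => ?_
  · intro w
    rw [map_sub, hg w, smul_sub, map_sum, Finset.smul_sum]
    congr 1
    refine Finset.sum_congr rfl fun κ _ => ?_
    rw [map_mul, isAlternating_alternant κ w, MvPolynomial.rename_C, mul_smul_comm]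
  · rw [MvPolynomial.coeff_sub, coeff_sum_alternant hB _ hκ]
    split_ifs with h
    · exact sub_self _
    · by_contra hc
      exact h (hgB κ hκ (by simpa using hc))

omit [IsDomain A] in
theorem alternant_bot_ne_zero : alternant A N ⊥ ≠ 0 := by
  intro h
  have hb : (⊥ : YoungDiagram).colLen 0 ≤ N := by
    have := colLen_le_card ⊥
    rw [card_bot] at this
    omega
  have h1 := coeff_alternant_deltaExp (A := A) hb hb
  rw [h] at h1
  simp at h1

omit [IsDomain A] [CharZero A] in
theorem colLen_le_of_mem {m : ℕ} {κ : YoungDiagram} (hm : m ≤ N) (hκ : κ ∈ partitionsLE m) :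
    κ.colLen 0 ≤ N :=
  (colLen_le_card κ).trans ((mem_partitionsLE.mp hκ).trans hm)

/-- The partitions of size `n`. -/
noncomputable def partitionsEq (n : ℕ) : Finset YoungDiagram :=
  (partitionsLE n).filter fun κ => κ.card = n

@[simp] theorem mem_partitionsEq {n : ℕ} {κ : YoungDiagram} :
    κ ∈ partitionsEq n ↔ κ.card = n := by
  simp only [partitionsEq, Finset.mem_filter, mem_partitionsLE]
  exact ⟨fun h => h.2, fun h => ⟨h.le, h⟩⟩

theorem IsAlternating.eq_sum_of_isHomogeneous {g : MvPolynomial (Fin N) A} (hg : IsAlternating g)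
    {n : ℕ} (hn : n ≤ N) (hgn : g.IsHomogeneous (n + ∑ i : Fin N, (N - 1 - (i : ℕ)))) :
    g = ∑ κ ∈ partitionsEq n, MvPolynomial.C (g.coeff (deltaExp N κ)) * alternant A N κ := by
  refine hg.eq_sum (fun κ hκ => (colLen_le_card κ).trans ?_) fun κ hκ h => ?_
  · rw [mem_partitionsEq.mp hκ]
    exact hn
  · have h1 := hgn h
    rw [Finsupp.weight_apply, Finsupp.sum_fintype _ _ (by simp)] at h1
    simp only [Pi.one_apply, smul_eq_mul, mul_one] at h1
    rw [sum_deltaExp hκ] at h1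
    rw [mem_partitionsEq]
    omega

end Alternating

/-! ### The Cauchy kernel of a specialization -/

section Kernel

variable {A : Type} [CommRing A] {N : ℕ}

/-- The alternant as a sum of monomials. -/
theorem alternant_eq_sum_monomial (κ : YoungDiagram) :
    alternant A N κ = ∑ w : Equiv.Perm (Fin N), (Equiv.Perm.sign w : ℤ) •
      MvPolynomial.monomial
        (Finsupp.equivFunOnFinite.symm fun i : Fin N =>
          κ.rowLen (w.symm i) + (N - 1 - ((w.symm i : Fin N) : ℕ))) (1 : A) := by
  rw [alternant, Matrix.det_apply]
  refine Finset.sum_congr rfl fun w _ => ?_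
  rw [Units.smul_def, ← Equiv.prod_comp w.symm, MvPolynomial.monomial_eq, map_one, one_mul,
    Finsupp.prod_fintype _ _ (by simp)]
  simp

/-- The part of degree `n` of `∏_i H(x_i)`. -/
noncomputable def kernelPart (H : PowerSeries A) {N : ℕ} (x : Fin N → A) (n : ℕ) : A :=
  PowerSeries.coeff n (∏ i, PowerSeries.rescale (x i) H)

theorem kernelPart_eq_sum (H : PowerSeries A) (x : Fin N → A) (n : ℕ) :
    kernelPart H x n = ∑ l ∈ Finset.finsuppAntidiag Finset.univ n,
      ∏ i, (x i ^ l i * PowerSeries.coeff (l i) H) := by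
  rw [kernelPart, PowerSeries.coeff_prod]
  simp only [PowerSeries.coeff_rescale]

theorem map_kernelPart {B : Type} [CommRing B] (φ : A →+* B) (H : PowerSeries A) (x : Fin N → A)
    (n : ℕ) : φ (kernelPart H x n) = kernelPart (PowerSeries.map φ H) (fun i => φ (x i)) n := by
  simp [kernelPart_eq_sum]

theorem kernelPart_X_eq_sum (H : PowerSeries A) (n : ℕ) :
    kernelPart (PowerSeries.map MvPolynomial.C H) (MvPolynomial.X : Fin N → MvPolynomial (Fin N) A)
      n = ∑ l ∈ Finset.finsuppAntidiag Finset.univ n,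
        MvPolynomial.monomial l (∏ i, PowerSeries.coeff (l i) H) := by
  rw [kernelPart_eq_sum]
  refine Finset.sum_congr rfl fun l _ => ?_
  rw [MvPolynomial.monomial_eq, Finset.prod_mul_distrib, Finsupp.prod_fintype _ _ (by simp),
    mul_comm, map_prod]
  simp

theorem coeff_kernelPart_X (H : PowerSeries A) (n : ℕ) (m : Fin N →₀ ℕ) :
    (kernelPart (PowerSeries.map MvPolynomial.C H)
      (MvPolynomial.X : Fin N → MvPolynomial (Fin N) A) n).coeff m =
      if ∑ i, m i = n then ∏ i, PowerSeries.coeff (m i) H else 0 := by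
  classical
  rw [kernelPart_X_eq_sum, MvPolynomial.coeff_sum]
  simp only [MvPolynomial.coeff_monomial]
  rw [Finset.sum_ite_eq']
  simp [Finset.mem_finsuppAntidiag]

theorem coeff_alternant_mul_kernelPart {H : PowerSeries A} (h0 : PowerSeries.coeff 0 H = 1)
    (n : ℕ) {κ : YoungDiagram} (hκ : κ.colLen 0 ≤ N) :
    (alternant A N ⊥ * kernelPart (PowerSeries.map MvPolynomial.C H)
      (MvPolynomial.X : Fin N → MvPolynomial (Fin N) A) n).coeff (deltaExp N κ) =
      if κ.card = n then jt H κ else 0 := by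
  classical
  rw [alternant_eq_sum_monomial, Finset.sum_mul, MvPolynomial.coeff_sum]
  simp only [smul_mul_assoc, MvPolynomial.coeff_smul, MvPolynomial.coeff_monomial_mul', one_mul,
    rowLen_bot, zero_add, coeff_kernelPart_X]
  rw [jt_eq_det h0 hκ, Matrix.det_apply]
  set D : Equiv.Perm (Fin N) → Fin N →₀ ℕ := fun w => Finsupp.equivFunOnFinite.symm
    fun i : Fin N => N - 1 - ((w.symm i : Fin N) : ℕ) with hD
  have hsumD : ∀ w, ∑ i, D w i = ∑ i : Fin N, (N - 1 - (i : ℕ)) := by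
    intro w
    simp only [hD, Finsupp.equivFunOnFinite_symm_apply_apply]
    exact Equiv.sum_comp w.symm fun i : Fin N => N - 1 - (i : ℕ)
  have hsum : ∀ w, D w ≤ deltaExp N κ → ∑ i, (deltaExp N κ - D w) i = κ.card := by
    intro w hw
    simp only [Finsupp.coe_tsub, Pi.sub_apply]
    rw [Finset.sum_tsub_distrib _ fun i _ => hw i, sum_deltaExp hκ, hsumD]
    omega
  split_ifs with hn
  · refine Finset.sum_congr rfl fun w _ => ?_
    rw [Units.smul_def]
    congr 1
    change (if D w ≤ deltaExp N κ then
      (if ∑ i, (deltaExp N κ - D w) i = n then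
        ∏ i, PowerSeries.coeff ((deltaExp N κ - D w) i) H else 0) else 0) = _
    by_cases hle : D w ≤ deltaExp N κ
    · rw [if_pos hle, if_pos ((hsum w hle).trans hn), ← Equiv.prod_comp w]
      refine Finset.prod_congr rfl fun i _ => ?_
      have hi := hle (w i)
      simp only [jtMatrix, Matrix.of_apply, Finsupp.coe_tsub, Pi.sub_apply]
      simp only [hD, Finsupp.equivFunOnFinite_symm_apply_apply, Equiv.symm_apply_apply,
        deltaExp_apply] at hi ⊢
      rw [← intCoeff_natCast]
      congr 1
      have := i.2
      have := (w i).2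
      omega
    · obtain ⟨i, hi⟩ : ∃ i, deltaExp N κ i < D w i := by
        by_contra hc
        push Not at hc
        exact hle fun i => hc i
      rw [if_neg hle]
      obtain ⟨i, rfl⟩ := w.surjective i
      refine (Finset.prod_eq_zero (Finset.mem_univ i) ?_).symm
      simp only [jtMatrix, Matrix.of_apply]
      refine intCoeff_of_neg H ?_
      simp only [hD, Finsupp.equivFunOnFinite_symm_apply_apply, Equiv.symm_apply_apply,
        deltaExp_apply] at hi
      have := i.2
      have := (w i).2
      omega
  · refine Finset.sum_eq_zero fun w _ => ?_
    change (Equiv.Perm.sign w : ℤ) • (if D w ≤ deltaExp N κ then _ else _) = _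
    split_ifs with hle hc
    · exact absurd ((hsum w hle).symm.trans hc) hn
    · simp
    · simp

theorem rename_prod_rescale (H : PowerSeries A) (n : ℕ) (w : Equiv.Perm (Fin N)) :
    MvPolynomial.rename w (kernelPart (PowerSeries.map MvPolynomial.C H)
      (MvPolynomial.X : Fin N → MvPolynomial (Fin N) A) n) =
      kernelPart (PowerSeries.map MvPolynomial.C H) MvPolynomial.X n := by
  change ((MvPolynomial.rename w).toRingHom : MvPolynomial (Fin N) A →+* _) _ = _
  rw [map_kernelPart, kernelPart, kernelPart]
  congr 1
  conv_rhs => rw [← Equiv.prod_comp w]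
  refine Finset.prod_congr rfl fun i _ => ?_
  ext k
  simp

/-- The Cauchy identity: the part of degree `n` of `∏_i H(x_i)` is the sum over the partitions `κ`
of `n` of the value of `s_κ` at `H` times `s_κ(x)`. -/
theorem kernelPart_X_eq [IsDomain A] [CharZero A] {H : PowerSeries A}
    (h0 : PowerSeries.coeff 0 H = 1) {n : ℕ} (hn : n ≤ N) :
    kernelPart (PowerSeries.map MvPolynomial.C H)
      (MvPolynomial.X : Fin N → MvPolynomial (Fin N) A) n =
      ∑ κ ∈ partitionsEq n, MvPolynomial.C (jt H κ) *
        jt (∏ i : Fin N, geo (MvPolynomial.X i : MvPolynomial (Fin N) A)) κ := by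
  refine mul_left_cancel₀ (alternant_bot_ne_zero (A := A) (N := N)) ?_
  have hcol : ∀ κ ∈ partitionsEq n, κ.colLen 0 ≤ N := fun κ hκ =>
    (colLen_le_card κ).trans ((mem_partitionsEq.mp hκ).le.trans hn)
  rw [((isAlternating_alternant ⊥).mul (rename_prod_rescale H n)).eq_sum hcol, Finset.mul_sum]
  · refine Finset.sum_congr rfl fun κ hκ => ?_
    rw [coeff_alternant_mul_kernelPart h0 n (hcol κ hκ), if_pos (mem_partitionsEq.mp hκ)]
    have := altAt_eq_mul_jt (MvPolynomial.X : Fin N → MvPolynomial (Fin N) A) (hcol κ hκ)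
    change alternant A N κ = alternant A N ⊥ * _ at this
    rw [this]
    ring
  · intro κ hκ h
    rw [coeff_alternant_mul_kernelPart h0 n hκ] at h
    rw [mem_partitionsEq]
    by_contra hc
    exact h (if_neg hc)

end Kernel

/-! ### Schur polynomials -/

section SchurPoly

variable {A : Type} [CommRing A] {N : ℕ}

/-- The Schur polynomial `s_κ(x_1, …, x_N)`; it vanishes if `κ` has more than `N` parts. -/
noncomputable def schurPoly (A : Type) [CommRing A] (N : ℕ) (κ : YoungDiagram) :
    MvPolynomial (Fin N) A :=
  jt (∏ i : Fin N, geo (MvPolynomial.X i)) κ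

theorem eval₂_schurPoly {B : Type*} [CommRing B] (φ : A →+* B) (x : Fin N → B)
    (κ : YoungDiagram) :
    MvPolynomial.eval₂Hom φ x (schurPoly A N κ) = jt (∏ i, geo (x i)) κ := by
  rw [schurPoly, ← jt_map, map_prod]
  simp only [map_geo, MvPolynomial.eval₂Hom_X']

theorem alternant_eq_mul_schurPoly {κ : YoungDiagram} (hκ : κ.colLen 0 ≤ N) :
    alternant A N κ = alternant A N ⊥ * schurPoly A N κ :=
  altAt_eq_mul_jt (MvPolynomial.X : Fin N → MvPolynomial (Fin N) A) hκ

theorem rename_schurPoly (w : Equiv.Perm (Fin N)) (κ : YoungDiagram) :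
    MvPolynomial.rename w (schurPoly A N κ) = schurPoly A N κ := by
  change ((MvPolynomial.rename w).toRingHom : MvPolynomial (Fin N) A →+* _) _ = _
  rw [schurPoly, ← jt_map, map_prod]
  congr 1
  conv_rhs => rw [← Equiv.prod_comp w]
  refine Finset.prod_congr rfl fun i _ => ?_
  rw [map_geo]
  simp

theorem isHomogeneous_coeff_prod_geo (s : Finset (Fin N)) (n : ℕ) :
    (PowerSeries.coeff n (∏ i ∈ s, geo (MvPolynomial.X i : MvPolynomial (Fin N) A))).IsHomogeneous
      n := by
  rw [PowerSeries.coeff_prod]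
  refine MvPolynomial.IsHomogeneous.sum _ _ _ fun l hl => ?_
  rw [← (Finset.mem_finsuppAntidiag.mp hl).1]
  refine MvPolynomial.IsHomogeneous.prod _ _ _ fun i _ => ?_
  rw [coeff_geo]
  exact MvPolynomial.isHomogeneous_X_pow _ _

theorem isHomogeneous_schurPoly (κ : YoungDiagram) :
    (schurPoly A N κ).IsHomogeneous κ.card := by
  rw [schurPoly, jt, Matrix.det_apply]
  refine MvPolynomial.IsHomogeneous.sum _ _ _ fun w _ => ?_
  rw [Units.smul_def, zsmul_eq_mul]
  suffices h : (∏ i, jtMatrix (∏ i : Fin N, geo (MvPolynomial.X i : MvPolynomial (Fin N) A))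
      (κ.colLen 0) (fun i => κ.rowLen i) (w i) i).IsHomogeneous κ.card by
    have h1 := (MvPolynomial.isHomogeneous_C (Fin N) ((Equiv.Perm.sign w : ℤ) : A)).mul h
    simpa using h1
  by_cases hneg : ∃ i : Fin (κ.colLen 0), (κ.rowLen (w i) : ℤ) - (w i : ℕ) + (i : ℕ) < 0
  · obtain ⟨i, hi⟩ := hneg
    rw [Finset.prod_eq_zero (Finset.mem_univ i)]
    · exact MvPolynomial.isHomogeneous_zero _ _ _
    · simp only [jtMatrix, Matrix.of_apply]
      exact intCoeff_of_neg _ hi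
  · push Not at hneg
    have hsum : κ.card = ∑ i : Fin (κ.colLen 0),
        ((κ.rowLen (w i) : ℤ) - (w i : ℕ) + (i : ℕ)).toNat := by
      zify
      rw [Finset.sum_congr rfl fun i _ => Int.toNat_of_nonneg (hneg i),
        card_eq_sum_rowLen (le_refl (κ.colLen 0)), Finset.sum_add_distrib,
        Finset.sum_sub_distrib, Equiv.sum_comp w fun i : Fin (κ.colLen 0) => (κ.rowLen i : ℤ),
        Equiv.sum_comp w fun i : Fin (κ.colLen 0) => ((i : ℕ) : ℤ)]
      push_cast
      ring
    rw [hsum]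
    refine MvPolynomial.IsHomogeneous.prod _ _ _ fun i _ => ?_
    simp only [jtMatrix, Matrix.of_apply, intCoeff]
    rw [if_pos (hneg i)]
    exact isHomogeneous_coeff_prod_geo _ _

/-- Setting the last variable to zero. -/
noncomputable def killLast (A : Type) [CommRing A] (N : ℕ) :
    MvPolynomial (Fin (N + 1)) A →+* MvPolynomial (Fin N) A :=
  MvPolynomial.eval₂Hom MvPolynomial.C (Fin.snoc MvPolynomial.X 0)

theorem geo_zero {B : Type*} [CommRing B] : geo (0 : B) = 1 := by
  ext n
  rw [coeff_geo, PowerSeries.coeff_one]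
  split_ifs with h <;> simp [h]

theorem killLast_schurPoly (κ : YoungDiagram) :
    killLast A N (schurPoly A (N + 1) κ) = schurPoly A N κ := by
  rw [killLast, eval₂_schurPoly, Fin.prod_univ_castSucc]
  simp [geo_zero, schurPoly]

theorem colLen_bot_le (N : ℕ) : (⊥ : YoungDiagram).colLen 0 ≤ N := by
  have := colLen_le_card ⊥
  rw [card_bot] at this
  omega

/-- Schur polynomials in sufficiently many variables are linearly independent. -/
theorem schurPoly_coeff_unique [CharZero A] [IsDomain A] {B : Finset YoungDiagram}
    (hB : ∀ κ ∈ B, κ.colLen 0 ≤ N) {c c' : YoungDiagram → A}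
    (h : ∑ κ ∈ B, MvPolynomial.C (c κ) * schurPoly A N κ =
      ∑ κ ∈ B, MvPolynomial.C (c' κ) * schurPoly A N κ) : ∀ κ ∈ B, c κ = c' κ := by
  intro η hη
  have key : ∀ c : YoungDiagram → A,
      (alternant A N ⊥ * ∑ κ ∈ B, MvPolynomial.C (c κ) * schurPoly A N κ).coeff (deltaExp N η) =
        c η := by
    intro c
    have h1 : alternant A N ⊥ * ∑ κ ∈ B, MvPolynomial.C (c κ) * schurPoly A N κ =
        ∑ κ ∈ B, MvPolynomial.C (c κ) * alternant A N κ := by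
      rw [Finset.mul_sum]
      refine Finset.sum_congr rfl fun κ hκ => ?_
      rw [alternant_eq_mul_schurPoly (hB κ hκ)]
      ring
    rw [h1, coeff_sum_alternant hB c (hB η hη), if_pos hη]
  rw [← key c, h, key c']

variable [CharZero A] [IsDomain A]

omit [CharZero A] [IsDomain A] in
theorem colLen_le_of_mem_partitionsEq {n : ℕ} (hn : n ≤ N) :
    ∀ κ ∈ partitionsEq n, κ.colLen 0 ≤ N := fun κ hκ =>
  (colLen_le_card κ).trans ((mem_partitionsEq.mp hκ).le.trans hn)

/-- A family of polynomials `p N`, one for each number of variables, which are compatible under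
setting the last variable to zero and are quotients of homogeneous alternating polynomials by the
Vandermonde determinant, has an expansion in Schur polynomials independent of `N`. -/
theorem exists_stable_expansion (p : (N : ℕ) → MvPolynomial (Fin N) A) (n : ℕ)
    (halt : ∀ N, n ≤ N → IsAlternating (alternant A N ⊥ * p N))
    (hhom : ∀ N, n ≤ N → (alternant A N ⊥ * p N).IsHomogeneous
      (n + ∑ i : Fin N, (N - 1 - (i : ℕ))))
    (hstab : ∀ N, n ≤ N → killLast A N (p (N + 1)) = p N) :
    ∃ c : YoungDiagram → A, (∀ κ, c κ ≠ 0 → κ.card = n) ∧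
      ∀ N, n ≤ N → p N = ∑ κ ∈ partitionsEq n, MvPolynomial.C (c κ) * schurPoly A N κ := by
  have hex : ∀ N, n ≤ N → ∃ c : YoungDiagram → A,
      p N = ∑ κ ∈ partitionsEq n, MvPolynomial.C (c κ) * schurPoly A N κ := by
    intro N hN
    refine ⟨fun κ => (alternant A N ⊥ * p N).coeff (deltaExp N κ),
      mul_left_cancel₀ alternant_bot_ne_zero
        (((halt N hN).eq_sum_of_isHomogeneous hN (hhom N hN)).trans ?_)⟩
    rw [Finset.mul_sum]
    refine Finset.sum_congr rfl fun κ hκ => ?_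
    rw [alternant_eq_mul_schurPoly (colLen_le_of_mem_partitionsEq hN κ hκ)]
    ring
  classical
  obtain ⟨c, hc⟩ := hex n le_rfl
  refine ⟨fun κ => if κ.card = n then c κ else 0, fun κ h => by_contra fun h' => h (if_neg h'), ?_⟩
  have hc' : ∀ N, n ≤ N → p N = ∑ κ ∈ partitionsEq n, MvPolynomial.C (c κ) * schurPoly A N κ := by
    intro N hN
    induction N, hN using Nat.le_induction with
    | base => exact hc
    | succ N hN ih =>
      obtain ⟨c', hc'⟩ := hex (N + 1) (by omega)
      have h1 : ∑ κ ∈ partitionsEq n, MvPolynomial.C (c' κ) * schurPoly A N κ =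
          ∑ κ ∈ partitionsEq n, MvPolynomial.C (c κ) * schurPoly A N κ := by
        rw [← ih, ← hstab N hN, hc', map_sum]
        refine Finset.sum_congr rfl fun κ _ => ?_
        rw [map_mul, killLast_schurPoly]
        simp [killLast]
      have h2 := schurPoly_coeff_unique (colLen_le_of_mem_partitionsEq hN) h1
      rw [hc']
      exact Finset.sum_congr rfl fun κ hκ => by rw [h2 κ hκ]
  intro N hN
  rw [hc' N hN]
  refine Finset.sum_congr rfl fun κ hκ => ?_
  change _ = MvPolynomial.C (if κ.card = n then c κ else 0) * _
  rw [if_pos (mem_partitionsEq.mp hκ)]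

omit [CharZero A] in
theorem schur_eq_algebraMap {R : Type} [CommRing R] [IsDomain R] [CharZero R] {κ : YoungDiagram}
    (hκ : κ.colLen 0 ≤ N) :
    schur R N κ = algebraMap (MvPolynomial (Fin N) R) (RatFun R N) (schurPoly R N κ) := by
  have hne : algebraMap (MvPolynomial (Fin N) R) (RatFun R N) (alternant R N ⊥) ≠ 0 := by
    rw [Ne, IsFractionRing.to_map_eq_zero_iff]
    exact alternant_bot_ne_zero
  rw [schur, div_eq_iff hne, alternant_eq_mul_schurPoly hκ, map_mul, mul_comm]

/-- The Schur coefficients of a stable family of polynomials. -/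
theorem schurCoeff_eq {f : (N : ℕ) → RatFun A N} {p : (N : ℕ) → MvPolynomial (Fin N) A} {n : ℕ}
    (hf : ∀ N, n ≤ N → f N = algebraMap _ _ (p N)) {c : YoungDiagram → A}
    (hc : ∀ κ, c κ ≠ 0 → κ.card = n)
    (hp : ∀ N, n ≤ N → p N = ∑ κ ∈ partitionsEq n, MvPolynomial.C (c κ) * schurPoly A N κ)
    (κ : YoungDiagram) : schurCoeff f κ = c κ := by
  have hex : IsSchurExpansion f
      (Finsupp.onFinset (partitionsEq n) c fun κ h => mem_partitionsEq.mpr (hc κ h)) := by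
    refine ⟨n, fun N hN => ?_⟩
    rw [Finsupp.onFinset_sum _ fun κ => by simp, hf N hN, hp N hN, map_sum]
    refine Finset.sum_congr rfl fun κ hκ => ?_
    rw [map_mul, schur_eq_algebraMap (colLen_le_of_mem_partitionsEq hN κ hκ),
      IsScalarTower.algebraMap_apply A (MvPolynomial (Fin N) A) (RatFun A N)]
    rfl
  have h : ∃ c, IsSchurExpansion f c := ⟨_, hex⟩
  rw [schurCoeff, dif_pos h, h.choose_spec.unique hex]
  rfl

end SchurPoly

/-! ### Littlewood–Richardson coefficients -/

section LittlewoodRichardson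

/-- The total size of a multiset of partitions. -/
def totalSize (M : Multiset YoungDiagram) : ℕ := (M.map YoungDiagram.card).sum

theorem exists_lr_expansion (M : Multiset YoungDiagram) :
    ∃ c : YoungDiagram → ℤ, (∀ κ, c κ ≠ 0 → κ.card = totalSize M) ∧
      ∀ N, totalSize M ≤ N → (M.map (schurPoly ℤ N)).prod =
        ∑ κ ∈ partitionsEq (totalSize M), MvPolynomial.C (c κ) * schurPoly ℤ N κ := by
  refine exists_stable_expansion (fun N => (M.map (schurPoly ℤ N)).prod) (totalSize M)
    (fun N _ => ?_) (fun N _ => ?_) fun N _ => ?_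
  · refine (isAlternating_alternant ⊥).mul fun w => ?_
    rw [map_multiset_prod, Multiset.map_map]
    congr 1
    exact Multiset.map_congr rfl fun κ _ => rename_schurPoly w κ
  · have h1 : (alternant ℤ N ⊥).IsHomogeneous (∑ i : Fin N, (N - 1 - (i : ℕ))) := by
      rw [alternant_eq_sum_monomial]
      refine MvPolynomial.IsHomogeneous.sum _ _ _ fun w _ => ?_
      rw [MvPolynomial.smul_monomial]
      refine MvPolynomial.isHomogeneous_monomial _ ?_
      rw [Finsupp.degree_eq_sum]
      simp only [rowLen_bot, zero_add, Finsupp.equivFunOnFinite_symm_apply_apply]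
      exact Equiv.sum_comp w.symm fun i : Fin N => N - 1 - (i : ℕ)
    have h2 : ∀ M : Multiset YoungDiagram,
        (M.map (schurPoly ℤ N)).prod.IsHomogeneous (totalSize M) := by
      intro M
      induction M using Multiset.induction_on with
      | empty => simpa [totalSize] using MvPolynomial.isHomogeneous_one (Fin N) ℤ
      | cons κ M ih =>
        simp only [totalSize, Multiset.map_cons, Multiset.prod_cons, Multiset.sum_cons]
        exact (isHomogeneous_schurPoly κ).mul ih
    rw [add_comm]
    exact h1.mul (h2 M)
  · rw [map_multiset_prod, Multiset.map_map]
    congr 1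
    exact Multiset.map_congr rfl fun κ _ => killLast_schurPoly κ

theorem lr_spec (M : Multiset YoungDiagram) :
    (∀ κ, lr κ M ≠ 0 → κ.card = totalSize M) ∧
      ∀ N, totalSize M ≤ N → (M.map (schurPoly ℤ N)).prod =
        ∑ κ ∈ partitionsEq (totalSize M), MvPolynomial.C (lr κ M) * schurPoly ℤ N κ := by
  obtain ⟨c, hc, hp⟩ := exists_lr_expansion M
  have h : ∀ κ, lr κ M = c κ := by
    intro κ
    refine schurCoeff_eq (p := fun N => (M.map (schurPoly ℤ N)).prod) (fun N hN => ?_) hc hp κ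
    rw [map_multiset_prod, Multiset.map_map]
    congr 1
    refine Multiset.map_congr rfl fun η hη => ?_
    refine schur_eq_algebraMap ((colLen_le_card η).trans (le_trans ?_ hN))
    exact Multiset.single_le_sum (fun _ _ => Nat.zero_le _) _ (Multiset.mem_map_of_mem _ hη)
  simp only [h]
  exact ⟨hc, hp⟩

theorem card_eq_of_lr_ne_zero {κ : YoungDiagram} {M : Multiset YoungDiagram} (h : lr κ M ≠ 0) :
    κ.card = totalSize M :=
  (lr_spec M).1 κ h

theorem card_eq_of_lr_pair_ne_zero {κ α β : YoungDiagram} (h : lr κ {α, β} ≠ 0) :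
    κ.card = α.card + β.card := by
  rw [card_eq_of_lr_ne_zero h]
  simp [totalSize]

theorem sum_partitionsEq_eq {B : Type*} [AddCommMonoid B] {n m : ℕ} (hm : n ≤ m)
    {f : YoungDiagram → B} (hf : ∀ κ, f κ ≠ 0 → κ.card = n) :
    ∑ κ ∈ partitionsEq n, f κ = ∑ κ ∈ partitionsLE m, f κ := by
  refine Finset.sum_subset (fun κ hκ => ?_) fun κ _ hκ => ?_
  · rw [mem_partitionsEq] at hκ
    rw [mem_partitionsLE]
    omega
  · rw [mem_partitionsEq] at hκ
    exact by_contra fun h => hκ (hf κ h)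

/-- Products of Schur functions, at any finite number of elements of a commutative ring. -/
theorem prod_jt_eq {B : Type*} [CommRing B] {ι : Type*} (s : Finset ι) (y : ι → B)
    (M : Multiset YoungDiagram) {m : ℕ} (hm : totalSize M ≤ m) :
    (M.map (jt (∏ i ∈ s, geo (y i)))).prod =
      ∑ κ ∈ partitionsLE m, (lr κ M : B) * jt (∏ i ∈ s, geo (y i)) κ := by
  classical
  set N := s.card + totalSize M with hN
  let x : Fin N → B := Fin.append (fun i => y (s.equivFin.symm i)) fun _ => 0
  have hx : ∏ i, geo (x i) = ∏ i ∈ s, geo (y i) := by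
    rw [Fin.prod_univ_add]
    simp only [x, Fin.append_left, Fin.append_right, geo_zero, Finset.prod_const_one, mul_one]
    rw [Equiv.prod_comp s.equivFin.symm fun i => geo (y i),
      Finset.prod_coe_sort s fun i => geo (y i)]
  have h := congrArg (MvPolynomial.eval₂Hom (Int.castRingHom B) x)
    ((lr_spec M).2 N (by omega))
  rw [map_multiset_prod, Multiset.map_map, map_sum] at h
  simp only [Function.comp_def, map_mul, eval₂_schurPoly, hx, eq_intCast,
    map_intCast] at h
  rw [h]
  refine sum_partitionsEq_eq hm fun κ hκ => card_eq_of_lr_ne_zero fun h0 => hκ ?_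
  simp [h0]

theorem jt_mul_jt {B : Type*} [CommRing B] {ι : Type*} (s : Finset ι) (y : ι → B)
    (α β : YoungDiagram) {m : ℕ} (hm : α.card + β.card ≤ m) :
    jt (∏ i ∈ s, geo (y i)) α * jt (∏ i ∈ s, geo (y i)) β =
      ∑ κ ∈ partitionsLE m, (lr κ {α, β} : B) * jt (∏ i ∈ s, geo (y i)) κ := by
  have := prod_jt_eq s y {α, β} (m := m) (by simpa [totalSize] using hm)
  simpa using this

/-- Iterated Littlewood–Richardson coefficients. -/
theorem lr_add (κ : YoungDiagram) (M M' : Multiset YoungDiagram) {m : ℕ}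
    (hm : totalSize M + totalSize M' ≤ m) :
    lr κ (M + M') = ∑ α ∈ partitionsLE m, ∑ β ∈ partitionsLE m,
      lr κ {α, β} * lr α M * lr β M' := by
  by_cases hκ : κ.card ≤ m
  swap
  · have h1 : lr κ (M + M') = 0 := by
      by_contra h
      have := card_eq_of_lr_ne_zero h
      simp only [totalSize, Multiset.map_add, Multiset.sum_add] at this hm
      omega
    rw [h1]
    refine (Finset.sum_eq_zero fun α _ => Finset.sum_eq_zero fun β _ => ?_).symm
    by_contra h
    have e1 := card_eq_of_lr_pair_ne_zero (left_ne_zero_of_mul (left_ne_zero_of_mul h))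
    have e2 := card_eq_of_lr_ne_zero (right_ne_zero_of_mul (left_ne_zero_of_mul h))
    have e3 := card_eq_of_lr_ne_zero (right_ne_zero_of_mul h)
    omega
  have hM := prod_jt_eq Finset.univ (MvPolynomial.X : Fin m → MvPolynomial (Fin m) ℤ) (M + M')
    (m := m) (by simpa [totalSize] using hm)
  have h1 := prod_jt_eq Finset.univ (MvPolynomial.X : Fin m → MvPolynomial (Fin m) ℤ) M
    (m := m) (by omega)
  have h2 := prod_jt_eq Finset.univ (MvPolynomial.X : Fin m → MvPolynomial (Fin m) ℤ) M'
    (m := m) (by omega)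
  rw [Multiset.map_add, Multiset.prod_add, h1, h2, Finset.sum_mul_sum] at hM
  refine (schurPoly_coeff_unique (N := m) (B := partitionsLE m)
    (c' := fun κ => lr κ (M + M'))
    (c := fun κ => ∑ α ∈ partitionsLE m, ∑ β ∈ partitionsLE m, lr κ {α, β} * lr α M * lr β M')
    (fun κ hκ => colLen_le_of_mem le_rfl hκ) ?_ κ (mem_partitionsLE.mpr hκ)).symm
  simp only [schurPoly]
  rw [show (∑ κ ∈ partitionsLE m, MvPolynomial.C (lr κ (M + M')) *
      jt (∏ i : Fin m, geo (MvPolynomial.X i : MvPolynomial (Fin m) ℤ)) κ) = _ from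
      Finset.sum_congr rfl fun κ _ => by rw [eq_intCast MvPolynomial.C], ← hM]
  simp only [map_sum, Finset.sum_mul]
  rw [Finset.sum_comm]
  refine Finset.sum_congr rfl fun α _ => ?_
  rw [Finset.sum_comm]
  refine Finset.sum_congr rfl fun β _ => ?_
  by_cases h0 : (lr α M : ℤ) * lr β M' = 0
  · rw [show ((lr α M : ℤ) : MvPolynomial (Fin m) ℤ) * jt _ α * (((lr β M' : ℤ) :
      MvPolynomial (Fin m) ℤ) * jt _ β) = ((lr α M * lr β M' : ℤ) : MvPolynomial (Fin m) ℤ) *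
      (jt _ α * jt _ β) by push_cast; ring, h0]
    simp only [Int.cast_zero, zero_mul]
    exact Finset.sum_eq_zero fun κ _ => by rw [mul_assoc, h0]; simp
  · have e2 := card_eq_of_lr_ne_zero (left_ne_zero_of_mul h0)
    have e3 := card_eq_of_lr_ne_zero (right_ne_zero_of_mul h0)
    rw [show ((lr α M : ℤ) : MvPolynomial (Fin m) ℤ) * jt _ α * (((lr β M' : ℤ) :
      MvPolynomial (Fin m) ℤ) * jt _ β) = ((lr α M * lr β M' : ℤ) : MvPolynomial (Fin m) ℤ) *
      (jt _ α * jt _ β) by push_cast; ring, jt_mul_jt _ _ α β (m := m) (by omega), Finset.mul_sum]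
    refine Finset.sum_congr rfl fun κ _ => ?_
    rw [eq_intCast MvPolynomial.C]
    push_cast
    ring

/-- The coproduct: the value of a Schur function at a product of two specializations. -/
theorem jt_mul {A : Type} [CommRing A] [IsDomain A] [CharZero A] {H H' : PowerSeries A}
    (h0 : PowerSeries.coeff 0 H = 1) (h0' : PowerSeries.coeff 0 H' = 1) (κ : YoungDiagram) {m : ℕ}
    (hm : κ.card ≤ m) :
    jt (H * H') κ = ∑ α ∈ partitionsLE m, ∑ β ∈ partitionsLE m,
      (lr κ {α, β} : A) * jt H α * jt H' β := by
  classical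
  set n := κ.card with hn
  have h0'' : PowerSeries.coeff 0 (H * H') = 1 := by
    rw [PowerSeries.coeff_zero_eq_constantCoeff] at h0 h0' ⊢
    rw [map_mul, h0, h0', one_mul]
  -- the Cauchy kernel is multiplicative in the power series; both sides are
  -- expanded in Schur polynomials in `n` variables
  have hK := kernelPart_X_eq (N := n) h0'' le_rfl
  have hprod : kernelPart (PowerSeries.map MvPolynomial.C (H * H'))
      (MvPolynomial.X : Fin n → MvPolynomial (Fin n) A) n =
      ∑ q ∈ Finset.HasAntidiagonal.antidiagonal n,
        kernelPart (PowerSeries.map MvPolynomial.C H)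
          (MvPolynomial.X : Fin n → MvPolynomial (Fin n) A) q.1 *
        kernelPart (PowerSeries.map MvPolynomial.C H')
          (MvPolynomial.X : Fin n → MvPolynomial (Fin n) A) q.2 := by
    rw [kernelPart, map_mul]
    simp only [map_mul, Finset.prod_mul_distrib]
    rw [PowerSeries.coeff_mul]
    rfl
  have hterm : ∀ q ∈ Finset.HasAntidiagonal.antidiagonal n,
      kernelPart (PowerSeries.map MvPolynomial.C H)
          (MvPolynomial.X : Fin n → MvPolynomial (Fin n) A) q.1 *
        kernelPart (PowerSeries.map MvPolynomial.C H')
          (MvPolynomial.X : Fin n → MvPolynomial (Fin n) A) q.2 =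
      ∑ η ∈ partitionsEq n, MvPolynomial.C (∑ α ∈ partitionsEq q.1, ∑ β ∈ partitionsEq q.2,
        (lr η {α, β} : A) * jt H α * jt H' β) * schurPoly A n η := by
    intro q hq
    have hq' := Finset.HasAntidiagonal.mem_antidiagonal.mp hq
    rw [kernelPart_X_eq h0 (by omega), kernelPart_X_eq h0' (by omega), Finset.sum_mul_sum]
    simp only [map_sum, Finset.sum_mul]
    rw [Finset.sum_comm (s := partitionsEq n)]
    refine Finset.sum_congr rfl fun α hα => ?_
    rw [Finset.sum_comm (s := partitionsEq n)]
    refine Finset.sum_congr rfl fun β hβ => ?_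
    rw [mem_partitionsEq] at hα hβ
    rw [mul_mul_mul_comm, jt_mul_jt _ _ α β (m := n) (by omega), Finset.mul_sum]
    rw [sum_partitionsEq_eq (le_refl n)]
    · refine Finset.sum_congr rfl fun η _ => ?_
      rw [schurPoly, map_mul, map_mul, map_intCast]
      ring
    · intro η hη
      have : lr η {α, β} ≠ 0 := fun h => hη (by
        rw [h, Int.cast_zero, zero_mul, zero_mul, map_zero, zero_mul])
      rw [card_eq_of_lr_pair_ne_zero this]
      omega
  rw [hprod, Finset.sum_congr rfl hterm, Finset.sum_comm] at hK
  simp only [← Finset.sum_mul, ← map_sum] at hK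
  have := schurPoly_coeff_unique (colLen_le_of_mem_partitionsEq le_rfl) hK κ
    (mem_partitionsEq.mpr hn.symm)
  rw [← this]
  have hq : ∀ q ∈ Finset.HasAntidiagonal.antidiagonal n,
      ∑ α ∈ partitionsEq q.1, ∑ β ∈ partitionsEq q.2,
      (lr κ {α, β} : A) * jt H α * jt H' β = ∑ α ∈ partitionsEq q.1, ∑ β ∈ partitionsLE m,
      (lr κ {α, β} : A) * jt H α * jt H' β := by
    intro q hq
    have hq' := Finset.HasAntidiagonal.mem_antidiagonal.mp hq
    refine Finset.sum_congr rfl fun α hα => ?_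
    rw [mem_partitionsEq] at hα
    refine sum_partitionsEq_eq (by omega) fun β hβ => ?_
    have : lr κ {α, β} ≠ 0 := fun h =>
      hβ (by rw [h, Int.cast_zero, zero_mul, zero_mul])
    have := card_eq_of_lr_pair_ne_zero this
    omega
  rw [Finset.sum_congr rfl hq, Finset.Nat.sum_antidiagonal_eq_sum_range_succ_mk]
  simp only
  rw [Finset.sum_sigma' (Finset.range n.succ) fun k => partitionsEq k]
  refine Finset.sum_bij_ne_zero (fun x _ _ => x.2) ?_ ?_ ?_ ?_
  · rintro ⟨k, α⟩ hx _
    simp only [Finset.mem_sigma, Finset.mem_range, mem_partitionsEq, mem_partitionsLE] at hx ⊢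
    omega
  · rintro ⟨k, α⟩ hx _ ⟨k', α'⟩ hx' _ h
    simp only [Finset.mem_sigma, mem_partitionsEq] at hx hx' h
    obtain ⟨_, rfl⟩ := hx
    obtain ⟨_, rfl⟩ := hx'
    rw [h]
  · intro α hα hne
    obtain ⟨β, _, hβ⟩ := Finset.exists_ne_zero_of_sum_ne_zero hne
    have h1 : lr κ {α, β} ≠ 0 := fun h =>
      hβ (by rw [h, Int.cast_zero, zero_mul, zero_mul])
    have h2 := card_eq_of_lr_pair_ne_zero h1
    refine ⟨⟨α.card, α⟩, ?_, hne, rfl⟩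
    simp only [Finset.mem_sigma, Finset.mem_range, mem_partitionsEq, and_true]
    omega
  · rintro ⟨k, α⟩ _ _
    rfl

/-! ### Two independent sets of variables -/

/-- The first of two sets of `N` variables. -/
noncomputable def firstVar (N : ℕ) (i : Fin N) : MvPolynomial (Fin N) (MvPolynomial (Fin N) ℤ) :=
  MvPolynomial.C (MvPolynomial.X i)

/-- The second of two sets of `N` variables. -/
noncomputable def secondVar (N : ℕ) (i : Fin N) : MvPolynomial (Fin N) (MvPolynomial (Fin N) ℤ) :=
  MvPolynomial.X i

theorem jt_firstVar (N : ℕ) (κ : YoungDiagram) :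
    jt (∏ i, geo (firstVar N i)) κ = MvPolynomial.C (schurPoly ℤ N κ) := by
  rw [schurPoly, ← jt_map, map_prod]
  simp only [map_geo]
  rfl

theorem two_schur_unique {m N : ℕ} (hm : m ≤ N) {c c' : YoungDiagram → YoungDiagram → ℤ}
    (h : ∑ α ∈ partitionsLE m, ∑ β ∈ partitionsLE m, (c α β : MvPolynomial (Fin N)
        (MvPolynomial (Fin N) ℤ)) * jt (∏ i, geo (firstVar N i)) α *
          jt (∏ i, geo (secondVar N i)) β =
      ∑ α ∈ partitionsLE m, ∑ β ∈ partitionsLE m, (c' α β : MvPolynomial (Fin N)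
        (MvPolynomial (Fin N) ℤ)) * jt (∏ i, geo (firstVar N i)) α *
          jt (∏ i, geo (secondVar N i)) β) {α β : YoungDiagram} (hα : α.card ≤ m)
    (hβ : β.card ≤ m) : c α β = c' α β := by
  have key : ∀ c : YoungDiagram → YoungDiagram → ℤ,
      ∑ α ∈ partitionsLE m, ∑ β ∈ partitionsLE m, (c α β : MvPolynomial (Fin N)
        (MvPolynomial (Fin N) ℤ)) * jt (∏ i, geo (firstVar N i)) α *
          jt (∏ i, geo (secondVar N i)) β =
      ∑ β ∈ partitionsLE m, MvPolynomial.C (∑ α ∈ partitionsLE m,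
        MvPolynomial.C (c α β) * schurPoly ℤ N α) * schurPoly (MvPolynomial (Fin N) ℤ) N β := by
    intro c
    rw [Finset.sum_comm]
    refine Finset.sum_congr rfl fun β _ => ?_
    rw [map_sum, Finset.sum_mul]
    refine Finset.sum_congr rfl fun α _ => ?_
    rw [jt_firstVar, map_mul, eq_intCast MvPolynomial.C (c α β), map_intCast]
    rfl
  rw [key, key] at h
  have hcol : ∀ κ ∈ partitionsLE m, κ.colLen 0 ≤ N := fun κ hκ => colLen_le_of_mem hm hκ
  have h1 := schurPoly_coeff_unique hcol h β (mem_partitionsLE.mpr hβ)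
  exact schurPoly_coeff_unique hcol (c := fun α => c α β) (c' := fun α => c' α β) h1 α
    (mem_partitionsLE.mpr hα)

/-- Conjugation preserves Littlewood–Richardson coefficients. -/
theorem lr_transpose (κ α β : YoungDiagram) :
    lr κ.transpose {α.transpose, β.transpose} = lr κ {α, β} := by
  set m := κ.card + α.card + β.card with hm
  have hE := jt_mul (coeff_zero_prod_linear Finset.univ (firstVar m))
    (coeff_zero_prod_linear Finset.univ (secondVar m)) κ (m := m) (by omega)
  have hG := jt_mul (coeff_zero_prod_geo Finset.univ (firstVar m))
    (coeff_zero_prod_geo Finset.univ (secondVar m)) κ.transpose (m := m)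
    (by rw [card_transpose]; omega)
  have hEG : jt ((∏ i, (1 + PowerSeries.C (firstVar m i) * PowerSeries.X)) *
      ∏ i, (1 + PowerSeries.C (secondVar m i) * PowerSeries.X)) κ =
      jt ((∏ i, geo (firstVar m i)) * ∏ i, geo (secondVar m i)) κ.transpose := by
    have := jt_prod_linear (Finset.univ : Finset (Fin m ⊕ Fin m))
      (Sum.elim (firstVar m) (secondVar m)) κ
    simpa [Fintype.prod_sum_type] using this
  rw [hE, hG] at hEG
  simp only [jt_prod_linear] at hEG
  have hre : ∀ f : YoungDiagram → MvPolynomial (Fin m) (MvPolynomial (Fin m) ℤ),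
      ∑ α ∈ partitionsLE m, f α.transpose = ∑ α ∈ partitionsLE m, f α := by
    intro f
    refine Finset.sum_bij' (fun η _ => η.transpose) (fun η _ => η.transpose) ?_ ?_ ?_ ?_ ?_
    · intro η hη
      simpa [card_transpose] using hη
    · intro η hη
      simpa [card_transpose] using hη
    · intro η _
      exact η.transpose_transpose
    · intro η _
      exact η.transpose_transpose
    · intro η _
      rfl
  have hEG' : ∑ α ∈ partitionsLE m, ∑ β ∈ partitionsLE m,
      ((lr κ {α.transpose, β.transpose} : ℤ) : MvPolynomial (Fin m) (MvPolynomial (Fin m) ℤ)) *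
        jt (∏ i, geo (firstVar m i)) α * jt (∏ i, geo (secondVar m i)) β =
      ∑ α ∈ partitionsLE m, ∑ β ∈ partitionsLE m, (lr κ.transpose {α, β} : MvPolynomial (Fin m)
        (MvPolynomial (Fin m) ℤ)) *
        jt (∏ i, geo (firstVar m i)) α * jt (∏ i, geo (secondVar m i)) β := by
    rw [← hEG, ← hre]
    refine Finset.sum_congr rfl fun α _ => ?_
    rw [← hre]
    refine Finset.sum_congr rfl fun β _ => ?_
    rw [α.transpose_transpose, β.transpose_transpose]
  have := two_schur_unique le_rfl hEG' (α := α.transpose) (β := β.transpose)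
    (by rw [card_transpose]; omega) (by rw [card_transpose]; omega)
  rw [← this, α.transpose_transpose, β.transpose_transpose]

/-- Multiplication and comultiplication of Schur functions are compatible. -/
theorem sum_lr_mul_lr (σ τ σ' τ' : YoungDiagram) {m M : ℕ} (hσ : σ.card ≤ m) (hτ : τ.card ≤ m)
    (hσ' : σ'.card ≤ m) (hτ' : τ'.card ≤ m) (hM : 2 * m ≤ M) :
    ∑ κ ∈ partitionsLE M, lr κ {σ, τ} * lr κ {σ', τ'} =
      ∑ α ∈ partitionsLE m, ∑ β ∈ partitionsLE m, ∑ γ ∈ partitionsLE m, ∑ ε ∈ partitionsLE m,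
        lr σ {α, β} * lr τ {γ, ε} * lr σ' {α, γ} * lr τ' {β, ε} := by
  have g1 := coeff_zero_prod_geo Finset.univ (firstVar M)
  have g2 := coeff_zero_prod_geo Finset.univ (secondVar M)
  set G1 := ∏ i, geo (firstVar M i) with hG1
  set G2 := ∏ i, geo (secondVar M i) with hG2
  have hmul := jt_mul_jt (Finset.univ : Finset (Fin M ⊕ Fin M))
      (Sum.elim (firstVar M) (secondVar M)) σ τ (m := M) (by omega)
  rw [Fintype.prod_sum_type] at hmul
  simp only [Sum.elim_inl, Sum.elim_inr, ← hG1, ← hG2] at hmul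
  -- the coefficients of `(s_σ s_τ)(x, y)`, splitting the variables before multiplying
  have hL : jt (G1 * G2) σ * jt (G1 * G2) τ = ∑ σ' ∈ partitionsLE M, ∑ τ' ∈ partitionsLE M,
      ((∑ α ∈ partitionsLE m, ∑ β ∈ partitionsLE m, ∑ γ ∈ partitionsLE m, ∑ ε ∈ partitionsLE m,
        lr σ {α, β} * lr τ {γ, ε} * lr σ' {α, γ} * lr τ' {β, ε} : ℤ) :
        MvPolynomial (Fin M) (MvPolynomial (Fin M) ℤ)) * jt G1 σ' * jt G2 τ' := by
    rw [jt_mul g1 g2 σ hσ, jt_mul g1 g2 τ hτ, Finset.sum_mul_sum]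
    simp only [Finset.sum_mul_sum]
    have hterm : ∀ α ∈ partitionsLE m, ∀ β ∈ partitionsLE m, ∀ γ ∈ partitionsLE m,
        ∀ ε ∈ partitionsLE m,
        ((lr σ {α, β} : ℤ) : MvPolynomial (Fin M) (MvPolynomial (Fin M) ℤ)) * jt G1 α * jt G2 β *
          (((lr τ {γ, ε} : ℤ) : MvPolynomial (Fin M) (MvPolynomial (Fin M) ℤ)) * jt G1 γ *
            jt G2 ε) =
        ∑ σ' ∈ partitionsLE M, ∑ τ' ∈ partitionsLE M,
          ((lr σ {α, β} * lr τ {γ, ε} * lr σ' {α, γ} * lr τ' {β, ε} : ℤ) :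
            MvPolynomial (Fin M) (MvPolynomial (Fin M) ℤ)) * jt G1 σ' * jt G2 τ' := by
      intro α hα β hβ γ hγ ε hε
      rw [mem_partitionsLE] at hα hβ hγ hε
      have e1 := jt_mul_jt Finset.univ (firstVar M) α γ (m := M) (by omega)
      have e2 := jt_mul_jt Finset.univ (secondVar M) β ε (m := M) (by omega)
      calc _ = ((lr σ {α, β} : ℤ) : MvPolynomial (Fin M) (MvPolynomial (Fin M) ℤ)) *
            (lr τ {γ, ε} : ℤ) * ((jt G1 α * jt G1 γ) * (jt G2 β * jt G2 ε)) := by ring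
        _ = _ := by
            rw [e1, e2, Finset.sum_mul_sum, Finset.mul_sum]
            refine Finset.sum_congr rfl fun σ' _ => ?_
            rw [Finset.mul_sum]
            refine Finset.sum_congr rfl fun τ' _ => ?_
            push_cast
            ring
    have hL' : ∀ F : YoungDiagram → YoungDiagram → YoungDiagram → YoungDiagram →
        MvPolynomial (Fin M) (MvPolynomial (Fin M) ℤ), ∀ B : Finset YoungDiagram,
        ∑ α ∈ B, ∑ γ ∈ B, ∑ β ∈ B, ∑ ε ∈ B, F α β γ ε =
        ∑ α ∈ B, ∑ β ∈ B, ∑ γ ∈ B, ∑ ε ∈ B, F α β γ ε := fun F B =>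
      Finset.sum_congr rfl fun α _ => Finset.sum_comm
    rw [hL' (fun α β γ ε => ((lr σ {α, β} : ℤ) : MvPolynomial (Fin M) (MvPolynomial (Fin M) ℤ)) *
      jt G1 α * jt G2 β * (((lr τ {γ, ε} : ℤ) : MvPolynomial (Fin M) (MvPolynomial (Fin M) ℤ)) *
      jt G1 γ * jt G2 ε))]
    rw [Finset.sum_congr rfl fun α hα => Finset.sum_congr rfl fun β hβ =>
      Finset.sum_congr rfl fun γ hγ => Finset.sum_congr rfl fun ε hε => hterm α hα β hβ γ hγ ε hε]
    push_cast
    simp only [Finset.sum_mul]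
    simp only [Finset.sum_comm (s := partitionsLE m) (t := partitionsLE M)]
  -- the same coefficients, multiplying before splitting the variables
  have hR : jt (G1 * G2) σ * jt (G1 * G2) τ = ∑ σ' ∈ partitionsLE M, ∑ τ' ∈ partitionsLE M,
      ((∑ κ ∈ partitionsLE M, lr κ {σ, τ} * lr κ {σ', τ'} : ℤ) :
        MvPolynomial (Fin M) (MvPolynomial (Fin M) ℤ)) * jt G1 σ' * jt G2 τ' := by
    rw [hmul]
    have hterm : ∀ κ ∈ partitionsLE M,
        ((lr κ {σ, τ} : ℤ) : MvPolynomial (Fin M) (MvPolynomial (Fin M) ℤ)) * jt (G1 * G2) κ =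
        ∑ σ' ∈ partitionsLE M, ∑ τ' ∈ partitionsLE M, ((lr κ {σ, τ} * lr κ {σ', τ'} : ℤ) :
          MvPolynomial (Fin M) (MvPolynomial (Fin M) ℤ)) * jt G1 σ' * jt G2 τ' := by
      intro κ hκ
      rw [jt_mul g1 g2 κ (mem_partitionsLE.mp hκ), Finset.mul_sum]
      refine Finset.sum_congr rfl fun σ' _ => ?_
      rw [Finset.mul_sum]
      refine Finset.sum_congr rfl fun τ' _ => ?_
      push_cast
      ring
    rw [Finset.sum_congr rfl hterm, Finset.sum_comm]
    refine Finset.sum_congr rfl fun σ' _ => ?_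
    rw [Finset.sum_comm]
    refine Finset.sum_congr rfl fun τ' _ => ?_
    push_cast
    simp only [Finset.sum_mul]
  exact two_schur_unique le_rfl (hR.symm.trans hL) (by omega) (by omega)

theorem lr_bot_left (κ τ : YoungDiagram) :
    lr κ {⊥, τ} = open Classical in if κ = τ then 1 else 0 := by
  classical
  set m := κ.card + τ.card with hm
  have h := jt_mul_jt Finset.univ (MvPolynomial.X : Fin m → MvPolynomial (Fin m) ℤ) ⊥ τ (m := m)
    (by rw [card_bot]; omega)
  refine schurPoly_coeff_unique (N := m) (B := partitionsLE m) (c := fun κ => lr κ {⊥, τ})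
    (c' := fun κ => if κ = τ then 1 else 0) (fun κ hκ => colLen_le_of_mem le_rfl hκ) ?_ κ
    (mem_partitionsLE.mpr (by omega))
  rw [jt_bot, one_mul] at h
  have h2 : ∑ κ ∈ partitionsLE m, MvPolynomial.C (if κ = τ then (1 : ℤ) else 0) *
      schurPoly ℤ m κ = schurPoly ℤ m τ := by
    rw [Finset.sum_eq_single τ]
    · simp
    · intro η _ hη
      simp [hη]
    · intro hτ
      exact absurd (mem_partitionsLE.mpr (by omega)) hτ
  rw [h2]
  simp only [eq_intCast MvPolynomial.C]
  exact h.symm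

theorem lr_pair_comm (κ α β : YoungDiagram) : lr κ {α, β} = lr κ {β, α} := by
  rw [Multiset.pair_comm]

end LittlewoodRichardson

/-! ### Schur P-functions at the elements of a finite subset of a field -/

section SchurP

variable {F : Type} [Field F] [DecidableEq F]

/-- The product `∏_{v ∈ V} (u + v) / (u - v)`. -/
noncomputable def crossProd (u : F) (V : Finset F) : F := ∏ v ∈ V, (u + v) / (u - v)

/-- The Schur P-function `P_l` of a sequence `l` of exponents, at the elements of `V`:
the sum over all injective choices of variables `v_1, v_2, …` of
`∏_i v_i ^ l_i ∏_{w ≠ v_1, …, v_i} (v_i + w) / (v_i - w)`. -/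
noncomputable def pfun : List ℕ → Finset F → F
  | [], _ => 1
  | a :: l, V => ∑ v ∈ V, v ^ a * crossProd v (V.erase v) * pfun l (V.erase v)

/-- The part of `pfun l (insert u V)` in which `u` has exponent zero. -/
noncomputable def pfunRest (u : F) : List ℕ → Finset F → F
  | [], _ => 1
  | a :: l, V => ∑ v ∈ V, v ^ a * crossProd v (V.erase v) * ((v + u) / (v - u)) *
      pfunRest u l (V.erase v)

theorem crossProd_insert (u : F) {w : F} {V : Finset F} (hw : w ∉ V) :
    crossProd u (insert w V) = (u + w) / (u - w) * crossProd u V := by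
  rw [crossProd, Finset.prod_insert hw, crossProd]

theorem crossProd_erase (u : F) {v : F} {V : Finset F} (hv : v ∈ V) :
    (u + v) / (u - v) * crossProd u (V.erase v) = crossProd u V :=
  Finset.mul_prod_erase V (fun v => (u + v) / (u - v)) hv

theorem pfun_cons_cons (a b : ℕ) (l : List ℕ) (V : Finset F) :
    pfun (a :: b :: l) V = -pfun (b :: a :: l) V := by
  have h : ∀ a b, pfun (a :: b :: l) V = ∑ v ∈ V, ∑ w ∈ V, if w = v then 0 else
      v ^ a * w ^ b * ((v + w) / (v - w)) * crossProd v ((V.erase v).erase w) *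
        crossProd w ((V.erase v).erase w) * pfun l ((V.erase v).erase w) := by
    intro a b
    simp only [pfun]
    refine Finset.sum_congr rfl fun v hv => ?_
    rw [Finset.mul_sum, ← Finset.add_sum_erase V _ hv, if_pos rfl, zero_add]
    refine Finset.sum_congr rfl fun w hw => ?_
    rw [if_neg (Finset.ne_of_mem_erase hw), ← crossProd_erase v hw]
    ring
  rw [h a b, h b a, Finset.sum_comm, ← Finset.sum_neg_distrib]
  refine Finset.sum_congr rfl fun v _ => ?_
  rw [← Finset.sum_neg_distrib]
  refine Finset.sum_congr rfl fun w _ => ?_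
  by_cases hvw : v = w
  · simp [hvw]
  rw [if_neg hvw, if_neg (Ne.symm hvw), Finset.erase_right_comm (a := w) (b := v), ← neg_sub v w,
    div_neg, add_comm w v]
  ring

theorem pfun_getElem_cons_eraseIdx (l : List ℕ) (k : ℕ) (hk : k < l.length) (V : Finset F) :
    pfun (l[k] :: l.eraseIdx k) V = (-1) ^ k * pfun l V := by
  induction l generalizing k V with
  | nil => simp at hk
  | cons a l ih =>
    cases k with
    | zero => simp
    | succ k =>
      simp only [List.getElem_cons_succ, List.eraseIdx_cons_succ]
      rw [pfun_cons_cons]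
      have hk' : k < l.length := by simpa using hk
      rw [pfun, Finset.sum_congr rfl fun v _ => by rw [ih k hk' (V.erase v)], pfun, Finset.mul_sum,
        ← Finset.sum_neg_distrib]
      refine Finset.sum_congr rfl fun v _ => ?_
      ring

theorem pfun_cons_of_mem [CharZero F] {a : ℕ} {l : List ℕ} (ha : a ∈ l) (V : Finset F) :
    pfun (a :: l) V = 0 := by
  obtain ⟨k, hk, rfl⟩ := List.mem_iff_getElem.mp ha
  have h1 : pfun (l[k] :: l[k] :: l.eraseIdx k) V = 0 := self_eq_neg.mp (pfun_cons_cons _ _ _ V)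
  rw [pfun] at h1
  simp only [pfun_getElem_cons_eraseIdx] at h1
  rw [pfun]
  have h2 : (-1 : F) ^ k *
      ∑ v ∈ V, v ^ l[k] * crossProd v (V.erase v) * pfun l (V.erase v) = 0 := by
    rw [← h1, Finset.mul_sum]
    refine Finset.sum_congr rfl fun v _ => ?_
    ring
  rcases mul_eq_zero.mp h2 with h | h
  · exact absurd h (pow_ne_zero _ (neg_ne_zero.mpr one_ne_zero))
  · exact h

/-- The terms of `pfun l (insert u V)` sorted by the exponent of `u`. -/
theorem pfun_insert (u : F) (l : List ℕ) (V : Finset F) (hu : u ∉ V) :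
    pfun l (insert u V) = crossProd u V * ∑ k ∈ Finset.range l.length,
      (-1) ^ k * u ^ l.getD k 0 * pfun (l.eraseIdx k) V + pfunRest u l V := by
  induction l generalizing V with
  | nil => simp [pfun, pfunRest]
  | cons a l ih =>
    rw [pfun, Finset.sum_insert hu, Finset.erase_insert hu, List.length_cons,
      Finset.sum_range_succ']
    have hterm : ∀ v ∈ V, v ^ a * crossProd v ((insert u V).erase v) *
        pfun l ((insert u V).erase v) =
        -(crossProd u V * ∑ k ∈ Finset.range l.length, (-1) ^ k * u ^ l.getD k 0 *
          (v ^ a * crossProd v (V.erase v) * pfun (l.eraseIdx k) (V.erase v))) +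
        v ^ a * crossProd v (V.erase v) * ((v + u) / (v - u)) * pfunRest u l (V.erase v) := by
      intro v hv
      have hvu : u ≠ v := fun h => hu (h ▸ hv)
      have hu' : u ∉ V.erase v := fun h => hu (Finset.mem_of_mem_erase h)
      rw [Finset.erase_insert_of_ne hvu, crossProd_insert v hu', ih _ hu', ← crossProd_erase u hv]
      have h1 : (v + u) / (v - u) = -((u + v) / (u - v)) := by
        rw [← neg_sub u v, div_neg, add_comm]
      rw [h1, mul_add, Finset.mul_sum, Finset.mul_sum, Finset.mul_sum, ← Finset.sum_neg_distrib]
      congr 1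
      · refine Finset.sum_congr rfl fun k _ => ?_
        ring
      · ring
    rw [Finset.sum_congr rfl hterm, Finset.sum_add_distrib, pfunRest, ← add_assoc]
    congr 1
    simp only [List.getD_cons_succ, List.eraseIdx_cons_succ, List.getD_cons_zero,
      List.eraseIdx_cons_zero, pow_zero, one_mul, pfun]
    rw [Finset.sum_neg_distrib, ← Finset.mul_sum, Finset.sum_comm, mul_add, ← mul_neg,
      ← Finset.sum_neg_distrib, add_comm]
    congr 1
    · congr 1
      refine Finset.sum_congr rfl fun k _ => ?_
      rw [Finset.mul_sum, ← Finset.sum_neg_distrib]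
      refine Finset.sum_congr rfl fun v _ => ?_
      ring
    · ring

theorem pfun_insert_zero {l : List ℕ} (hl : ∀ a ∈ l, 0 < a) {V : Finset F} (h0 : (0 : F) ∉ V) :
    pfun l (insert 0 V) = pfun l V := by
  induction l generalizing V with
  | nil => rfl
  | cons a l ih =>
    rw [pfun, pfun, Finset.sum_insert h0, zero_pow (hl a (by simp)).ne', zero_mul, zero_mul,
      zero_add]
    refine Finset.sum_congr rfl fun v hv => ?_
    have hv0 : v ≠ 0 := fun h => h0 (h ▸ hv)
    have h0' : (0 : F) ∉ V.erase v := fun h => h0 (Finset.mem_of_mem_erase h)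
    rw [Finset.erase_insert_of_ne hv0.symm, crossProd_insert v h0',
      ih (fun b hb => hl b (by simp [hb])) h0', add_zero, sub_zero, div_self hv0, one_mul]

omit [DecidableEq F] in
theorem map_crossProd {L : Type} [Field L] [DecidableEq L] (φ : F →+* L) (u : F) (V : Finset F) :
    crossProd (φ u) (V.image φ) = φ (crossProd u V) := by
  rw [crossProd, Finset.prod_image fun _ _ _ _ h => φ.injective h, crossProd, map_prod]
  simp

theorem map_pfun {L : Type} [Field L] [DecidableEq L] (φ : F →+* L) (l : List ℕ)
    (V : Finset F) : pfun l (V.image φ) = φ (pfun l V) := by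
  induction l generalizing V with
  | nil => simp [pfun]
  | cons a l ih =>
    rw [pfun, Finset.sum_image fun _ _ _ _ h => φ.injective h, pfun, map_sum]
    refine Finset.sum_congr rfl fun v _ => ?_
    rw [← Finset.image_erase φ.injective, map_crossProd, ih]
    simp

open Polynomial in
/-- The numerator of `pfun l (insert u V)`, as a polynomial in `u`. -/
noncomputable def pfunNum : List ℕ → Finset F → F[X]
  | [], V => ∏ v ∈ V, (X - C v)
  | a :: l, V => X ^ a * (∏ v ∈ V, (X + C v)) * C (pfun l V) +
      ∑ v ∈ V, C (v ^ a * crossProd v (V.erase v)) * (-(X + C v)) * pfunNum l (V.erase v)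

open Polynomial in
theorem eval₂_pfunNum {L : Type} [Field L] [DecidableEq L] (φ : F →+* L) (l : List ℕ)
    {V : Finset F} {u : L} (hu : u ∉ V.image φ) :
    (pfunNum l V).eval₂ φ u = (∏ v ∈ V, (u - φ v)) * pfun l (insert u (V.image φ)) := by
  induction l generalizing V with
  | nil => simp [pfunNum, pfun, Polynomial.eval₂_finsetProd]
  | cons a l ih =>
    rw [pfunNum, pfun, Finset.sum_insert hu, Finset.erase_insert hu,
      Finset.sum_image fun _ _ _ _ h => φ.injective h, mul_add]
    simp only [eval₂_add, eval₂_mul, eval₂_pow, eval₂_X, eval₂_finsetProd, eval₂_C,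
      eval₂_finsetSum, eval₂_neg]
    have hne : ∀ v ∈ V, u - φ v ≠ 0 := fun v hv h => hu
      (Finset.mem_image.mpr ⟨v, hv, (sub_eq_zero.mp h).symm⟩)
    congr 1
    · rw [map_pfun, crossProd, Finset.prod_image fun _ _ _ _ h => φ.injective h,
        Finset.prod_div_distrib]
      have := Finset.prod_ne_zero_iff.mpr hne
      field_simp
    · rw [Finset.mul_sum]
      refine Finset.sum_congr rfl fun v hv => ?_
      have hv' : u ≠ φ v := sub_ne_zero.mp (hne v hv)
      have hu' : u ∉ (V.erase v).image φ := fun h =>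
        hu (Finset.image_subset_image (Finset.erase_subset _ _) h)
      rw [Finset.erase_insert_of_ne hv', ← Finset.image_erase φ.injective, crossProd_insert _ hu',
        map_crossProd, ih hu', ← Finset.mul_prod_erase V _ hv]
      have h1 : φ v - u ≠ 0 := sub_ne_zero.mpr hv'.symm
      field_simp
      simp only [map_mul, map_pow]
      ring

open Polynomial in
theorem eval_pfunNum_of_mem (l : List ℕ) {V : Finset F} {u : F} (hu : u ∈ V) :
    (pfunNum l V).eval u = 0 := by
  induction l generalizing V with
  | nil =>
    rw [pfunNum, eval_prod]
    exact Finset.prod_eq_zero hu (by simp)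
  | cons a l ih =>
    rw [pfunNum]
    simp only [eval_add, eval_mul, eval_pow, eval_X, eval_prod, eval_C, eval_finsetSum, eval_neg]
    rw [Finset.sum_eq_single u]
    · have h1 := eval₂_pfunNum (RingHom.id F) l (V := V.erase u) (u := u) (by simp)
      have h2 : (V.erase u).image (RingHom.id F) = V.erase u := by
        ext
        simp
      rw [h2, Finset.insert_erase hu] at h1
      change (pfunNum l (V.erase u)).eval u = _ at h1
      rw [h1, crossProd, Finset.prod_div_distrib, ← Finset.mul_prod_erase V _ hu]
      have h3 : ∏ v ∈ V.erase u, (u - v) ≠ 0 := Finset.prod_ne_zero_iff.mpr fun v hv =>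
        sub_ne_zero.mpr (Finset.ne_of_mem_erase hv).symm
      simp only [RingHom.id_apply]
      field_simp
      ring
    · intro v hv hvu
      rw [ih (Finset.mem_erase.mpr ⟨hvu.symm, hu⟩), mul_zero]
    · exact fun h => absurd hu h

/-- `pfun l (insert u V)` is a polynomial in `u`. -/
theorem exists_pfun_polynomial (l : List ℕ) (V : Finset F) :
    ∃ f : Polynomial F, ∀ {L : Type} [Field L] [DecidableEq L] (φ : F →+* L) {u : L},
      u ∉ V.image φ → pfun l (insert u (V.image φ)) = f.eval₂ φ u := by
  obtain ⟨f, hf⟩ : (∏ v ∈ V, (Polynomial.X - Polynomial.C v)) ∣ pfunNum l V := by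
    refine Finset.prod_dvd_of_coprime ?_ fun v hv => ?_
    · intro v _ w _ hvw
      exact Polynomial.isCoprime_X_sub_C_of_isUnit_sub (sub_ne_zero.mpr hvw).isUnit
    · exact Polynomial.dvd_iff_isRoot.mpr (eval_pfunNum_of_mem l hv)
  refine ⟨f, fun {L} _ _ φ u hu => ?_⟩
  have h1 := eval₂_pfunNum φ l hu
  rw [hf, Polynomial.eval₂_mul, Polynomial.eval₂_finsetProd] at h1
  simp only [Polynomial.eval₂_sub, Polynomial.eval₂_X, Polynomial.eval₂_C] at h1
  have hne : ∏ v ∈ V, (u - φ v) ≠ 0 := Finset.prod_ne_zero_iff.mpr fun v hv h =>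
    hu (Finset.mem_image.mpr ⟨v, hv, (sub_eq_zero.mp h).symm⟩)
  exact (mul_left_cancel₀ hne h1).symm

/-- The series `(1 + aT) / (1 - aT)`. -/
noncomputable def qgeo {A : Type*} [CommRing A] (a : A) : PowerSeries A :=
  geo a * (1 + PowerSeries.C a * PowerSeries.X)

/-- The generating series of the Schur q-functions of `V`. -/
noncomputable def qser (V : Finset F) : PowerSeries F := ∏ v ∈ V, qgeo v

omit [DecidableEq F] in
theorem qgeo_mul (a : F) : qgeo a * (1 - PowerSeries.C a * PowerSeries.X) =
    1 + PowerSeries.C a * PowerSeries.X := by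
  have := geo_mul a
  rw [map_neg, neg_mul, ← sub_eq_add_neg] at this
  rw [qgeo, mul_right_comm, this, one_mul]

/-- Expanding at `u = ∞`: the coefficient of a positive power `u ^ m` in `pfun l (insert u V)`. -/
theorem coeff_pfun_polynomial (l : List ℕ) (V : Finset F) {f : Polynomial F}
    (hf : ∀ {L : Type} [Field L] [DecidableEq L] (φ : F →+* L) {u : L},
      u ∉ V.image φ → pfun l (insert u (V.image φ)) = f.eval₂ φ u) {m : ℕ} (hm : 0 < m) :
    f.coeff m = ∑ k ∈ Finset.range l.length,
      (-1) ^ k * intCoeff (qser V) ((l.getD k 0 : ℤ) - m) * pfun (l.eraseIdx k) V := by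
  classical
  let φ : F →+* LaurentSeries F := HahnSeries.C
  let ι : PowerSeries F →+* LaurentSeries F := HahnSeries.ofPowerSeries ℤ F
  -- `T` plays the role of `1 / u`, so that `(u + v) / (u - v)` is the series `qgeo v` in `T`
  set T : LaurentSeries F := HahnSeries.single 1 1 with hT
  set u : LaurentSeries F := HahnSeries.single (-1) 1 with hu
  have huT : u * T = 1 := by
    rw [hu, hT, HahnSeries.single_mul_single]
    simp
  have hTX : ι PowerSeries.X = T := HahnSeries.ofPowerSeries_X
  have hιC : ∀ a, ι (PowerSeries.C a) = φ a := fun a => HahnSeries.ofPowerSeries_C a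
  have hcoeff0 : ∀ g : PowerSeries F, ∀ k : ℤ, (ι g).coeff k = intCoeff g k := by
    intro g k
    rcases lt_or_ge k 0 with hk | hk
    · rw [intCoeff_of_neg g hk]
      exact HahnSeries.embDomain_of_notMem_range (by
        rintro ⟨n, hn⟩
        have hn' : ((n : ℕ) : ℤ) = k := hn
        omega)
    · obtain ⟨k, rfl⟩ := Int.eq_ofNat_of_zero_le hk
      rw [intCoeff_natCast]
      exact HahnSeries.ofPowerSeries_apply_coeff g k
  have hone : ∀ v : F, (1 : LaurentSeries F) - φ v * T ≠ 0 := by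
    intro v h
    have h1 : ι (1 - PowerSeries.C v * PowerSeries.X) = 0 := by
      rw [map_sub, map_mul, map_one, hTX, hιC, h]
    have h2 := hcoeff0 (1 - PowerSeries.C v * PowerSeries.X) ((0 : ℕ) : ℤ)
    rw [h1, intCoeff_natCast] at h2
    simp at h2
  have hfrac : ∀ v : F, (u + φ v) / (u - φ v) = ι (qgeo v) := by
    intro v
    have hune : u - φ v ≠ 0 := by
      intro h
      refine hone v ?_
      have : (u - φ v) * T = 1 - φ v * T := by rw [sub_mul, huT]
      rw [← this, h, zero_mul]
    rw [div_eq_iff hune]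
    have h1 := congrArg ι (qgeo_mul v)
    rw [map_mul, map_sub, map_add, map_mul, map_one, hTX, hιC] at h1
    have hT0 : T ≠ 0 := right_ne_zero_of_mul_eq_one huT
    refine mul_right_cancel₀ hT0 ?_
    rw [mul_assoc, sub_mul, add_mul, huT, h1]
  have hnot : u ∉ V.image φ := by
    intro h
    obtain ⟨v, _, hv⟩ := Finset.mem_image.mp h
    refine hone v ?_
    rw [hv, huT, sub_self]
  have hcross : crossProd u (V.image φ) = ι (qser V) := by
    rw [crossProd, Finset.prod_image fun _ _ _ _ h => φ.injective h, qser, map_prod]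
    exact Finset.prod_congr rfl fun v _ => hfrac v
  -- the terms without a power of `u` contribute to non-negative powers of `T` only
  have hrest : ∀ (l : List ℕ) (V : Finset F), ∃ g, pfunRest u l (V.image φ) = ι g := by
    intro l
    induction l with
    | nil => exact fun V => ⟨1, by simp [pfunRest]⟩
    | cons a l ih =>
      intro V
      choose g hg using ih
      refine ⟨∑ v ∈ V, PowerSeries.C (v ^ a * crossProd v (V.erase v)) * (-qgeo v) *
        g (V.erase v), ?_⟩
      rw [pfunRest, Finset.sum_image fun _ _ _ _ h => φ.injective h, map_sum]
      refine Finset.sum_congr rfl fun v _ => ?_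
      rw [← Finset.image_erase φ.injective, map_crossProd, hg, map_mul, map_mul, map_neg, ← hfrac,
        hιC, map_mul, map_pow, ← neg_sub u (φ v), div_neg, add_comm (φ v) u]
  obtain ⟨g, hg⟩ := hrest l V
  have key := (hf φ hnot).symm.trans (pfun_insert u l _ hnot)
  rw [hcross, hg, Polynomial.eval₂_eq_sum_range] at key
  have hupow : ∀ k : ℕ, u ^ k = HahnSeries.single (-(k : ℤ)) (1 : F) := by
    intro k
    rw [hu, HahnSeries.single_pow]
    simp
  have hc := congrArg (fun z : LaurentSeries F => z.coeff (-(m : ℤ))) key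
  simp only [HahnSeries.coeff_add, hcoeff0, intCoeff_of_neg g (show -(m : ℤ) < 0 by omega),
    add_zero, hupow, HahnSeries.coeff_sum, map_pfun] at hc
  have hL : ∀ k : ℕ, (φ (f.coeff k) * HahnSeries.single (-(k : ℤ)) (1 : F)).coeff (-(m : ℤ)) =
      if k = m then f.coeff k else 0 := by
    intro k
    change (HahnSeries.C (f.coeff k) * _ : LaurentSeries F).coeff _ = _
    rw [HahnSeries.C_mul_eq_smul, HahnSeries.coeff_smul, HahnSeries.coeff_single]
    split_ifs <;> first | omega | simp
  simp only [hL] at hc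
  rw [Finset.sum_ite_eq'] at hc
  have hm' : (if m ∈ Finset.range (f.natDegree + 1) then f.coeff m else 0) = f.coeff m := by
    split_ifs with h
    · rfl
    · rw [Finset.mem_range, not_lt] at h
      exact (Polynomial.coeff_eq_zero_of_natDegree_lt (by omega)).symm
  rw [hm'] at hc
  rw [hc, Finset.mul_sum, HahnSeries.coeff_sum]
  refine Finset.sum_congr rfl fun k _ => ?_
  have : ι (qser V) * ((-1) ^ k * HahnSeries.single (-((l.getD k 0 : ℕ) : ℤ)) (1 : F) *
      φ (pfun (l.eraseIdx k) V)) = φ ((-1) ^ k * pfun (l.eraseIdx k) V) *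
      (HahnSeries.single (-((l.getD k 0 : ℕ) : ℤ)) (1 : F) * ι (qser V)) := by
    rw [map_mul φ, map_pow φ, map_neg φ, map_one φ]
    ring
  rw [this]
  change (HahnSeries.C _ * _ : LaurentSeries F).coeff _ = _
  rw [HahnSeries.C_mul_eq_smul, HahnSeries.coeff_smul]
  have h2 := HahnSeries.coeff_single_mul_add (r := (1 : F)) (x := ι (qser V))
    (a := -(m : ℤ) + (l.getD k 0 : ℕ)) (b := -((l.getD k 0 : ℕ) : ℤ))
  rw [add_neg_cancel_right, one_mul, hcoeff0] at h2
  rw [h2, smul_eq_mul, neg_add_eq_sub]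
  ring

/-- The branching rule: `pfun l (insert u V)` as a polynomial in `u`. -/
theorem pfun_insert_eq_sum {l : List ℕ} (hl : ∀ a ∈ l, 0 < a) {V : Finset F} (h0 : (0 : F) ∉ V)
    {u : F} (hu : u ∉ V) {n : ℕ} (hn : ∀ a ∈ l, a ≤ n) :
    pfun l (insert u V) = pfun l V + ∑ m ∈ Finset.Icc 1 n, u ^ m *
      ∑ k ∈ Finset.range l.length,
        (-1) ^ k * intCoeff (qser V) ((l.getD k 0 : ℤ) - m) * pfun (l.eraseIdx k) V := by
  obtain ⟨f, hf⟩ := exists_pfun_polynomial l V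
  have hid : V.image (RingHom.id F) = V := by ext; simp
  have h1 : pfun l (insert u V) = f.eval u := by
    have := hf (RingHom.id F) (u := u) (by rwa [hid])
    rwa [hid] at this
  have h2 : pfun l V = f.coeff 0 := by
    have := hf (RingHom.id F) (u := 0) (by rwa [hid])
    rw [hid, pfun_insert_zero hl h0] at this
    rw [this, Polynomial.coeff_zero_eq_eval_zero]
    rfl
  have hc : ∀ m, 0 < m → f.coeff m = _ := fun m hm => coeff_pfun_polynomial l V hf hm
  have hdeg : f.natDegree < n + 1 := by
    rw [Nat.lt_succ_iff, Polynomial.natDegree_le_iff_coeff_eq_zero]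
    intro m hm
    rw [hc m (by omega)]
    refine Finset.sum_eq_zero fun k hk => ?_
    have hk' := Finset.mem_range.mp hk
    have h3 : l.getD k 0 ≤ n := by
      rw [List.getD_eq_getElem _ _ hk']
      exact hn _ (List.getElem_mem hk')
    rw [intCoeff_of_neg _ (by omega)]
    ring
  rw [h1, Polynomial.eval_eq_sum_range' hdeg, Finset.sum_range_succ', h2, add_comm, pow_zero,
    mul_one]
  congr 1
  rw [Finset.range_eq_Ico, Finset.sum_Ico_add' (fun m => f.coeff m * u ^ m) 0 n 1]
  refine Finset.sum_congr (by ext; simp) fun m hm => ?_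
  rw [hc m (by simp at hm; omega)]
  ring

end SchurP

/-! ### The Cauchy identity for Schur P-functions -/

/-- The finite sets of positive integers with sum `n`, that is, the strict partitions of `n`. -/
def strictSets (n : ℕ) : Finset (Finset ℕ) :=
  (Finset.Icc 1 n).powerset.filter fun S => ∑ a ∈ S, a = n

theorem mem_strictSets {n : ℕ} {S : Finset ℕ} :
    S ∈ strictSets n ↔ 0 ∉ S ∧ ∑ a ∈ S, a = n := by
  rw [strictSets, Finset.mem_filter, Finset.mem_powerset]
  constructor
  · rintro ⟨h1, h2⟩
    exact ⟨fun h => by simpa using h1 h, h2⟩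
  · rintro ⟨h1, h2⟩
    refine ⟨fun a ha => ?_, h2⟩
    rw [Finset.mem_Icc]
    refine ⟨Nat.pos_of_ne_zero fun h => h1 (h ▸ ha), ?_⟩
    rw [← h2]
    exact Finset.single_le_sum (f := fun a : ℕ => a) (fun _ _ => Nat.zero_le _) ha

theorem sum_strictSets_sum {M : Type*} [AddCommMonoid M] (n : ℕ) (G : ℕ → Finset ℕ → M) :
    ∑ S ∈ strictSets n, ∑ a ∈ S, G a (S.erase a) =
      ∑ a ∈ Finset.Icc 1 n, ∑ S ∈ strictSets (n - a), if a ∈ S then 0 else G a S := by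
  rw [Finset.sum_sigma', Finset.sum_congr rfl fun a _ => (by
    rw [Finset.sum_filter]; simp only [ite_not] :
      (∑ S ∈ strictSets (n - a), if a ∈ S then 0 else G a S) =
        ∑ S ∈ (strictSets (n - a)).filter fun S => ¬ a ∈ S, G a S), Finset.sum_sigma']
  refine Finset.sum_bij' (fun x _ => ⟨x.2, x.1.erase x.2⟩) (fun x _ => ⟨insert x.1 x.2, x.1⟩)
    ?_ ?_ ?_ ?_ ?_
  · rintro ⟨S, a⟩ h
    simp only [Finset.mem_sigma, mem_strictSets, Finset.mem_filter, Finset.mem_Icc] at h ⊢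
    obtain ⟨⟨h0, hs⟩, ha⟩ := h
    have := Finset.add_sum_erase S (fun a => a) ha
    have ha0 : a ≠ 0 := fun h => h0 (h ▸ ha)
    refine ⟨⟨by omega, by omega⟩, ⟨fun h => h0 (Finset.mem_of_mem_erase h), by omega⟩, by simp⟩
  · rintro ⟨a, S⟩ h
    simp only [Finset.mem_sigma, mem_strictSets, Finset.mem_filter, Finset.mem_Icc] at h ⊢
    obtain ⟨⟨h1, h2⟩, ⟨h0, hs⟩, ha⟩ := h
    rw [Finset.sum_insert ha]
    refine ⟨⟨?_, by omega⟩, by simp⟩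
    simp only [Finset.mem_insert, not_or]
    exact ⟨by omega, h0⟩
  · rintro ⟨S, a⟩ h
    simp only [Finset.mem_sigma] at h
    simp [Finset.insert_erase h.2]
  · rintro ⟨a, S⟩ h
    simp only [Finset.mem_sigma, Finset.mem_filter] at h
    simp [Finset.erase_insert h.2.2]
  · rintro ⟨S, a⟩ _
    rfl

theorem sort_erase (S : Finset ℕ) (a : ℕ) :
    (S.erase a).sort (· ≥ ·) = (S.sort (· ≥ ·)).erase a := by
  refine List.Perm.eq_of_pairwise' (r := (· ≥ ·)) ?_ ?_ ?_
  · exact Finset.pairwise_sort _ _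
  · exact (Finset.pairwise_sort S (· ≥ ·)).sublist List.erase_sublist
  · rw [List.perm_ext_iff_of_nodup (Finset.sort_nodup _ _) ((Finset.sort_nodup _ _).erase a)]
    intro b
    rw [(Finset.sort_nodup S (· ≥ ·)).mem_erase_iff]
    simp

theorem sum_range_length {M : Type*} [AddCommMonoid M] (S : Finset ℕ) (h : ℕ → M) :
    ∑ k ∈ Finset.range (S.sort (· ≥ ·)).length, h k =
      ∑ a ∈ S, h ((S.sort (· ≥ ·)).idxOf a) := by
  symm
  refine Finset.sum_bij' (fun a _ => (S.sort (· ≥ ·)).idxOf a)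
    (fun k _ => (S.sort (· ≥ ·)).getD k 0) ?_ ?_ ?_ ?_ ?_
  · intro a ha
    rw [Finset.mem_range]
    exact List.idxOf_lt_length_of_mem (by simpa using ha)
  · intro k hk
    rw [List.getD_eq_getElem _ _ (Finset.mem_range.mp hk), ← Finset.mem_sort (· ≥ ·)]
    exact List.getElem_mem _
  · intro a ha
    have : (S.sort (· ≥ ·)).idxOf a < (S.sort (· ≥ ·)).length :=
      List.idxOf_lt_length_of_mem (by simpa using ha)
    rw [List.getD_eq_getElem _ _ this, List.getElem_idxOf]
  · intro k hk
    rw [List.getD_eq_getElem _ _ (Finset.mem_range.mp hk),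
      (Finset.sort_nodup S (· ≥ ·)).idxOf_getElem]
  · exact fun _ _ => rfl

section Cauchy

variable {F : Type} [Field F] [DecidableEq F]

omit [DecidableEq F] in
theorem coeff_qgeo (a : F) (n : ℕ) :
    PowerSeries.coeff n (qgeo a) = if n = 0 then 1 else 2 * a ^ n := by
  rw [qgeo, mul_add, mul_one, map_add, coeff_geo]
  rcases n with _ | n
  · simp [PowerSeries.coeff_zero_mul_X, ← mul_assoc]
  · rw [← mul_assoc, PowerSeries.coeff_succ_mul_X, PowerSeries.coeff_mul_C, coeff_geo,
      if_neg (Nat.succ_ne_zero n)]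
    ring

omit [DecidableEq F] in
theorem coeff_zero_qser (V : Finset F) : PowerSeries.coeff 0 (qser V) = 1 := by
  rw [qser, PowerSeries.coeff_zero_eq_constantCoeff_apply, map_prod]
  refine Finset.prod_eq_one fun v _ => ?_
  rw [← PowerSeries.coeff_zero_eq_constantCoeff_apply, coeff_qgeo, if_pos rfl]

omit [DecidableEq F] in
theorem coeff_rescale_qgeo_mul (u : F) (G : PowerSeries F) (n : ℕ) :
    PowerSeries.coeff n (qgeo u * G) = PowerSeries.coeff n G +
      ∑ j ∈ Finset.Icc 1 n, 2 * u ^ j * PowerSeries.coeff (n - j) G := by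
  rw [PowerSeries.coeff_mul, Finset.Nat.sum_antidiagonal_eq_sum_range_succ_mk,
    Finset.sum_range_succ', add_comm]
  congr 1
  · simp [coeff_qgeo]
  · rw [Finset.range_eq_Ico, Finset.sum_Ico_add' (fun j => PowerSeries.coeff j (qgeo u) *
      PowerSeries.coeff (n - j) G) 0 n 1]
    refine Finset.sum_congr (by ext; simp) fun j hj => ?_
    rw [coeff_qgeo, if_neg (by simp at hj; omega)]

/-- The Schur q-function `q_m` is twice the P-function of the partition `(m)`. -/
theorem coeff_qser_eq {m : ℕ} (hm : 0 < m) {V : Finset F} (h0 : (0 : F) ∉ V) :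
    PowerSeries.coeff m (qser V) = 2 * pfun [m] V := by
  induction V using Finset.induction_on with
  | empty => simp [qser, pfun, PowerSeries.coeff_one, hm.ne']
  | insert u V hu ih =>
    have h0' : (0 : F) ∉ V := fun h => h0 (Finset.mem_insert_of_mem h)
    rw [pfun_insert_eq_sum (n := m) (by simpa using hm) h0' hu (by simp), mul_add, ← ih h0',
      qser, Finset.prod_insert hu, ← qser, coeff_rescale_qgeo_mul, Finset.mul_sum]
    congr 1
    refine Finset.sum_congr rfl fun j hj => ?_
    have hjm : j ≤ m := (Finset.mem_Icc.mp hj).2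
    simp only [List.length_singleton, Finset.range_one, Finset.sum_singleton, pow_zero, one_mul,
      List.getD_cons_zero, List.eraseIdx_cons_zero, pfun, mul_one]
    rw [← Nat.cast_sub hjm, intCoeff_natCast]
    ring

/-- The series `∏_{v ∈ V, w ∈ W} (1 + vwT) / (1 - vwT)`. -/
noncomputable def qkernel (V W : Finset F) : PowerSeries F := ∏ v ∈ V, ∏ w ∈ W, qgeo (v * w)

omit [DecidableEq F] in
theorem rescale_qgeo (c a : F) : PowerSeries.rescale c (qgeo a) = qgeo (c * a) := by
  ext n
  rw [PowerSeries.coeff_rescale, coeff_qgeo, coeff_qgeo]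
  split_ifs with h
  · simp [h]
  · ring

omit [DecidableEq F] in
theorem rescale_qser (c : F) (V : Finset F) :
    PowerSeries.rescale c (qser V) = ∏ v ∈ V, qgeo (c * v) := by
  rw [qser, map_prod]
  exact Finset.prod_congr rfl fun v _ => rescale_qgeo c v

omit [DecidableEq F] in
theorem coeff_rescale_mul (c : F) (G H : PowerSeries F) (n : ℕ) :
    PowerSeries.coeff n (PowerSeries.rescale c G * H) =
      ∑ b ∈ Finset.range (n + 1),
        c ^ b * PowerSeries.coeff b G * PowerSeries.coeff (n - b) H := by
  rw [PowerSeries.coeff_mul, Finset.Nat.sum_antidiagonal_eq_sum_range_succ_mk]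
  simp only [PowerSeries.coeff_rescale]

theorem pfun_sort_empty (S : Finset ℕ) :
    pfun (S.sort (· ≥ ·)) (∅ : Finset F) = if S = ∅ then 1 else 0 := by
  split_ifs with h
  · subst h
    simp [pfun]
  · obtain ⟨a, l, hl⟩ : ∃ a l, S.sort (· ≥ ·) = a :: l := by
      refine List.exists_cons_of_ne_nil fun h' => h ?_
      have := congrArg List.toFinset h'
      simpa using this
    rw [hl, pfun, Finset.sum_empty]

/-- The Cauchy identity for Schur P-functions. The induction adjoins an element `u` to `W`; in the
branching rule for `P_S(W ∪ {u})`, removing the part `a` of `S` is dual to giving `a` as exponent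
to a variable `v` in `P_S(V)`. -/
theorem sum_strictSets_pfun [CharZero F] {V W : Finset F} (hV : (0 : F) ∉ V) (hW : (0 : F) ∉ W)
    (n : ℕ) :
    ∑ S ∈ strictSets n, 2 ^ S.card * pfun (S.sort (· ≥ ·)) V * pfun (S.sort (· ≥ ·)) W =
      PowerSeries.coeff n (qkernel V W) := by
  induction W using Finset.induction_on generalizing V n with
  | empty =>
    simp only [qkernel, Finset.prod_empty, Finset.prod_const_one, PowerSeries.coeff_one,
      pfun_sort_empty, mul_ite, mul_one, mul_zero, Finset.sum_ite_eq']
    simp only [mem_strictSets, Finset.notMem_empty, not_false_eq_true, true_and, Finset.sum_empty,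
      eq_comm (a := 0), Finset.card_empty, pow_zero, Finset.sort_empty, pfun, mul_one]
  | insert u W hu ih =>
    have hW' : (0 : F) ∉ W := fun h => hW (Finset.mem_insert_of_mem h)
    -- the branching rule; its signs are absorbed by moving the part `a` of `S` to the front in the
    -- factor `P_S(V)`
    have hbranch : ∀ S ∈ strictSets n, 2 ^ S.card * pfun (S.sort (· ≥ ·)) V *
        pfun (S.sort (· ≥ ·)) (insert u W) =
        2 ^ S.card * pfun (S.sort (· ≥ ·)) V * pfun (S.sort (· ≥ ·)) W +
        ∑ m ∈ Finset.Icc 1 n, u ^ m * ∑ a ∈ S, 2 ^ ((S.erase a).card + 1) *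
          intCoeff (qser W) ((a : ℤ) - m) * pfun ((S.erase a).sort (· ≥ ·)) W *
          pfun (a :: (S.erase a).sort (· ≥ ·)) V := by
      intro S hS
      have hS' := Finset.mem_powerset.mp (Finset.mem_filter.mp hS).1
      have hmem : ∀ a ∈ S.sort (· ≥ ·), 1 ≤ a ∧ a ≤ n := fun a ha =>
        Finset.mem_Icc.mp (hS' ((Finset.mem_sort _).mp ha))
      rw [pfun_insert_eq_sum (n := n) (fun a ha => (hmem a ha).1) hW' hu
        (fun a ha => (hmem a ha).2), mul_add, Finset.mul_sum]
      congr 1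
      refine Finset.sum_congr rfl fun m _ => ?_
      rw [mul_left_comm, sum_range_length, Finset.mul_sum]
      congr 1
      refine Finset.sum_congr rfl fun a ha => ?_
      have hlt : (S.sort (· ≥ ·)).idxOf a < (S.sort (· ≥ ·)).length :=
        List.idxOf_lt_length_of_mem (by simpa using ha)
      have h1 := pfun_getElem_cons_eraseIdx (S.sort (· ≥ ·)) _ hlt V
      rw [List.getElem_idxOf, List.eraseIdx_idxOf_eq_erase, ← sort_erase S a] at h1
      rw [h1, List.getD_eq_getElem _ _ hlt, List.getElem_idxOf, List.eraseIdx_idxOf_eq_erase,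
        ← sort_erase S a, Finset.card_erase_add_one ha]
      ring
    -- the coefficient of `u ^ m`; the induction hypothesis is applied to `V \ {v}` and `W`
    have hinner : ∀ m ∈ Finset.Icc 1 n,
        ∑ S ∈ strictSets n, ∑ a ∈ S, 2 ^ ((S.erase a).card + 1) *
          intCoeff (qser W) ((a : ℤ) - m) * pfun ((S.erase a).sort (· ≥ ·)) W *
          pfun (a :: (S.erase a).sort (· ≥ ·)) V =
        PowerSeries.coeff m (qser V) * PowerSeries.coeff (n - m) (qkernel V W) := by
      intro m hm
      rw [Finset.mem_Icc] at hm
      have hsplit : ∀ v ∈ V, PowerSeries.coeff (n - m) (qkernel V W) =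
          ∑ b ∈ Finset.range (n - m + 1), v ^ b * PowerSeries.coeff b (qser W) *
            PowerSeries.coeff (n - m - b) (qkernel (V.erase v) W) := by
        intro v hv
        rw [← coeff_rescale_mul, rescale_qser, qkernel, qkernel, ← Finset.mul_prod_erase V _ hv]
      rw [sum_strictSets_sum n (fun a μ => 2 ^ (μ.card + 1) * intCoeff (qser W) ((a : ℤ) - m) *
        pfun (μ.sort (· ≥ ·)) W * pfun (a :: μ.sort (· ≥ ·)) V)]
      have hterm : ∀ a ∈ Finset.Icc 1 n,
          (∑ μ ∈ strictSets (n - a), if a ∈ μ then 0 else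
            2 ^ (μ.card + 1) * intCoeff (qser W) ((a : ℤ) - m) * pfun (μ.sort (· ≥ ·)) W *
              pfun (a :: μ.sort (· ≥ ·)) V) =
          ∑ v ∈ V, 2 * (v ^ a * crossProd v (V.erase v)) * (intCoeff (qser W) ((a : ℤ) - m) *
            PowerSeries.coeff (n - a) (qkernel (V.erase v) W)) := by
        intro a _
        have h1 : ∀ μ ∈ strictSets (n - a), (if a ∈ μ then 0 else
            2 ^ (μ.card + 1) * intCoeff (qser W) ((a : ℤ) - m) * pfun (μ.sort (· ≥ ·)) W *
              pfun (a :: μ.sort (· ≥ ·)) V) =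
            ∑ v ∈ V, 2 * (v ^ a * crossProd v (V.erase v)) * (intCoeff (qser W) ((a : ℤ) - m) *
              (2 ^ μ.card * pfun (μ.sort (· ≥ ·)) (V.erase v) * pfun (μ.sort (· ≥ ·)) W)) := by
          intro μ _
          have h2 : (if a ∈ μ then 0 else
            2 ^ (μ.card + 1) * intCoeff (qser W) ((a : ℤ) - m) * pfun (μ.sort (· ≥ ·)) W *
              pfun (a :: μ.sort (· ≥ ·)) V) = 2 ^ (μ.card + 1) * intCoeff (qser W) ((a : ℤ) - m) *
              pfun (μ.sort (· ≥ ·)) W * pfun (a :: μ.sort (· ≥ ·)) V := by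
            split_ifs with h
            · rw [pfun_cons_of_mem (by simpa using h), mul_zero]
            · rfl
          rw [h2, pfun, Finset.mul_sum]
          refine Finset.sum_congr rfl fun v _ => ?_
          ring
        rw [Finset.sum_congr rfl h1, Finset.sum_comm]
        refine Finset.sum_congr rfl fun v _ => ?_
        rw [← ih (V := V.erase v) (fun h => hV (Finset.mem_of_mem_erase h)) hW', Finset.mul_sum,
          Finset.mul_sum]
      rw [Finset.sum_congr rfl hterm, Finset.sum_comm, coeff_qser_eq (by omega) hV, pfun,
        Finset.mul_sum, Finset.sum_mul]
      refine Finset.sum_congr rfl fun v hv => ?_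
      rw [hsplit v hv, Finset.mul_sum]
      have hsub : Finset.Icc m n ⊆ Finset.Icc 1 n := Finset.Icc_subset_Icc_left hm.1
      rw [← Finset.sum_subset hsub]
      · symm
        refine Finset.sum_bij' (fun b _ => b + m) (fun a _ => a - m) ?_ ?_ ?_ ?_ ?_
        · intro b hb
          simp at hb ⊢
          omega
        · intro a ha
          simp at ha ⊢
          omega
        · intro b _
          simp
        · intro a ha
          simp at ha
          omega
        · intro b hb
          have h3 : ((b + m : ℕ) : ℤ) - m = (b : ℕ) := by push_cast; ring
          have h4 : n - m - b = n - (b + m) := by omega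
          rw [h3, intCoeff_natCast, h4, pfun]
          ring
      · intro a _ ha'
        have h5 : (a : ℤ) - m < 0 := by
          simp only [Finset.mem_Icc] at *
          omega
        rw [intCoeff_of_neg _ h5]
        ring
    have hker : qkernel V (insert u W) = PowerSeries.rescale u (qser V) * qkernel V W := by
      rw [rescale_qser, qkernel, qkernel, ← Finset.prod_mul_distrib]
      refine Finset.prod_congr rfl fun v _ => ?_
      rw [Finset.prod_insert hu, mul_comm v u]
    rw [Finset.sum_congr rfl hbranch, Finset.sum_add_distrib, ih hV hW', hker, coeff_rescale_mul,
      Finset.sum_range_succ', coeff_zero_qser, Finset.sum_comm, add_comm]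
    congr 1
    · rw [Finset.range_eq_Ico, Finset.sum_Ico_add' (fun j => u ^ j * PowerSeries.coeff j (qser V) *
        PowerSeries.coeff (n - j) (qkernel V W)) 0 n 1]
      refine Finset.sum_congr (by ext; simp) fun m hm => ?_
      rw [← Finset.mul_sum, hinner m hm, mul_assoc]
    · simp

end Cauchy

/-! ### Hall–Littlewood polynomials -/

section HallLittlewood

variable {N : ℕ}

/-- The distinct rearrangements of the sequence `κ_1, …, κ_N`. -/
def rearrangements (N : ℕ) (κ : YoungDiagram) : Finset (Fin N → ℕ) :=
  Finset.univ.image fun (w : Equiv.Perm (Fin N)) (i : Fin N) => κ.rowLen (w i)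

theorem filter_map_rowLen {κ : YoungDiagram} (hκ : κ.colLen 0 ≤ N) :
    ((Finset.univ : Finset (Fin N)).val.map fun i : Fin N => κ.rowLen i).filter (0 < ·) =
      parts κ := by
  obtain ⟨k, rfl⟩ := Nat.exists_eq_add_of_le hκ
  have h1 : ((Finset.univ : Finset (Fin (κ.colLen 0 + k))).val.map
      fun i : Fin (κ.colLen 0 + k) => κ.rowLen i) =
      (((List.range (κ.colLen 0 + k)).map κ.rowLen : List ℕ) : Multiset ℕ) := by
    rw [← List.map_coe_finRange_eq_range, List.map_map, ← Multiset.map_coe]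
    rfl
  rw [h1, Multiset.filter_coe, List.range_add, List.map_append, List.filter_append, parts,
    YoungDiagram.rowLens]
  have h2 : ∀ i, 0 < κ.rowLen i ↔ i < κ.colLen 0 := fun i => by
    have := rowLen_eq_zero_iff (κ := κ) (i := i)
    omega
  congr 1
  rw [List.filter_eq_self.mpr, List.filter_eq_nil_iff.mpr, List.append_nil]
  · simp only [List.map_map, List.mem_map, List.mem_range]
    rintro a ⟨i, _, rfl⟩
    simp [h2]
  · simp only [List.mem_map, List.mem_range]
    rintro a ⟨i, hi, rfl⟩
    simpa [h2] using hi

theorem mem_rearrangements {κ : YoungDiagram} (hκ : κ.colLen 0 ≤ N) {α : Fin N → ℕ} :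
    α ∈ rearrangements N κ ↔
      ((Finset.univ : Finset (Fin N)).val.map α).filter (0 < ·) = parts κ := by
  rw [rearrangements, Finset.mem_image, ← filter_map_rowLen hκ]
  constructor
  · rintro ⟨w, -, rfl⟩
    have h : (fun i : Fin N => κ.rowLen (w i)) = (fun i : Fin N => κ.rowLen i) ∘ w := rfl
    rw [h, ← Multiset.map_map, Multiset.map_univ_val_equiv]
  · intro h
    have hadd : ∀ m : Multiset ℕ, m = m.filter (0 < ·) +
        Multiset.replicate (m.card - (m.filter (0 < ·)).card) 0 := by
      intro m
      conv_lhs => rw [← Multiset.filter_add_not (fun a => 0 < a) m]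
      congr 1
      rw [Multiset.eq_replicate]
      constructor
      · have := congrArg Multiset.card (Multiset.filter_add_not (fun a => 0 < a) m)
        rw [Multiset.card_add] at this
        omega
      · intro b hb
        have := (Multiset.mem_filter.mp hb).2
        omega
    have hm : (Finset.univ : Finset (Fin N)).val.map α =
        (Finset.univ : Finset (Fin N)).val.map fun i : Fin N => κ.rowLen i := by
      rw [hadd (Multiset.map α _), hadd (Multiset.map (fun i : Fin N => κ.rowLen i) _), h]
      simp
    set σ := Tuple.sort α
    have hmono : Antitone (α ∘ σ ∘ Fin.rev) := fun i j hij =>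
      Tuple.monotone_sort α (Fin.rev_le_rev.mpr hij)
    have hanti : Antitone fun i : Fin N => κ.rowLen i := fun i j hij =>
      κ.rowLen_anti _ _ (Fin.le_def.mp hij)
    have heq : List.ofFn (α ∘ σ ∘ Fin.rev) = List.ofFn fun i : Fin N => κ.rowLen i := by
      refine List.Perm.eq_of_pairwise' (r := (· ≥ ·)) hmono.sortedGE_ofFn.pairwise
        hanti.sortedGE_ofFn.pairwise ?_
      rw [← Multiset.coe_eq_coe, List.ofFn_eq_map, List.ofFn_eq_map, ← Multiset.map_coe,
        ← Multiset.map_coe]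
      have h1 : (Finset.univ : Finset (Fin N)).val.map (α ∘ (Fin.revPerm.trans σ)) =
          (Finset.univ : Finset (Fin N)).val.map α := by
        rw [← Multiset.map_map, Multiset.map_univ_val_equiv]
      exact h1.trans hm
    have hfun := List.ofFn_injective heq
    refine ⟨(Fin.revPerm.trans σ).symm, Finset.mem_univ _, ?_⟩
    funext i
    have := congrFun hfun ((Fin.revPerm.trans σ).symm i)
    rw [← this]
    change α ((Fin.revPerm.trans σ) ((Fin.revPerm.trans σ).symm i)) = α i
    rw [Equiv.apply_symm_apply]

/-- The Hall–Littlewood polynomial at elements `x_1, …, x_N` of a field. -/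
noncomputable def hlAt {K : Type*} [Field K] (t : K) (x : Fin N → K) (κ : YoungDiagram) : K :=
  ∑ α ∈ rearrangements N κ, (∏ i, x i ^ α i) *
    ∏ ij ∈ Finset.univ.filter (fun ij : Fin N × Fin N => α ij.2 < α ij.1),
      (x ij.1 - t * x ij.2) / (x ij.1 - x ij.2)

/-- The product of the Hall–Littlewood polynomial and the Vandermonde product
`∏_{i < j} (x_i - x_j)`; it is defined over any commutative ring. -/
noncomputable def hlNum {B : Type*} [CommRing B] (t : B) (x : Fin N → B) (κ : YoungDiagram) : B :=
  ∑ α ∈ rearrangements N κ, (∏ i, x i ^ α i) *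
    ∏ ij ∈ Finset.univ.filter (fun ij : Fin N × Fin N => ij.1 < ij.2),
      (if α ij.2 < α ij.1 then x ij.1 - t * x ij.2 else
        if α ij.1 < α ij.2 then t * x ij.1 - x ij.2 else x ij.1 - x ij.2)

/-- The product `∏_{i < j} (x_i - x_j)`. -/
noncomputable def vdm {B : Type*} [CommRing B] (x : Fin N → B) : B :=
  ∏ ij ∈ Finset.univ.filter (fun ij : Fin N × Fin N => ij.1 < ij.2), (x ij.1 - x ij.2)

theorem map_hlNum {B B' : Type*} [CommRing B] [CommRing B'] (φ : B →+* B') (t : B)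
    (x : Fin N → B) (κ : YoungDiagram) :
    φ (hlNum t x κ) = hlNum (φ t) (fun i => φ (x i)) κ := by
  simp only [hlNum, map_sum, map_mul, map_prod, map_pow, apply_ite φ, map_sub]

theorem map_vdm {B B' : Type*} [CommRing B] [CommRing B'] (φ : B →+* B') (x : Fin N → B) :
    φ (vdm x) = vdm fun i => φ (x i) := by
  simp only [vdm, map_prod, map_sub]

theorem vdm_ne_zero {K : Type*} [Field K] {x : Fin N → K} (hx : Function.Injective x) :
    vdm x ≠ 0 :=
  Finset.prod_ne_zero_iff.mpr fun _ h =>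
    sub_ne_zero.mpr (hx.ne (Finset.mem_filter.mp h).2.ne)

theorem hlNum_eq {K : Type*} [Field K] (t : K) {x : Fin N → K} (hx : Function.Injective x)
    (κ : YoungDiagram) : hlNum t x κ = vdm x * hlAt t x κ := by
  rw [hlNum, hlAt, Finset.mul_sum]
  refine Finset.sum_congr rfl fun α _ => ?_
  rw [mul_left_comm]
  congr 1
  have h1 : ∏ ij ∈ Finset.univ.filter (fun ij : Fin N × Fin N => α ij.2 < α ij.1),
      (x ij.1 - t * x ij.2) / (x ij.1 - x ij.2) =
      ∏ ij ∈ Finset.univ.filter (fun ij : Fin N × Fin N => ij.1 < ij.2),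
        (if α ij.2 < α ij.1 then (x ij.1 - t * x ij.2) / (x ij.1 - x ij.2) else
          if α ij.1 < α ij.2 then (x ij.2 - t * x ij.1) / (x ij.2 - x ij.1) else 1) := by
    rw [← Finset.prod_filter_mul_prod_filter_not _ (fun ij : Fin N × Fin N => ij.1 < ij.2),
      Finset.filter_filter, Finset.filter_filter]
    have h2 : ∀ ij : Fin N × Fin N,
        (if α ij.2 < α ij.1 then (x ij.1 - t * x ij.2) / (x ij.1 - x ij.2) else
          if α ij.1 < α ij.2 then (x ij.2 - t * x ij.1) / (x ij.2 - x ij.1) else 1) =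
        (if α ij.2 < α ij.1 then (x ij.1 - t * x ij.2) / (x ij.1 - x ij.2) else 1) *
        (if α ij.1 < α ij.2 then (x ij.2 - t * x ij.1) / (x ij.2 - x ij.1) else 1) := by
      intro ij
      split_ifs <;> first | omega | simp
    simp only [h2]
    rw [Finset.prod_mul_distrib, ← Finset.prod_filter, ← Finset.prod_filter, Finset.filter_filter,
      Finset.filter_filter]
    congr 1
    · refine Finset.prod_congr ?_ fun _ _ => rfl
      ext ij
      simp [and_comm]
    · refine Finset.prod_bij' (fun ij _ => ij.swap) (fun ij _ => ij.swap) ?_ ?_ ?_ ?_ ?_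
      · rintro ⟨i, j⟩ h
        simp only [Finset.mem_filter, Finset.mem_univ, true_and, Prod.swap] at h ⊢
        refine ⟨lt_of_le_of_ne (not_lt.mp h.2) ?_, h.1⟩
        rintro rfl
        exact lt_irrefl _ h.1
      · rintro ⟨i, j⟩ h
        simp only [Finset.mem_filter, Finset.mem_univ, true_and, Prod.swap] at h ⊢
        exact ⟨h.2, not_lt.mpr h.1.le⟩
      · exact fun _ _ => rfl
      · exact fun _ _ => rfl
      · exact fun _ _ => rfl
  rw [h1, vdm, ← Finset.prod_mul_distrib]
  refine Finset.prod_congr rfl fun ij h => ?_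
  have h3 : x ij.1 - x ij.2 ≠ 0 := sub_ne_zero.mpr (hx.ne (Finset.mem_filter.mp h).2.ne)
  split_ifs
  · field_simp
  · rw [← neg_sub (x ij.1) (x ij.2), div_neg, mul_neg, mul_div_cancel₀ _ h3]
    ring
  · rw [mul_one]

theorem hlAt_comp_perm {K : Type*} [Field K] (t : K) (x : Fin N → K) (κ : YoungDiagram)
    (w : Equiv.Perm (Fin N)) : hlAt t (fun i => x (w i)) κ = hlAt t x κ := by
  rw [hlAt, hlAt]
  refine Finset.sum_bij' (fun α _ i => α (w.symm i)) (fun α _ i => α (w i)) ?_ ?_ ?_ ?_ ?_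
  · intro α hα
    obtain ⟨v, -, rfl⟩ := Finset.mem_image.mp hα
    exact Finset.mem_image.mpr ⟨w.symm.trans v, Finset.mem_univ _, rfl⟩
  · intro α hα
    obtain ⟨v, -, rfl⟩ := Finset.mem_image.mp hα
    exact Finset.mem_image.mpr ⟨w.trans v, Finset.mem_univ _, rfl⟩
  · intro α _
    simp
  · intro α _
    simp
  · intro α _
    rw [← Equiv.prod_comp w fun i => x i ^ α (w.symm i)]
    simp only [Equiv.symm_apply_apply]
    congr 1
    refine Finset.prod_bij' (fun ij _ => (w ij.1, w ij.2))
      (fun ij _ => (w.symm ij.1, w.symm ij.2)) ?_ ?_ ?_ ?_ ?_ <;> simp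

theorem hlAt_snoc_zero {K : Type*} [Field K] (t : K) {x : Fin N → K} (hx : ∀ i, x i ≠ 0)
    {κ : YoungDiagram} (hκ : κ.colLen 0 ≤ N) :
    hlAt t (Fin.snoc x 0 : Fin (N + 1) → K) κ = hlAt t x κ := by
  have hval : ∀ α : Fin (N + 1) → ℕ, (Finset.univ : Finset (Fin (N + 1))).val.map α =
      α (Fin.last N) ::ₘ (Finset.univ : Finset (Fin N)).val.map fun i => α i.castSucc := by
    intro α
    rw [Fin.univ_castSuccEmb, Finset.cons_val, Multiset.map_cons, Finset.map_val,
      Multiset.map_map]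
    rfl
  -- rearrangements with a positive last entry contribute zero
  have hzero : ∀ α ∈ rearrangements (N + 1) κ, α ∉ (rearrangements (N + 1) κ).filter
      (fun α => α (Fin.last N) = 0) → (∏ i, (Fin.snoc x 0 : Fin (N + 1) → K) i ^ α i) *
      ∏ ij ∈ Finset.univ.filter (fun ij : Fin (N + 1) × Fin (N + 1) => α ij.2 < α ij.1),
      ((Fin.snoc x 0 : Fin (N + 1) → K) ij.1 - t * (Fin.snoc x 0 : Fin (N + 1) → K) ij.2) /
      ((Fin.snoc x 0 : Fin (N + 1) → K) ij.1 - (Fin.snoc x 0 : Fin (N + 1) → K) ij.2) = 0 := by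
    intro α hα hα'
    have h : α (Fin.last N) ≠ 0 := fun h => hα' (Finset.mem_filter.mpr ⟨hα, h⟩)
    rw [Fin.prod_univ_castSucc, Fin.snoc_last, zero_pow h, mul_zero, zero_mul]
  rw [hlAt, ← Finset.sum_subset (Finset.filter_subset (fun α => α (Fin.last N) = 0) _) hzero, hlAt]
  refine Finset.sum_bij' (fun α _ i => α i.castSucc)
    (fun α _ => (Fin.snoc α 0 : Fin (N + 1) → ℕ)) ?_ ?_ ?_ ?_ ?_
  · intro α hα
    rw [Finset.mem_filter, mem_rearrangements (by omega), hval] at hα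
    rw [mem_rearrangements hκ, ← hα.1, hα.2]
    simp
  · intro α hα
    rw [mem_rearrangements hκ] at hα
    rw [Finset.mem_filter, mem_rearrangements (by omega), hval]
    simp only [Fin.snoc_last, Fin.snoc_castSucc, and_true]
    rw [Multiset.filter_cons_of_neg _ (lt_irrefl 0), hα]
  · intro α hα
    have h := (Finset.mem_filter.mp hα).2
    funext i
    refine Fin.lastCases ?_ (fun i => ?_) i
    · rw [Fin.snoc_last, h]
    · rw [Fin.snoc_castSucc]
  · intro α _
    funext i
    rw [Fin.snoc_castSucc]
  · intro α hα
    have h := (Finset.mem_filter.mp hα).2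
    rw [Fin.prod_univ_castSucc, Fin.snoc_last, h, pow_zero, mul_one]
    simp only [Fin.snoc_castSucc]
    congr 1
    rw [Finset.prod_filter, Finset.prod_filter, Fintype.prod_prod_type, Fintype.prod_prod_type,
      Fin.prod_univ_castSucc]
    have h1 : ∀ j : Fin (N + 1), ¬ α j < α (Fin.last N) := by
      intro j
      omega
    simp only [h1, if_false, Finset.prod_const_one, mul_one]
    refine Finset.prod_congr rfl fun i _ => ?_
    rw [Fin.prod_univ_castSucc]
    simp only [Fin.snoc_castSucc, Fin.snoc_last, mul_zero, sub_zero, div_self (hx i), ite_self,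
      mul_one]

theorem isHomogeneous_hlNum {A : Type} [CommRing A] (t : A) {κ : YoungDiagram}
    (hκ : κ.colLen 0 ≤ N) :
    (hlNum (MvPolynomial.C t) (MvPolynomial.X : Fin N → MvPolynomial (Fin N) A) κ).IsHomogeneous
      (κ.card + ∑ i : Fin N, (N - 1 - (i : ℕ))) := by
  refine MvPolynomial.IsHomogeneous.sum _ _ _ fun α hα => ?_
  refine MvPolynomial.IsHomogeneous.mul ?_ ?_
  · have h1 : κ.card = ∑ i : Fin N, α i := by
      obtain ⟨w, -, rfl⟩ := Finset.mem_image.mp hα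
      rw [Equiv.sum_comp w fun i : Fin N => κ.rowLen i, card_eq_sum_rowLen hκ]
    rw [h1]
    exact MvPolynomial.IsHomogeneous.prod _ _ _ fun i _ => MvPolynomial.isHomogeneous_X_pow _ _
  · have h2 : ∑ i : Fin N, (N - 1 - (i : ℕ)) = ∑ ij ∈ Finset.univ.filter
        (fun ij : Fin N × Fin N => ij.1 < ij.2), 1 := by
      rw [Finset.sum_filter, Fintype.sum_prod_type]
      refine Finset.sum_congr rfl fun i _ => ?_
      rw [← Finset.sum_filter, Finset.sum_const, smul_eq_mul, mul_one]
      have : Finset.univ.filter (fun j => i < j) = Finset.Ioi i := by ext; simp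
      rw [this, Fin.card_Ioi]
    rw [h2]
    refine MvPolynomial.IsHomogeneous.prod _ _ _ fun ij _ => ?_
    have hX : ∀ i : Fin N, (MvPolynomial.X i : MvPolynomial (Fin N) A).IsHomogeneous 1 :=
      fun i => MvPolynomial.isHomogeneous_X _ _
    have hCX : ∀ i : Fin N, (MvPolynomial.C t * MvPolynomial.X i :
        MvPolynomial (Fin N) A).IsHomogeneous 1 := fun i => by
      simpa using (MvPolynomial.isHomogeneous_C (Fin N) t).mul (hX i)
    split_ifs
    · exact (hX _).sub (hCX _)
    · exact (hCX _).sub (hX _)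
    · exact (hX _).sub (hX _)

theorem alternant_bot_eq_vdm (A : Type) [CommRing A] (N : ℕ) :
    alternant A N ⊥ = vdm (MvPolynomial.X : Fin N → MvPolynomial (Fin N) A) := by
  rw [alternant, ← Matrix.det_submatrix_equiv_self Fin.revPerm]
  have h : (Matrix.of fun i j : Fin N => (MvPolynomial.X i : MvPolynomial (Fin N) A) ^
      ((⊥ : YoungDiagram).rowLen j + (N - 1 - (j : ℕ)))).submatrix Fin.revPerm Fin.revPerm =
      Matrix.vandermonde fun i : Fin N => (MvPolynomial.X i.rev : MvPolynomial (Fin N) A) := by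
    ext1 i j
    simp only [Matrix.submatrix_apply, Matrix.of_apply, rowLen_bot, zero_add, Fin.revPerm_apply,
      Fin.val_rev, Matrix.vandermonde_apply]
    congr 1
    omega
  rw [h, Matrix.det_vandermonde, Finset.prod_sigma', vdm]
  refine Finset.prod_bij' (fun ij _ => (ij.2.rev, ij.1.rev)) (fun ij _ => ⟨ij.2.rev, ij.1.rev⟩)
    ?_ ?_ ?_ ?_ ?_
  · rintro ⟨i, j⟩ h
    simpa using h
  · rintro ⟨i, j⟩ h
    simpa using h
  · rintro ⟨i, j⟩ _
    simp
  · rintro ⟨i, j⟩ _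
    simp
  · rintro ⟨i, j⟩ _
    rfl

theorem var_injective (A : Type) [CommRing A] [IsDomain A] (N : ℕ) :
    Function.Injective (var A N) :=
  (IsFractionRing.injective (MvPolynomial (Fin N) A) (RatFun A N)).comp
    (MvPolynomial.X_injective)

theorem var_ne_zero (A : Type) [CommRing A] [IsDomain A] (N : ℕ) (i : Fin N) : var A N i ≠ 0 := by
  rw [var, Ne, IsFractionRing.to_map_eq_zero_iff]
  exact MvPolynomial.X_ne_zero i

theorem algebraMap_hlNum {A : Type} [CommRing A] [IsDomain A] (t : A) (κ : YoungDiagram) :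
    algebraMap (MvPolynomial (Fin N) A) (RatFun A N)
      (hlNum (MvPolynomial.C t) MvPolynomial.X κ) =
      algebraMap _ (RatFun A N) (alternant A N ⊥) * hallLittlewoodP A t N κ := by
  rw [map_hlNum, alternant_bot_eq_vdm, map_vdm]
  exact hlNum_eq _ (var_injective A N) κ

theorem isAlternating_hlNum {A : Type} [CommRing A] [IsDomain A] (t : A) (κ : YoungDiagram) :
    IsAlternating (hlNum (MvPolynomial.C t) (MvPolynomial.X : Fin N → MvPolynomial (Fin N) A)
      κ) := by
  intro w
  refine IsFractionRing.injective (MvPolynomial (Fin N) A) (RatFun A N) ?_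
  have h1 : (MvPolynomial.rename w) (hlNum (MvPolynomial.C t)
      (MvPolynomial.X : Fin N → MvPolynomial (Fin N) A) κ) =
      hlNum (MvPolynomial.C t) (fun i => MvPolynomial.X (w i)) κ := by
    change (MvPolynomial.rename w : MvPolynomial (Fin N) A →ₐ[A] _).toRingHom _ = _
    rw [map_hlNum]
    simp
  have h2 : (MvPolynomial.rename w) (alternant A N ⊥) =
      vdm fun i => (MvPolynomial.X (w i) : MvPolynomial (Fin N) A) := by
    rw [alternant_bot_eq_vdm]
    change (MvPolynomial.rename w : MvPolynomial (Fin N) A →ₐ[A] _).toRingHom _ = _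
    rw [map_vdm]
    simp
  rw [h1, map_hlNum, hlNum_eq _ (x := fun i => algebraMap (MvPolynomial (Fin N) A) (RatFun A N)
    (MvPolynomial.X (w i))) ((var_injective A N).comp w.injective), map_zsmul,
    algebraMap_hlNum]
  have h3 := congrArg (algebraMap _ (RatFun A N)) (h2.symm.trans (isAlternating_alternant ⊥ w))
  rw [map_vdm, map_zsmul] at h3
  change vdm (fun i => var A N (w i)) * hlAt _ (fun i => var A N (w i)) κ = _
  rw [hlAt_comp_perm]
  change vdm (fun i => var A N (w i)) = _ at h3
  rw [h3, smul_mul_assoc]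
  rfl

variable {A : Type} [CommRing A] [IsDomain A] [CharZero A]

theorem exists_hl_polynomial (t : A) {κ : YoungDiagram} (hκ : κ.card ≤ N) :
    ∃ p : MvPolynomial (Fin N) A,
      alternant A N ⊥ * p = hlNum (MvPolynomial.C t) MvPolynomial.X κ := by
  have h := (isAlternating_hlNum t κ).eq_sum_of_isHomogeneous (n := κ.card) hκ
    (isHomogeneous_hlNum t ((colLen_le_card κ).trans hκ))
  rw [h]
  refine ⟨∑ σ ∈ partitionsEq κ.card, MvPolynomial.C
    ((hlNum (MvPolynomial.C t) (MvPolynomial.X : Fin N → MvPolynomial (Fin N) A) κ).coeff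
      (deltaExp N σ)) * schurPoly A N σ, ?_⟩
  rw [Finset.mul_sum]
  refine Finset.sum_congr rfl fun σ hσ => ?_
  rw [alternant_eq_mul_schurPoly (colLen_le_of_mem_partitionsEq hκ σ hσ)]
  ring

omit [IsDomain A] [CharZero A] in
/-- Evaluation of the polynomial `P_κ(x; t)` at distinct elements of a field. -/
theorem eval_hl_polynomial {K : Type*} [Field K] (φ : A →+* K) {x : Fin N → K}
    (hx : Function.Injective x) {t : A} {κ : YoungDiagram} {p : MvPolynomial (Fin N) A}
    (hp : alternant A N ⊥ * p = hlNum (MvPolynomial.C t) MvPolynomial.X κ) :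
    MvPolynomial.eval₂Hom φ x p = hlAt (φ t) x κ := by
  have h := congrArg (MvPolynomial.eval₂Hom φ x) hp
  rw [map_mul, map_hlNum, alternant_bot_eq_vdm, map_vdm] at h
  simp only [MvPolynomial.eval₂Hom_X', MvPolynomial.eval₂Hom_C] at h
  rw [hlNum_eq _ hx] at h
  exact mul_left_cancel₀ (vdm_ne_zero hx) h

/-- The Schur expansion of Hall–Littlewood polynomials. -/
theorem exists_hl_expansion (t : A) (κ : YoungDiagram) :
    ∃ (c : YoungDiagram → A) (p : (N : ℕ) → MvPolynomial (Fin N) A),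
      (∀ σ, c σ ≠ 0 → σ.card = κ.card) ∧
      (∀ N, κ.card ≤ N → alternant A N ⊥ * p N = hlNum (MvPolynomial.C t) MvPolynomial.X κ) ∧
      ∀ N, κ.card ≤ N →
        p N = ∑ σ ∈ partitionsEq κ.card, MvPolynomial.C (c σ) * schurPoly A N σ := by
  classical
  have hex : ∀ N, ∃ p : MvPolynomial (Fin N) A, κ.card ≤ N →
      alternant A N ⊥ * p = hlNum (MvPolynomial.C t) MvPolynomial.X κ := by
    intro N
    by_cases h : κ.card ≤ N
    · obtain ⟨p, hp⟩ := exists_hl_polynomial t h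
      exact ⟨p, fun _ => hp⟩
    · exact ⟨0, fun h' => absurd h' h⟩
  choose p hp using hex
  obtain ⟨c, hc, hpc⟩ := exists_stable_expansion p κ.card
    (fun N hN => by rw [hp N hN]; exact isAlternating_hlNum t κ)
    (fun N hN => by
      rw [hp N hN]
      exact isHomogeneous_hlNum t ((colLen_le_card κ).trans hN))
    (fun N hN => by
      refine IsFractionRing.injective (MvPolynomial (Fin N) A) (RatFun A N) ?_
      set φ : A →+* RatFun A N := (algebraMap (MvPolynomial (Fin N) A) (RatFun A N)).comp
        MvPolynomial.C
      have hinj : Function.Injective (Fin.snoc (var A N) 0 : Fin (N + 1) → RatFun A N) :=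
        Fin.snoc_injective_iff.mpr ⟨var_injective A N, by
          rintro ⟨i, hi⟩
          exact var_ne_zero A N i hi⟩
      have h1 : algebraMap _ (RatFun A N) (killLast A N (p (N + 1))) =
          MvPolynomial.eval₂Hom φ (Fin.snoc (var A N) 0 : Fin (N + 1) → RatFun A N)
            (p (N + 1)) := by
        rw [killLast, ← RingHom.comp_apply]
        congr 1
        refine MvPolynomial.ringHom_ext (fun a => by simp [φ]) fun i => ?_
        refine Fin.lastCases ?_ (fun i => ?_) i <;> simp [var]
      have h2 : algebraMap _ (RatFun A N) (p N) = MvPolynomial.eval₂Hom φ (var A N) (p N) := by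
        have : algebraMap (MvPolynomial (Fin N) A) (RatFun A N) =
            MvPolynomial.eval₂Hom φ (var A N) :=
          MvPolynomial.ringHom_ext (fun a => by simp [φ]) fun i => by simp [var]
        rw [← this]
      rw [h1, h2, eval_hl_polynomial φ hinj (hp (N + 1) (by omega)),
        eval_hl_polynomial φ (var_injective A N) (hp N hN),
        hlAt_snoc_zero _ (var_ne_zero A N) ((colLen_le_card κ).trans hN)])
  exact ⟨c, p, hc, hp, hpc⟩

omit [CharZero A] in
theorem hallLittlewoodP_eq {t : A} {κ : YoungDiagram} {p : MvPolynomial (Fin N) A}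
    (hp : alternant A N ⊥ * p = hlNum (MvPolynomial.C t) MvPolynomial.X κ) :
    hallLittlewoodP A t N κ = algebraMap _ _ p := by
  have h := congrArg (algebraMap _ (RatFun A N)) hp
  rw [algebraMap_hlNum, map_mul] at h
  have hne : algebraMap (MvPolynomial (Fin N) A) (RatFun A N) (alternant A N ⊥) ≠ 0 := by
    rw [alternant_bot_eq_vdm, map_vdm]
    exact vdm_ne_zero (var_injective A N)
  exact (mul_left_cancel₀ hne h).symm

theorem card_eq_of_invKostka_ne_zero {κ σ : YoungDiagram} (h : invKostka κ σ ≠ 0) :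
    σ.card = κ.card := by
  obtain ⟨c, p, hc, hp, hpc⟩ := exists_hl_expansion (Polynomial.X : Polynomial ℤ) κ
  rw [invKostka, schurCoeff_eq (fun N hN => hallLittlewoodP_eq (hp N hN)) hc hpc] at h
  exact hc σ h

/-- The specialization at `t = -1` of the Schur expansion of a Hall–Littlewood polynomial. -/
theorem hlAt_neg_one {K : Type*} [Field K] {x : Fin N → K} (hx : Function.Injective x)
    {κ : YoungDiagram} (hκ : κ.card ≤ N) :
    hlAt (-1) x κ = ∑ σ ∈ partitionsEq κ.card,
      (((invKostka κ σ).eval (-1) : ℤ) : K) * jt (∏ i, geo (x i)) σ := by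
  obtain ⟨c, p, hc, hp, hpc⟩ := exists_hl_expansion (Polynomial.X : Polynomial ℤ) κ
  have hinv : ∀ σ, invKostka κ σ = c σ := fun σ =>
    schurCoeff_eq (fun N hN => hallLittlewoodP_eq (hp N hN)) hc hpc σ
  set φ : Polynomial ℤ →+* K := (Int.castRingHom K).comp (Polynomial.evalRingHom (-1))
  have h := eval_hl_polynomial φ hx (hp N hκ)
  have h1 : φ Polynomial.X = -1 := by simp [φ]
  rw [h1, hpc N hκ, map_sum] at h
  rw [← h]
  refine Finset.sum_congr rfl fun σ _ => ?_
  rw [map_mul, eval₂_schurPoly, MvPolynomial.eval₂Hom_C, hinv]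
  rfl

end HallLittlewood

/-! ### Partitions and their multisets of parts -/

theorem rowLen_ofParts (m : Multiset ℕ) (i : ℕ) :
    (ofParts m).rowLen i = (m.sort (· ≥ ·)).getD i 0 := by
  have h : ∀ j, j < (ofParts m).rowLen i ↔ j < (m.sort (· ≥ ·)).getD i 0 := by
    intro j
    rw [← YoungDiagram.mem_iff_lt_rowLen, ofParts, YoungDiagram.mem_ofRowLens]
    constructor
    · rintro ⟨h1, h2⟩
      rwa [List.getD_eq_getElem _ _ h1]
    · intro h
      have h1 : i < (m.sort (· ≥ ·)).length := by
        by_contra hc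
        rw [List.getD_eq_default _ _ (not_lt.mp hc)] at h
        omega
      rw [List.getD_eq_getElem _ _ h1] at h
      exact ⟨h1, h⟩
  have h1 := h ((ofParts m).rowLen i)
  have h2 := h ((m.sort (· ≥ ·)).getD i 0)
  omega

theorem parts_ofParts (m : Multiset ℕ) : parts (ofParts m) = m.filter (0 < ·) := by
  have hcol : (ofParts m).colLen 0 ≤ (m.sort (· ≥ ·)).length := by
    rw [← rowLen_eq_zero_iff, rowLen_ofParts, List.getD_eq_default _ _ le_rfl]
  rw [← filter_map_rowLen hcol]
  congr 1
  conv_rhs => rw [← Multiset.sort_eq m (· ≥ ·)]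
  conv_rhs => rw [← List.ofFn_getElem (xs := m.sort (· ≥ ·)), List.ofFn_eq_map, ← Multiset.map_coe]
  refine Multiset.map_congr rfl fun i _ => ?_
  rw [rowLen_ofParts, List.getD_eq_getElem _ _ i.2]

theorem pos_of_mem_parts {κ : YoungDiagram} {a : ℕ} (ha : a ∈ parts κ) : 0 < a :=
  YoungDiagram.pos_of_mem_rowLens κ a (by simpa [parts] using ha)

theorem sort_parts (κ : YoungDiagram) : (parts κ).sort (· ≥ ·) = κ.rowLens := by
  refine List.Perm.eq_of_pairwise' (r := (· ≥ ·)) (Multiset.pairwise_sort _ _)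
    κ.rowLens_sorted.pairwise ?_
  rw [← Multiset.coe_eq_coe, Multiset.sort_eq]
  rfl

theorem parts_injective : Function.Injective parts := by
  intro κ η h
  have h1 : κ.rowLens = η.rowLens := by rw [← sort_parts, ← sort_parts, h]
  have h2 : ∀ κ : YoungDiagram, ∀ i, κ.rowLen i = κ.rowLens.getD i 0 := by
    intro κ i
    rcases lt_or_ge i κ.rowLens.length with hi | hi
    · rw [List.getD_eq_getElem _ _ hi]
      exact YoungDiagram.get_rowLens.symm
    · rw [List.getD_eq_default _ _ hi, rowLen_eq_zero_iff]
      simpa using hi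
  exact youngDiagram_ext_rowLen fun i => by rw [h2, h2, h1]

theorem ofParts_parts (κ : YoungDiagram) : ofParts (parts κ) = κ := by
  refine parts_injective ?_
  rw [parts_ofParts]
  exact Multiset.filter_eq_self.mpr fun a ha => pos_of_mem_parts ha

theorem sum_filter_pos (m : Multiset ℕ) : (m.filter (0 < ·)).sum = m.sum := by
  induction m using Multiset.induction_on with
  | empty => rfl
  | cons a m ih =>
    rcases Nat.eq_zero_or_pos a with h | h
    · rw [Multiset.filter_cons_of_neg _ (by omega), ih, Multiset.sum_cons, h, zero_add]
    · rw [Multiset.filter_cons_of_pos (p := (0 < ·)) _ h, Multiset.sum_cons, Multiset.sum_cons, ih]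

theorem sum_parts (κ : YoungDiagram) : (parts κ).sum = κ.card := by
  rw [card_eq_sum_rowLen (le_refl (κ.colLen 0)), ← filter_map_rowLen (le_refl (κ.colLen 0)),
    sum_filter_pos]
  rfl

theorem sum_filter_isStrict {M : Type*} [AddCommMonoid M] [DecidablePred IsStrict] (n : ℕ)
    (f : ℕ → List ℕ → M) :
    ∑ κ ∈ (partitionsEq n).filter IsStrict, f (height κ) κ.rowLens =
      ∑ S ∈ strictSets n, f S.card (S.sort (· ≥ ·)) := by
  have hval : ∀ κ ∈ (partitionsEq n).filter IsStrict, (parts κ).toFinset.val = parts κ :=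
    fun κ hκ => Multiset.dedup_eq_self.mpr (Finset.mem_filter.mp hκ).2
  have hpos : ∀ S ∈ strictSets n, S.val.filter (0 < ·) = S.val := by
    intro S hS
    rw [mem_strictSets] at hS
    exact Multiset.filter_eq_self.mpr fun a ha => Nat.pos_of_ne_zero fun h => hS.1 (h ▸ ha)
  refine Finset.sum_bij' (fun κ _ => (parts κ).toFinset) (fun S _ => ofParts S.val) ?_ ?_ ?_ ?_ ?_
  · intro κ hκ
    have h := hval κ hκ
    rw [mem_strictSets]
    refine ⟨fun h0 => ?_, ?_⟩
    · exact lt_irrefl 0 (pos_of_mem_parts (Multiset.mem_toFinset.mp h0))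
    · rw [Finset.sum_eq_multiset_sum, h, Multiset.map_id', sum_parts]
      exact mem_partitionsEq.mp (Finset.mem_filter.mp hκ).1
  · intro S hS
    have h := hpos S hS
    rw [mem_strictSets] at hS
    rw [Finset.mem_filter, mem_partitionsEq, ← sum_parts, IsStrict, parts_ofParts, h]
    exact ⟨by rw [← hS.2, Finset.sum_eq_multiset_sum, Multiset.map_id'], S.nodup⟩
  · intro κ hκ
    rw [hval κ hκ, ofParts_parts]
  · intro S hS
    rw [← Finset.val_inj, Multiset.toFinset_val, parts_ofParts, hpos S hS]
    exact Multiset.dedup_eq_self.mpr S.nodup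
  · intro κ hκ
    have h := hval κ hκ
    have h1 : (parts κ).toFinset.sort (· ≥ ·) = (parts κ).toFinset.val.sort (· ≥ ·) := rfl
    rw [h1, h, sort_parts, Finset.card_def, h]
    rfl

/-! ### Hall–Littlewood polynomials at `t = -1` -/

section Placements

variable {N : ℕ}

/-- The functions supported on `s` whose positive values are the entries of `l`. -/
def placements : List ℕ → Finset (Fin N) → Finset (Fin N → ℕ)
  | [], _ => {0}
  | a :: l, s => s.biUnion fun i => (placements l (s.erase i)).image fun α => Function.update α i a

theorem mem_placements {l : List ℕ} (hl : ∀ a ∈ l, 0 < a) {s : Finset (Fin N)} {α : Fin N → ℕ} :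
    α ∈ placements l s ↔ (∀ i, i ∉ s → α i = 0) ∧
      ((Finset.univ : Finset (Fin N)).val.map α).filter (0 < ·) = l := by
  have hval : ∀ (α : Fin N → ℕ) (i : Fin N), (Finset.univ : Finset (Fin N)).val.map α =
      α i ::ₘ (Finset.univ.erase i : Finset (Fin N)).val.map α := by
    intro α i
    rw [← Multiset.map_cons, ← Finset.insert_val_of_notMem (Finset.notMem_erase _ _),
      Finset.insert_erase (Finset.mem_univ i)]
  have hupd : ∀ (α : Fin N → ℕ) (i : Fin N) (a : ℕ),
      (Finset.univ.erase i : Finset (Fin N)).val.map (Function.update α i a) =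
      (Finset.univ.erase i : Finset (Fin N)).val.map α := by
    intro α i a
    refine Multiset.map_congr rfl fun j hj => ?_
    exact Function.update_of_ne (Finset.ne_of_mem_erase (s := Finset.univ) hj) _ _
  induction l generalizing s α with
  | nil =>
    rw [placements, Finset.mem_singleton]
    constructor
    · rintro rfl
      refine ⟨fun _ _ => rfl, ?_⟩
      rw [Multiset.coe_nil, Multiset.filter_eq_nil]
      intro a ha
      obtain ⟨_, _, rfl⟩ := Multiset.mem_map.mp ha
      exact lt_irrefl 0
    · rintro ⟨-, h⟩
      rw [Multiset.coe_nil, Multiset.filter_eq_nil] at h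
      funext i
      have := h (α i) (Multiset.mem_map_of_mem α (Finset.mem_univ i))
      simpa using this
  | cons a l ih =>
    have ha : 0 < a := hl a (by simp)
    have hl' : ∀ b ∈ l, 0 < b := fun b hb => hl b (by simp [hb])
    simp only [placements, Finset.mem_biUnion, Finset.mem_image, ih hl']
    constructor
    · rintro ⟨i, hi, α, ⟨h1, h2⟩, rfl⟩
      refine ⟨fun j hj => ?_, ?_⟩
      · have hji : j ≠ i := fun h => hj (h ▸ hi)
        rw [Function.update_of_ne hji]
        exact h1 j fun h => hj (Finset.mem_of_mem_erase h)
      · have h3 : α i = 0 := h1 i (Finset.notMem_erase _ _)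
        rw [hval α i, h3, Multiset.filter_cons_of_neg _ (lt_irrefl 0)] at h2
        rw [hval _ i, hupd, Function.update_self, Multiset.filter_cons_of_pos _ ha, h2,
          Multiset.cons_coe]
    · rintro ⟨h1, h2⟩
      have hmem : a ∈ ((Finset.univ : Finset (Fin N)).val.map α).filter (0 < ·) := by
        rw [h2]
        simp
      obtain ⟨i, -, hi⟩ := Multiset.mem_map.mp (Multiset.mem_filter.mp hmem).1
      have his : i ∈ s := by
        by_contra h
        rw [h1 i h] at hi
        omega
      refine ⟨i, his, Function.update α i 0, ⟨fun j hj => ?_, ?_⟩, ?_⟩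
      · rcases eq_or_ne j i with rfl | hji
        · rw [Function.update_self]
        · rw [Function.update_of_ne hji]
          exact h1 j fun h => hj (Finset.mem_erase.mpr ⟨hji, h⟩)
      · rw [hval α i, hi, Multiset.filter_cons_of_pos _ ha, ← Multiset.cons_coe] at h2
        rw [hval _ i, hupd, Function.update_self, Multiset.filter_cons_of_neg _ (lt_irrefl 0)]
        exact (Multiset.cons_inj_right a).mp h2
      · rw [Function.update_idem, ← hi, Function.update_eq_self]

/-- The Schur P-function of a strict partition as a sum over placements of its parts. -/
theorem pfun_eq_sum_placements {K : Type} [Field K] [DecidableEq K] {x : Fin N → K}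
    (hx : Function.Injective x) {l : List ℕ} (hl : ∀ a ∈ l, 0 < a) (hs : l.Pairwise (· > ·))
    (s : Finset (Fin N)) :
    pfun l (s.image x) = ∑ α ∈ placements l s, (∏ i, x i ^ α i) *
      ∏ i ∈ s, ∏ j ∈ s, if α j < α i then (x i + x j) / (x i - x j) else 1 := by
  induction l generalizing s with
  | nil => simp [pfun, placements]
  | cons a l ih =>
    have hl' : ∀ b ∈ l, 0 < b := fun b hb => hl b (by simp [hb])
    have ha : 0 < a := hl a (by simp)
    have hlt : ∀ b ∈ l, b < a := (List.pairwise_cons.mp hs).1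
    have hαlt : ∀ t : Finset (Fin N), ∀ α ∈ placements l t, ∀ j, α j < a := by
      intro t α hα j
      rcases Nat.eq_zero_or_pos (α j) with h | h
      · omega
      · have h1 := ((mem_placements hl').mp hα).2
        have h2 : α j ∈ ((Finset.univ : Finset (Fin N)).val.map α).filter (0 < ·) :=
          Multiset.mem_filter.mpr ⟨Multiset.mem_map_of_mem α (Finset.mem_univ j), h⟩
        rw [h1] at h2
        exact hlt _ (by simpa using h2)
    rw [pfun, Finset.sum_image fun _ _ _ _ h => hx h, placements, Finset.sum_biUnion]
    · refine Finset.sum_congr rfl fun i hi => ?_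
      rw [Finset.sum_image]
      · rw [← Finset.image_erase hx, ih hl' (List.pairwise_cons.mp hs).2, Finset.mul_sum]
        refine Finset.sum_congr rfl fun α hα => ?_
        have hαi : α i = 0 := ((mem_placements hl').mp hα).1 i (Finset.notMem_erase _ _)
        have h1 : ∏ j, x j ^ Function.update α i a j = x i ^ a * ∏ j, x j ^ α j := by
          rw [← Finset.mul_prod_erase Finset.univ _ (Finset.mem_univ i),
            ← Finset.mul_prod_erase Finset.univ (fun j => x j ^ α j) (Finset.mem_univ i), hαi,
            pow_zero, one_mul, Function.update_self]
          congr 1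
          refine Finset.prod_congr rfl fun j hj => ?_
          rw [Function.update_of_ne (Finset.ne_of_mem_erase hj)]
        have h2 : ∀ k ∈ s.erase i, (∏ j ∈ s, if Function.update α i a j < Function.update α i a k
            then (x k + x j) / (x k - x j) else 1) =
            ∏ j ∈ s.erase i, if α j < α k then (x k + x j) / (x k - x j) else 1 := by
          intro k hk
          have hki := Finset.ne_of_mem_erase hk
          rw [← Finset.mul_prod_erase s _ hi, Function.update_self, Function.update_of_ne hki,
            if_neg (not_lt.mpr (hαlt _ α hα k).le), one_mul]
          refine Finset.prod_congr rfl fun j hj => ?_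
          rw [Function.update_of_ne (Finset.ne_of_mem_erase hj)]
        have h3 : (∏ j ∈ s, if Function.update α i a j < Function.update α i a i
            then (x i + x j) / (x i - x j) else 1) = crossProd (x i) ((s.erase i).image x) := by
          rw [← Finset.mul_prod_erase s _ hi, if_neg (lt_irrefl _), one_mul, crossProd,
            Finset.prod_image fun _ _ _ _ h => hx h]
          refine Finset.prod_congr rfl fun j hj => ?_
          rw [Function.update_of_ne (Finset.ne_of_mem_erase hj), Function.update_self,
            if_pos (hαlt _ α hα j)]
        rw [h1, ← Finset.mul_prod_erase s (fun k => ∏ j ∈ s, if Function.update α i a j <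
          Function.update α i a k then (x k + x j) / (x k - x j) else 1) hi, h3,
          Finset.prod_congr rfl h2]
        ring
      · intro α hα β hβ h
        have hα' := ((mem_placements hl').mp hα).1 i (Finset.notMem_erase _ _)
        have hβ' := ((mem_placements hl').mp hβ).1 i (Finset.notMem_erase _ _)
        funext j
        rcases eq_or_ne j i with rfl | hj
        · rw [hα', hβ']
        · have := congrFun h j
          simpa only [Function.update_of_ne hj] using this
    · intro i _ j _ hij
      refine Finset.disjoint_left.mpr fun γ h1 h2 => ?_
      obtain ⟨α, hα, rfl⟩ := Finset.mem_image.mp h1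
      obtain ⟨β, hβ, h⟩ := Finset.mem_image.mp h2
      have := congrFun h i
      rw [Function.update_self, Function.update_of_ne hij] at this
      exact absurd this (hαlt _ β hβ i).ne

/-- At `t = -1`, the Hall–Littlewood polynomial of a strict partition is a Schur P-function. -/
theorem hlAt_neg_one_eq_pfun {K : Type} [Field K] [DecidableEq K] {x : Fin N → K}
    (hx : Function.Injective x) {κ : YoungDiagram} (hκ : κ.card ≤ N) (hs : IsStrict κ) :
    hlAt (-1) x κ = pfun κ.rowLens (Finset.univ.image x) := by
  have hpos : ∀ a ∈ κ.rowLens, 0 < a := fun a ha => YoungDiagram.pos_of_mem_rowLens κ a ha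
  have hsorted : κ.rowLens.Pairwise (· > ·) := by
    have h1 : κ.rowLens.Nodup := by simpa [IsStrict, parts] using hs
    have h2 := κ.rowLens_sorted.pairwise
    exact (h2.and h1).imp fun h => lt_of_le_of_ne h.1 h.2.symm
  rw [pfun_eq_sum_placements hx hpos hsorted, hlAt]
  refine Finset.sum_congr ?_ fun α _ => ?_
  · ext α
    rw [mem_rearrangements ((colLen_le_card κ).trans hκ), mem_placements hpos, parts]
    simp
  · rw [Finset.prod_filter, Fintype.prod_prod_type]
    simp only [neg_mul, one_mul, sub_neg_eq_add]

end Placements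

/-! ### The inverse Kostka polynomials at `t = -1` -/

theorem sum_range_partitionsEq {M : Type*} [AddCommMonoid M] (m : ℕ) (f : YoungDiagram → M) :
    ∑ n ∈ Finset.range (m + 1), ∑ κ ∈ partitionsEq n, f κ = ∑ κ ∈ partitionsLE m, f κ := by
  rw [Finset.sum_sigma']
  refine Finset.sum_bij' (fun x _ => x.2) (fun κ _ => ⟨κ.card, κ⟩) ?_ ?_ ?_ ?_ ?_
  · rintro ⟨n, κ⟩ h
    simp only [Finset.mem_sigma, Finset.mem_range, mem_partitionsEq, mem_partitionsLE] at h ⊢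
    omega
  · intro κ h
    simp only [Finset.mem_sigma, Finset.mem_range, mem_partitionsEq, mem_partitionsLE,
      and_true] at h ⊢
    omega
  · rintro ⟨n, κ⟩ h
    simp only [Finset.mem_sigma, mem_partitionsEq] at h
    obtain ⟨-, rfl⟩ := h
    rfl
  · exact fun _ _ => rfl
  · exact fun _ _ => rfl

theorem sum_strict_hlAt {K : Type} [Field K] [CharZero K] [DecidablePred IsStrict] {N n : ℕ}
    (hn : n ≤ N) {x y : Fin N → K} (hx : Function.Injective x) (hy : Function.Injective y)
    (hx0 : ∀ i, x i ≠ 0) (hy0 : ∀ i, y i ≠ 0) :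
    ∑ κ ∈ (partitionsEq n).filter IsStrict, 2 ^ height κ * hlAt (-1) x κ * hlAt (-1) y κ =
      kernelPart (∏ i, qgeo (x i)) y n := by
  classical
  have h1 : ∀ κ ∈ (partitionsEq n).filter IsStrict,
      2 ^ height κ * hlAt (-1) x κ * hlAt (-1) y κ = 2 ^ height κ *
        pfun κ.rowLens (Finset.univ.image x) * pfun κ.rowLens (Finset.univ.image y) := by
    intro κ hκ
    rw [Finset.mem_filter, mem_partitionsEq] at hκ
    rw [hlAt_neg_one_eq_pfun hx (by omega) hκ.2, hlAt_neg_one_eq_pfun hy (by omega) hκ.2]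
  rw [Finset.sum_congr rfl h1, sum_filter_isStrict n fun h l => (2 : K) ^ h *
    pfun l (Finset.univ.image x) * pfun l (Finset.univ.image y),
    sum_strictSets_pfun (by simpa using hx0) (by simpa using hy0), kernelPart, qkernel,
    Finset.prod_image fun _ _ _ _ h => hx h, Finset.prod_comm' (t' := Finset.univ.image y)
      (s' := fun _ => Finset.univ) (by simp), Finset.prod_image fun _ _ _ _ h => hy h]
  congr 2
  funext j
  rw [map_prod]
  refine Finset.prod_congr rfl fun i _ => ?_
  rw [rescale_qgeo, mul_comm]

theorem kernelPart_qgeo {N n m : ℕ} (hn : n ≤ m) (hm : m ≤ N) :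
    kernelPart (∏ i, qgeo (firstVar N i)) (secondVar N) n = ∑ τ ∈ partitionsEq n,
      ∑ σ ∈ partitionsLE m, ((∑ α ∈ partitionsLE m, ∑ β ∈ partitionsLE m,
        lr σ {α.transpose, β} * lr τ {α, β} : ℤ) : MvPolynomial (Fin N)
        (MvPolynomial (Fin N) ℤ)) * jt (∏ i, geo (firstVar N i)) σ *
          jt (∏ i, geo (secondVar N i)) τ := by
  set X : Fin N → MvPolynomial (Fin N) ℤ := MvPolynomial.X
  have hQ : ∏ i, qgeo (X i) = (∏ i, (1 + PowerSeries.C (X i) * PowerSeries.X)) *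
      ∏ i, geo (X i) := by
    rw [← Finset.prod_mul_distrib]
    exact Finset.prod_congr rfl fun i _ => mul_comm _ _
  have h1 := coeff_zero_prod_linear Finset.univ X
  have h2 := coeff_zero_prod_geo Finset.univ X
  have h12 : PowerSeries.coeff 0 (∏ i, qgeo (X i)) = 1 := by
    rw [hQ]
    rw [PowerSeries.coeff_zero_eq_constantCoeff] at h1 h2 ⊢
    rw [map_mul, h1, h2, one_mul]
  have hmap : ∏ i, qgeo (firstVar N i) = PowerSeries.map MvPolynomial.C (∏ i, qgeo (X i)) := by
    rw [map_prod]
    refine Finset.prod_congr rfl fun i _ => ?_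
    rw [qgeo, qgeo, map_mul, map_geo]
    simp [firstVar, X]
  rw [hmap]
  refine (kernelPart_X_eq h12 (hn.trans hm)).trans (Finset.sum_congr rfl fun τ hτ => ?_)
  rw [mem_partitionsEq] at hτ
  rw [← Finset.sum_mul]
  congr 1
  have hterm : ∀ α ∈ partitionsLE m, ∀ β ∈ partitionsLE m,
      ((lr τ {α, β} : ℤ) : MvPolynomial (Fin N) ℤ) * jt (∏ i, geo (X i)) α.transpose *
        jt (∏ i, geo (X i)) β = ∑ σ ∈ partitionsLE m,
        ((lr σ {α.transpose, β} * lr τ {α, β} : ℤ) : MvPolynomial (Fin N) ℤ) *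
          jt (∏ i, geo (X i)) σ := by
    intro α _ β _
    by_cases h : lr τ {α, β} = 0
    · simp only [h, mul_zero, Int.cast_zero, zero_mul, Finset.sum_const_zero]
    · have h3 := card_eq_of_lr_pair_ne_zero h
      rw [mul_assoc, jt_mul_jt Finset.univ X α.transpose β (m := m)
        (by rw [card_transpose]; omega), Finset.mul_sum]
      refine Finset.sum_congr rfl fun σ _ => ?_
      push_cast
      ring
  rw [hQ, jt_mul h1 h2 τ (m := m) (by omega)]
  simp only [jt_prod_linear]
  rw [Finset.sum_congr rfl fun α hα => Finset.sum_congr rfl fun β hβ => hterm α hα β hβ, map_sum]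
  simp only [jt_firstVar, Int.cast_sum, Finset.sum_mul]
  rw [Finset.sum_comm (s := partitionsLE m) (t := partitionsLE m)]
  refine Finset.sum_congr rfl fun α _ => ?_
  rw [Finset.sum_comm, map_sum]
  refine Finset.sum_congr rfl fun β _ => ?_
  rw [map_sum]
  refine Finset.sum_congr rfl fun σ _ => ?_
  rw [map_mul, map_intCast]
  rfl

/-- The pairing of the rows of the inverse Kostka matrix at `t = -1`: the Cauchy identity for
Schur P-functions, read off in the basis of Schur functions. -/
theorem sum_strict_invKostka [DecidablePred IsStrict] {σ τ : YoungDiagram} {m M : ℕ}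
    (hσ : σ.card ≤ m) (hτ : τ.card ≤ m) (hM : m ≤ M) :
    ∑ κ ∈ (partitionsLE M).filter IsStrict,
        2 ^ height κ * (invKostka κ σ).eval (-1) * (invKostka κ τ).eval (-1) =
      ∑ α ∈ partitionsLE m, ∑ β ∈ partitionsLE m, lr σ {α.transpose, β} * lr τ {α, β} := by
  -- only the `κ` of the size of `σ` contribute
  have hsub : ∑ κ ∈ (partitionsLE M).filter IsStrict,
        2 ^ height κ * (invKostka κ σ).eval (-1) * (invKostka κ τ).eval (-1) =
      ∑ κ ∈ (partitionsLE m).filter IsStrict,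
        2 ^ height κ * (invKostka κ σ).eval (-1) * (invKostka κ τ).eval (-1) := by
    symm
    refine Finset.sum_subset (fun κ hκ => ?_) fun κ hκ hκ' => ?_
    · rw [Finset.mem_filter, mem_partitionsLE] at hκ ⊢
      exact ⟨by omega, hκ.2⟩
    · rw [Finset.mem_filter, mem_partitionsLE] at hκ hκ'
      have : invKostka κ σ = 0 := by
        by_contra h
        have := card_eq_of_invKostka_ne_zero h
        exact hκ' ⟨by omega, hκ.2⟩
      rw [this, Polynomial.eval_zero, mul_zero, zero_mul]
  rw [hsub]
  set R := MvPolynomial (Fin m) (MvPolynomial (Fin m) ℤ) with hR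
  set j : R →+* FractionRing R := algebraMap R (FractionRing R) with hj
  have hinj : Function.Injective j := IsFractionRing.injective R (FractionRing R)
  have : CharZero (FractionRing R) := charZero_of_injective_algebraMap hinj
  set x : Fin m → FractionRing R := fun i => j (firstVar m i) with hxdef
  set y : Fin m → FractionRing R := fun i => j (secondVar m i) with hydef
  have hx : Function.Injective x :=
    (hinj.comp (MvPolynomial.C_injective _ _)).comp MvPolynomial.X_injective
  have hy : Function.Injective y := hinj.comp MvPolynomial.X_injective
  have hx0 : ∀ i, x i ≠ 0 := fun i => (map_ne_zero_iff j hinj).mpr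
    ((map_ne_zero_iff _ (MvPolynomial.C_injective _ _)).mpr (MvPolynomial.X_ne_zero i))
  have hy0 : ∀ i, y i ≠ 0 := fun i => (map_ne_zero_iff j hinj).mpr (MvPolynomial.X_ne_zero i)
  have hjt1 : ∀ κ, j (jt (∏ i, geo (firstVar m i)) κ) = jt (∏ i, geo (x i)) κ := fun κ => by
    rw [← jt_map, map_prod]
    simp only [map_geo, hxdef]
  have hjt2 : ∀ κ, j (jt (∏ i, geo (secondVar m i)) κ) = jt (∏ i, geo (y i)) κ := fun κ => by
    rw [← jt_map, map_prod]
    simp only [map_geo, hydef]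
  -- compare coefficients of `s_σ(x) s_τ(y)` in the field of fractions, where the variables are
  -- distinct and nonzero
  refine two_schur_unique (le_refl m) (c := fun σ τ => ∑ κ ∈ (partitionsLE m).filter IsStrict,
    2 ^ height κ * (invKostka κ σ).eval (-1) * (invKostka κ τ).eval (-1))
    (c' := fun σ τ => ∑ α ∈ partitionsLE m, ∑ β ∈ partitionsLE m,
      lr σ {α.transpose, β} * lr τ {α, β}) (hinj ?_) hσ hτ
  have hL : ∀ κ ∈ (partitionsLE m).filter IsStrict,
      2 ^ height κ * hlAt (-1) x κ * hlAt (-1) y κ =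
      ∑ σ ∈ partitionsLE m, ∑ τ ∈ partitionsLE m, ((2 ^ height κ * (invKostka κ σ).eval (-1) *
        (invKostka κ τ).eval (-1) : ℤ) : FractionRing R) * jt (∏ i, geo (x i)) σ *
        jt (∏ i, geo (y i)) τ := by
    intro κ hκ
    rw [Finset.mem_filter, mem_partitionsLE] at hκ
    have hsupp : ∀ z : Fin m → FractionRing R, ∀ σ,
        (((invKostka κ σ).eval (-1) : ℤ) : FractionRing R) * jt (∏ i, geo (z i)) σ ≠ 0 →
          σ.card = κ.card := by
      intro z σ h
      refine card_eq_of_invKostka_ne_zero fun h0 => h ?_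
      rw [h0, Polynomial.eval_zero, Int.cast_zero, zero_mul]
    rw [hlAt_neg_one hx hκ.1, hlAt_neg_one hy hκ.1, sum_partitionsEq_eq hκ.1 (hsupp x),
      sum_partitionsEq_eq hκ.1 (hsupp y), mul_assoc, Finset.sum_mul_sum, Finset.mul_sum]
    refine Finset.sum_congr rfl fun σ _ => ?_
    rw [Finset.mul_sum]
    refine Finset.sum_congr rfl fun τ _ => ?_
    push_cast
    ring
  have hsum : ∑ κ ∈ (partitionsLE m).filter IsStrict,
      2 ^ height κ * hlAt (-1) x κ * hlAt (-1) y κ = j (∑ n ∈ Finset.range (m + 1),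
        kernelPart (∏ i, qgeo (firstVar m i)) (secondVar m) n) := by
    rw [Finset.sum_filter, ← sum_range_partitionsEq, map_sum]
    refine Finset.sum_congr rfl fun n hn => ?_
    have hn' : n ≤ m := by
      rw [Finset.mem_range] at hn
      omega
    rw [← Finset.sum_filter, sum_strict_hlAt hn' hx hy hx0 hy0, map_kernelPart, map_prod]
    congr 1
    refine Finset.prod_congr rfl fun i _ => ?_
    rw [qgeo, qgeo, map_mul, map_geo]
    simp [hxdef]
  rw [Finset.sum_congr rfl hL] at hsum
  have hR' : ∑ n ∈ Finset.range (m + 1), kernelPart (∏ i, qgeo (firstVar m i)) (secondVar m) n =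
      ∑ σ ∈ partitionsLE m, ∑ τ ∈ partitionsLE m, ((∑ α ∈ partitionsLE m, ∑ β ∈ partitionsLE m,
        lr σ {α.transpose, β} * lr τ {α, β} : ℤ) : R) * jt (∏ i, geo (firstVar m i)) σ *
          jt (∏ i, geo (secondVar m i)) τ := by
    rw [Finset.sum_comm, ← sum_range_partitionsEq]
    refine Finset.sum_congr rfl fun n hn => ?_
    rw [Finset.mem_range] at hn
    exact kernelPart_qgeo (by omega) le_rfl
  rw [← hR', ← hsum]
  simp only [map_sum, map_mul, map_intCast, hjt1, hjt2, Int.cast_sum, Finset.sum_mul]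
  refine (Finset.sum_congr rfl fun σ _ => Finset.sum_comm).trans ?_
  rw [Finset.sum_comm]

/-! ### Removing bars -/

section Bars

variable {p : ℕ} {κ η ρ : YoungDiagram}

theorem count_parts_ofParts (m : Multiset ℕ) {a : ℕ} (ha : 0 < a) :
    (parts (ofParts m)).count a = m.count a := by
  rw [parts_ofParts, Multiset.count_filter, if_pos ha]

theorem mem_parts_ofParts {m : Multiset ℕ} {a : ℕ} : a ∈ parts (ofParts m) ↔ a ∈ m ∧ 0 < a := by
  rw [parts_ofParts, Multiset.mem_filter]

theorem card_ofParts (m : Multiset ℕ) : (ofParts m).card = m.sum := by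
  rw [← sum_parts, parts_ofParts, sum_filter_pos]

theorem isPStrict_iff : IsPStrict p κ ↔ ∀ a, ¬ p ∣ a → (parts κ).count a ≤ 1 := by
  constructor
  · intro h a ha
    by_contra hc
    exact ha (h a (Multiset.count_pos.mp (by omega)) (by omega))
  · intro h a _ ha
    by_contra hc
    have := h a hc
    omega

theorem RemovesBar.card_eq (h : RemovesBar p κ η) : κ.card = η.card + p := by
  rcases h with ⟨a, ha, hpa, -, rfl⟩ | ⟨a, b, hab, hle, rfl⟩
  · rw [card_ofParts, ← sum_parts, ← Multiset.cons_erase ha]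
    simp only [Multiset.sum_cons, Multiset.erase_cons_head]
    omega
  · obtain ⟨m, hm⟩ := Multiset.le_iff_exists_add.mp hle
    rw [card_ofParts, ← sum_parts, hm, add_tsub_cancel_left, Multiset.sum_add]
    simp only [Multiset.insert_eq_cons, Multiset.sum_cons, Multiset.sum_singleton]
    omega

theorem RemovesBars.card_eq {e : ℕ} (h : RemovesBars p e κ ρ) : κ.card = ρ.card + p * e := by
  induction e generalizing κ with
  | zero =>
    rw [show κ = ρ from h, mul_zero, add_zero]
  | succ e ih =>
    obtain ⟨ζ, h1, h2⟩ := h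
    rw [h1.card_eq, ih h2]
    ring

theorem IsPStrict.of_removesBar (hκ : IsPStrict p κ) (h : RemovesBar p κ η) : IsPStrict p η := by
  rw [isPStrict_iff] at hκ ⊢
  intro c hc
  have hc0 : 0 < c := Nat.pos_of_ne_zero fun h => hc (h ▸ dvd_zero p)
  have h1 := hκ c hc
  rcases h with ⟨a, ha, hpa, hor, rfl⟩ | ⟨a, b, -, -, rfl⟩
  · rw [count_parts_ofParts _ hc0]
    have h2 := Multiset.count_le_of_le c (Multiset.erase_le a (parts κ))
    by_cases hca : c = a - p
    · have hna : ¬ p ∣ a := fun h => hc (hca ▸ Nat.dvd_sub h dvd_rfl)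
      have h3 := Multiset.count_eq_zero.mpr (hor.resolve_left hna)
      rw [← hca] at h3
      rw [← hca, Multiset.count_cons_self]
      omega
    · rw [Multiset.count_cons_of_ne hca]
      omega
  · rw [count_parts_ofParts _ hc0]
    have := Multiset.count_le_of_le c (tsub_le_self : parts κ - {a, b} ≤ parts κ)
    omega

theorem card_residueParts_replace {i a : ℕ} (hi : 0 < i) (hip : i < p) (ha : a ∈ parts κ)
    (hpa : p ≤ a) :
    (residueParts p i (ofParts ((a - p) ::ₘ (parts κ).erase a))).card =
      (residueParts p i κ).card := by
  have h0 : ∀ m : Multiset ℕ, (m.filter (0 < ·)).filter (fun a => a ≡ i [MOD p]) =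
      m.filter fun a => a ≡ i [MOD p] := by
    intro m
    rw [Multiset.filter_filter]
    refine Multiset.filter_congr fun b _ => ⟨fun h => h.1, fun h => ⟨h, ?_⟩⟩
    rcases Nat.eq_zero_or_pos b with hb | hb
    · subst hb
      have h' : 0 % p = i % p := h
      rw [Nat.zero_mod, Nat.mod_eq_of_lt hip] at h'
      omega
    · exact hb
  have h1 : a - p ≡ i [MOD p] ↔ a ≡ i [MOD p] := by
    have h2 : (a - p) % p = a % p := by
      conv_rhs => rw [← Nat.sub_add_cancel hpa, Nat.add_mod_right]
    rw [Nat.ModEq, Nat.ModEq, h2]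
  rw [residueParts, residueParts, parts_ofParts, h0]
  conv_rhs => rw [← Multiset.cons_erase ha]
  by_cases h : a ≡ i [MOD p]
  · rw [Multiset.filter_cons_of_pos (p := fun a => a ≡ i [MOD p]) _ (h1.mpr h),
      Multiset.filter_cons_of_pos (p := fun a => a ≡ i [MOD p]) _ h,
      Multiset.card_cons, Multiset.card_cons]
  · rw [Multiset.filter_cons_of_neg (p := fun a => a ≡ i [MOD p]) _ (fun h' => h (h1.mp h')),
      Multiset.filter_cons_of_neg (p := fun a => a ≡ i [MOD p]) _ h]

/-- The positions occupied on the `i`-th runner of the abacus: the `k` such that `i + pk` is a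
part. -/
def runner (p i : ℕ) (κ : YoungDiagram) : Finset ℕ :=
  (Finset.range (κ.card + 1)).filter fun k => i + p * k ∈ parts κ

theorem mem_runner (hp : 0 < p) {i k : ℕ} : k ∈ runner p i κ ↔ i + p * k ∈ parts κ := by
  rw [runner, Finset.mem_filter, Finset.mem_range]
  refine ⟨fun h => h.2, fun h => ⟨?_, h⟩⟩
  have h1 := Multiset.single_le_sum (fun _ _ => Nat.zero_le _) _ h
  rw [sum_parts] at h1
  have h2 := Nat.le_mul_of_pos_left k hp
  omega

theorem residueParts_eq_runner (hκ : IsPStrict p κ) {i : ℕ} (hi : 0 < i) (hip : i < p) :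
    residueParts p i κ = (runner p i κ).val.map fun k => i + p * k := by
  have hinj : Function.Injective fun k => i + p * k := fun k k' h =>
    Nat.eq_of_mul_eq_mul_left (by omega : 0 < p) (Nat.add_left_cancel h)
  refine (Multiset.Nodup.ext ?_ ((runner p i κ).nodup.map hinj)).mpr fun a => ?_
  · rw [Multiset.nodup_iff_count_le_one]
    intro a
    rw [residueParts, Multiset.count_filter]
    split_ifs with h
    · refine isPStrict_iff.mp hκ a fun hpa => ?_
      have h' : a % p = i % p := h
      rw [Nat.mod_eq_zero_of_dvd hpa, Nat.mod_eq_of_lt hip] at h'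
      omega
    · omega
  · rw [residueParts, Multiset.mem_filter, Multiset.mem_map]
    constructor
    · rintro ⟨ha, h⟩
      have h' : a % p = i % p := h
      rw [Nat.mod_eq_of_lt hip] at h'
      have h2 := Nat.mod_add_div a p
      rw [h'] at h2
      exact ⟨a / p, (mem_runner (by omega)).mpr (h2.symm ▸ ha), h2⟩
    · rintro ⟨k, hk, rfl⟩
      refine ⟨(mem_runner (by omega)).mp hk, ?_⟩
      change (i + p * k) % p = i % p
      rw [Nat.add_mul_mod_self_left]

theorem card_runner (hκ : IsPStrict p κ) {i : ℕ} (hi : 0 < i) (hip : i < p) :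
    (runner p i κ).card = (residueParts p i κ).card := by
  rw [residueParts_eq_runner hκ hi hip, Multiset.card_map, Finset.card_def]

theorem eq_range_of_forall_succ {B : Finset ℕ} (h : ∀ k, k + 1 ∈ B → k ∈ B) :
    B = Finset.range B.card := by
  have h1 : ∀ j k, k + j ∈ B → k ∈ B := by
    intro j
    induction j with
    | zero => exact fun k hk => hk
    | succ j ih => exact fun k hk => ih k (h _ hk)
  refine Finset.eq_of_subset_of_card_le (fun k hk => ?_) (by simp)
  have h2 : Finset.range (k + 1) ⊆ B := fun j hj => by
    rw [Finset.mem_range] at hj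
    exact h1 (k - j) j (by rwa [Nat.add_sub_cancel' (by omega)])
  have := Finset.card_le_card h2
  rw [Finset.card_range] at this
  rw [Finset.mem_range]
  omega

/-- A `p`-strict partition whose parts have residues at most `(p - 1) / 2`, and which has as many
parts as `ρ` on each runner other than the zeroth. -/
def SameRunners (p : ℕ) (ρ κ : YoungDiagram) : Prop :=
  IsPStrict p κ ∧ (∀ a ∈ parts κ, a % p ≤ p / 2) ∧
    ∀ i, 0 < i → i ≤ p / 2 → (residueParts p i κ).card = (residueParts p i ρ).card

/-- If no part of `κ` can be decreased by `p`, then `κ` is determined by its numbers of parts on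
the runners. -/
theorem SameRunners.eq_of_forall_not (hp : 0 < p) {κ' : YoungDiagram} (h : SameRunners p ρ κ)
    (h' : SameRunners p ρ κ')
    (hc : ∀ a ∈ parts κ, p ≤ a → ¬ p ∣ a ∧ a - p ∈ parts κ)
    (hc' : ∀ a ∈ parts κ', p ≤ a → ¬ p ∣ a ∧ a - p ∈ parts κ') : κ = κ' := by
  have key : ∀ κ, SameRunners p ρ κ → (∀ a ∈ parts κ, p ≤ a → ¬ p ∣ a ∧ a - p ∈ parts κ) →
      ∀ a, (parts κ).count a = if 0 < a % p ∧ a % p ≤ p / 2 ∧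
        a / p < (residueParts p (a % p) ρ).card then 1 else 0 := by
    intro κ h hc a
    have hz : a ∈ parts κ → 0 < a % p := by
      intro ha
      by_contra h0
      have hpa : p ∣ a := Nat.dvd_of_mod_eq_zero (by omega)
      exact (hc a ha (Nat.le_of_dvd (pos_of_mem_parts ha) hpa)).1 hpa
    have hmem : a ∈ parts κ ↔ 0 < a % p ∧ a % p ≤ p / 2 ∧
        a / p < (residueParts p (a % p) ρ).card := by
      have hrun : 0 < a % p → a % p ≤ p / 2 → (a ∈ parts κ ↔
          a / p < (residueParts p (a % p) ρ).card) := by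
        intro h1 h2
        have h3 : runner p (a % p) κ = Finset.range (runner p (a % p) κ).card := by
          refine eq_range_of_forall_succ fun k hk => ?_
          rw [mem_runner hp] at hk ⊢
          have := (hc _ hk (by rw [mul_add]; omega)).2
          rwa [mul_add, mul_one, ← add_assoc, Nat.add_sub_cancel] at this
        have h4 := mem_runner (κ := κ) hp (i := a % p) (k := a / p)
        rw [Nat.mod_add_div, h3, Finset.mem_range, card_runner h.1 h1 (Nat.mod_lt _ hp),
          h.2.2 _ h1 h2] at h4
        exact h4.symm
      constructor
      · intro ha
        exact ⟨hz ha, h.2.1 a ha, (hrun (hz ha) (h.2.1 a ha)).mp ha⟩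
      · rintro ⟨h1, h2, h3⟩
        exact (hrun h1 h2).mpr h3
    split_ifs with hif
    · have h1 := Multiset.count_pos.mpr (hmem.mpr hif)
      have h2 := isPStrict_iff.mp h.1 a fun hpa => by
        have := Nat.mod_eq_zero_of_dvd hpa
        omega
      omega
    · exact Multiset.count_eq_zero.mpr fun ha => hif (hmem.mp ha)
  refine parts_injective (Multiset.ext.mpr fun a => ?_)
  rw [key κ h hc, key κ' h' hc']

theorem IsBarCore.sub_mem (hρ : IsBarCore p ρ) :
    ∀ a ∈ parts ρ, p ≤ a → ¬ p ∣ a ∧ a - p ∈ parts ρ := by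
  intro a ha hpa
  by_contra hc
  refine hρ.2 _ (Or.inl ⟨a, ha, hpa, ?_, rfl⟩)
  tauto

theorem IsBarCore.mem_of_lt (hρ : IsBarCore p ρ) {i k : ℕ} (hi : 0 < i) (hip : i < p)
    (hk : k < (residueParts p i ρ).card) : i + p * k ∈ parts ρ := by
  have h3 : runner p i ρ = Finset.range (runner p i ρ).card := by
    refine eq_range_of_forall_succ fun k hk => ?_
    rw [mem_runner (by omega)] at hk ⊢
    have := (hρ.sub_mem _ hk (by rw [mul_add]; omega)).2
    rwa [mul_add, mul_one, ← add_assoc, Nat.add_sub_cancel] at this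
  rw [← mem_runner (by omega), h3, Finset.mem_range, card_runner hρ.1 hi hip]
  exact hk

theorem IsRouquier.le_card {d : ℕ} (hR : IsRouquier p d ρ) {i : ℕ} (hi : 0 < i)
    (hip : i ≤ p / 2) : d ≤ (residueParts p i ρ).card := by
  induction i, hi using Nat.le_induction with
  | base => exact hR.1
  | succ i hi ih =>
    have h1 := hR.2 (i + 1) (by omega) hip
    have h2 := ih (by omega)
    rw [Nat.add_sub_cancel] at h1
    omega

theorem IsBarCore.sameRunners (hodd : p = 2 * (p / 2) + 1) {d : ℕ} (hd : 1 ≤ d)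
    (hρ : IsBarCore p ρ) (hR : IsRouquier p d ρ) : SameRunners p ρ ρ := by
  refine ⟨hρ.1, fun a ha => ?_, fun _ _ _ => rfl⟩
  by_contra hc
  have hlt := Nat.mod_lt a (show 0 < p by omega)
  -- the first part `a % p` on the runner of `a` forms a bar with the first part on the
  -- complementary runner
  have h1 : a % p ∈ parts ρ := by
    have h2 : a ∈ residueParts p (a % p) ρ :=
      Multiset.mem_filter.mpr ⟨ha, (Nat.mod_modEq a p).symm⟩
    have := hρ.mem_of_lt (k := 0) (by omega) hlt (Multiset.card_pos_iff_exists_mem.mpr ⟨a, h2⟩)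
    simpa using this
  have h3 : p - a % p ∈ parts ρ := by
    have := hρ.mem_of_lt (i := p - a % p) (k := 0) (by omega) (by omega)
      (lt_of_lt_of_le hd (hR.le_card (by omega) (by omega)))
    simpa using this
  refine hρ.2 _ (Or.inr ⟨a % p, p - a % p, by omega, ?_, rfl⟩)
  rw [Multiset.insert_eq_cons, Multiset.cons_le_of_notMem (by simp; omega)]
  exact ⟨h1, Multiset.singleton_le.mpr h3⟩

/-- Adding at most `d` bars to a `d`-Rouquier core moves parts along the runners only: the lower
parts of the core stay in place, and they prevent the addition of a pair of parts with sum `p`. -/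
theorem sameRunners_of_removesBars (hodd : p = 2 * (p / 2) + 1) {d : ℕ} (hd : 1 ≤ d)
    (hρ : IsBarCore p ρ) (hR : IsRouquier p d ρ) {e : ℕ} (he : e ≤ d) (hκ : IsPStrict p κ)
    (h : RemovesBars p e κ ρ) :
    SameRunners p ρ κ ∧ ∀ i k, 0 < i → i ≤ p / 2 → k + e < (residueParts p i ρ).card →
      i + p * k ∈ parts κ := by
  induction e generalizing κ with
  | zero =>
    obtain rfl : κ = ρ := h
    exact ⟨hρ.sameRunners hodd hd hR, fun i k hi hip hk => hρ.mem_of_lt hi (by omega) hk⟩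
  | succ e ih =>
    obtain ⟨ζ, h1, h2⟩ := h
    obtain ⟨⟨-, hres, hcard⟩, hbot⟩ := ih (by omega) (hκ.of_removesBar h1) h2
    rcases h1 with ⟨a, ha, hpa, -, rfl⟩ | ⟨a, b, hab, hle, rfl⟩
    · have hsub : ∀ c ∈ (parts κ).erase a, c % p ≤ p / 2 := fun c hc => hres c
        (mem_parts_ofParts.mpr ⟨Multiset.mem_cons_of_mem hc,
          pos_of_mem_parts (Multiset.mem_of_mem_erase hc)⟩)
      have hamod : (a - p) % p = a % p := by
        conv_rhs => rw [← Nat.sub_add_cancel hpa, Nat.add_mod_right]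
      refine ⟨⟨hκ, fun c hc => ?_, fun i hi hip => ?_⟩, fun i k hi hip hk => ?_⟩
      · by_cases hca : c = a
        · subst hca
          rcases Nat.eq_zero_or_pos (c - p) with h0 | h0
          · rw [← hamod, h0, Nat.zero_mod]
            exact Nat.zero_le _
          · rw [← hamod]
            exact hres _ (mem_parts_ofParts.mpr ⟨Multiset.mem_cons_self _ _, h0⟩)
        · exact hsub c ((Multiset.mem_erase_of_ne hca).mpr hc)
      · rw [← hcard i hi hip, card_residueParts_replace hi (by omega) ha hpa]
      · have h3 := (mem_parts_ofParts.mp (hbot i k hi hip (by omega))).1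
        rcases Multiset.mem_cons.mp h3 with h4 | h4
        · exfalso
          have h5 := (mem_parts_ofParts.mp (hbot i (k + 1) hi hip (by omega))).1
          have h6 : i + p * (k + 1) = a := by
            rw [mul_add, mul_one, ← add_assoc, h4]
            omega
          rw [h6, Multiset.mem_cons] at h5
          have h7 := h5.resolve_left (by omega)
          have h8 := Multiset.count_pos.mpr h7
          rw [Multiset.count_erase_self] at h8
          have h9 := isPStrict_iff.mp hκ a fun hdvd => by
            have h10 := Nat.mod_eq_zero_of_dvd hdvd
            rw [← h6, Nat.add_mul_mod_self_left, Nat.mod_eq_of_lt (by omega)] at h10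
            omega
          omega
        · exact Multiset.mem_of_mem_erase h4
    · exfalso
      have hpos : ∀ c ∈ ({a, b} : Multiset ℕ), 0 < c := fun c hc =>
        pos_of_mem_parts (Multiset.mem_of_le hle hc)
      have ha0 := hpos a (by simp)
      have hb0 := hpos b (by simp)
      -- the smaller of the two parts would repeat the lowest part on its runner, which is still
      -- present
      have hcontra : ∀ c ∈ ({a, b} : Multiset ℕ), c ≤ p / 2 → False := by
        intro c hc hcp
        have hc0 := hpos c hc
        have h3 := hbot c 0 hc0 hcp (by have := hR.le_card hc0 hcp; omega)
        rw [mul_zero, add_zero] at h3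
        have h4 := Multiset.count_pos.mpr (mem_parts_ofParts.mp h3).1
        have h5 := Multiset.count_pos.mpr hc
        rw [Multiset.count_sub] at h4
        have h6 := isPStrict_iff.mp hκ c fun hdvd => by
          have := Nat.le_of_dvd hc0 hdvd
          omega
        omega
      rcases le_or_gt a (p / 2) with h | h
      · exact hcontra a (by simp) h
      · exact hcontra b (by simp) (by omega)

theorem SameRunners.exists_removesBars (hp : 0 < p) (hρ : IsBarCore p ρ) (hρ' : SameRunners p ρ ρ)
    {n : ℕ} (hn : κ.card ≤ n) (h : SameRunners p ρ κ) : ∃ e, RemovesBars p e κ ρ := by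
  induction n generalizing κ with
  | zero =>
    refine ⟨0, h.eq_of_forall_not hp hρ' (fun a ha hpa => ?_) hρ.sub_mem⟩
    have h1 := Multiset.single_le_sum (fun _ _ => Nat.zero_le _) _ ha
    rw [sum_parts] at h1
    omega
  | succ n ih =>
    by_cases hc : ∀ a ∈ parts κ, p ≤ a → ¬ p ∣ a ∧ a - p ∈ parts κ
    · exact ⟨0, h.eq_of_forall_not hp hρ' hc hρ.sub_mem⟩
    · push Not at hc
      obtain ⟨a, ha, hpa, hor⟩ := hc
      have hbar : RemovesBar p κ (ofParts ((a - p) ::ₘ (parts κ).erase a)) :=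
        Or.inl ⟨a, ha, hpa, by tauto, rfl⟩
      have hcard := hbar.card_eq
      have hgood : SameRunners p ρ (ofParts ((a - p) ::ₘ (parts κ).erase a)) := by
        refine ⟨h.1.of_removesBar hbar, fun c hc => ?_, fun i hi hip => ?_⟩
        · rcases Multiset.mem_cons.mp (mem_parts_ofParts.mp hc).1 with h1 | h1
          · have hamod : (a - p) % p = a % p := by
              conv_rhs => rw [← Nat.sub_add_cancel hpa, Nat.add_mod_right]
            rw [h1, hamod]
            exact h.2.1 a ha
          · exact h.2.1 c (Multiset.mem_of_mem_erase h1)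
        · rw [card_residueParts_replace hi (by omega) ha hpa, h.2.2 i hi hip]
      obtain ⟨e, he⟩ := ih (by omega) hgood
      exact ⟨e + 1, _, hbar, he⟩

/-- The block with core `ρ` and weight `d` in terms of the abacus. -/
theorem mem_pStrictPartitions_iff (hodd : p = 2 * (p / 2) + 1) {d : ℕ} (hd : 1 ≤ d)
    (hρ : IsBarCore p ρ) (hR : IsRouquier p d ρ) :
    κ ∈ pStrictPartitions p ρ d ↔ SameRunners p ρ κ ∧ κ.card = ρ.card + p * d := by
  constructor
  · rintro ⟨h1, h2, -⟩
    exact ⟨(sameRunners_of_removesBars hodd hd hρ hR le_rfl h1 h2).1, h2.card_eq⟩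
  · rintro ⟨h1, h2⟩
    obtain ⟨e, he⟩ := SameRunners.exists_removesBars (by omega) hρ
      (hρ.sameRunners hodd hd hR) le_rfl h1
    have h3 := he.card_eq
    have h4 : e = d := by
      have : p * d = p * e := by omega
      exact (Nat.eq_of_mul_eq_mul_left (by omega) this).symm
    exact ⟨h1.1, h4 ▸ he, hρ⟩

end Bars

/-! ### Bar-quotients -/

section Quotients

variable {p : ℕ} {κ η ρ : YoungDiagram}

/-- The `r`-element beta-set `{η_j + r - j}` of a partition `η` with at most `r` parts (the parts
being numbered from `1`). -/
def betaSet (r : ℕ) (η : YoungDiagram) : Finset ℕ :=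
  Finset.univ.image fun j : Fin r => η.rowLen j + (r - 1 - (j : ℕ))

theorem betaSet_strictAnti (r : ℕ) (η : YoungDiagram) :
    StrictAnti fun j : Fin r => η.rowLen j + (r - 1 - (j : ℕ)) := by
  intro i j hij
  have h1 := η.rowLen_anti i j (Fin.le_def.mp hij.le)
  have h2 := Fin.lt_def.mp hij
  have h3 := j.2
  change η.rowLen j + (r - 1 - (j : ℕ)) < η.rowLen i + (r - 1 - (i : ℕ))
  omega

theorem betaSet_val (r : ℕ) (η : YoungDiagram) : (betaSet r η).val =
    (Finset.univ : Finset (Fin r)).val.map fun j : Fin r => η.rowLen j + (r - 1 - (j : ℕ)) :=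
  Finset.image_val_of_injOn (betaSet_strictAnti r η).injective.injOn

theorem card_betaSet (r : ℕ) (η : YoungDiagram) : (betaSet r η).card = r := by
  rw [betaSet, Finset.card_image_of_injective _ (betaSet_strictAnti r η).injective]
  simp

theorem sum_betaSet {r : ℕ} (hη : η.colLen 0 ≤ r) :
    ∑ k ∈ betaSet r η, k = η.card + ∑ j : Fin r, (r - 1 - (j : ℕ)) := by
  rw [betaSet, Finset.sum_image (betaSet_strictAnti r η).injective.injOn,
    Finset.sum_add_distrib, card_eq_sum_rowLen hη]

theorem card_filter_lt_betaSet (r : ℕ) (η : YoungDiagram) (j : Fin r) :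
    ((betaSet r η).filter (· < η.rowLen j + (r - 1 - (j : ℕ)))).card = r - 1 - (j : ℕ) := by
  rw [betaSet, Finset.filter_image, Finset.card_image_of_injective _
    (betaSet_strictAnti r η).injective]
  have h : Finset.univ.filter (fun i : Fin r => η.rowLen i + (r - 1 - (i : ℕ)) <
      η.rowLen j + (r - 1 - (j : ℕ))) = Finset.Ioi j := by
    ext i
    rw [Finset.mem_filter, Finset.mem_Ioi]
    exact ⟨fun h => (betaSet_strictAnti r η).lt_iff_gt.mp h.2,
      fun h => ⟨Finset.mem_univ _, (betaSet_strictAnti r η).lt_iff_gt.mpr h⟩⟩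
  rw [h, Fin.card_Ioi]

theorem ofParts_map_rowLen {r : ℕ} (hη : η.colLen 0 ≤ r) :
    ofParts ((Finset.univ : Finset (Fin r)).val.map fun j : Fin r => η.rowLen j) = η := by
  refine parts_injective ?_
  rw [parts_ofParts, filter_map_rowLen hη]

theorem exists_eq_betaSet (B : Finset ℕ) :
    ∃ η : YoungDiagram, η.colLen 0 ≤ B.card ∧ B = betaSet B.card η := by
  set r := B.card with hr
  set e := B.orderEmbOfFin hr.symm with he
  -- the `j`-th smallest element of `B` is at least `j`, and the excess is weakly increasing in `j`
  have hgap : ∀ i j : Fin r, i ≤ j → e i + ((j : ℕ) - i) ≤ e j := by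
    have h1 : ∀ n : ℕ, ∀ i j : Fin r, (j : ℕ) = i + n → e i + n ≤ e j := by
      intro n
      induction n with
      | zero =>
        intro i j hij
        rw [Fin.ext (by omega : (i : ℕ) = j), add_zero]
      | succ n ih =>
        intro i j hij
        have h2 := ih i ⟨i + n, by omega⟩ rfl
        have h3 : e ⟨i + n, by omega⟩ < e j := e.strictMono (by
          rw [Fin.lt_def]
          simp only
          omega)
        omega
    intro i j hij
    exact h1 _ i j (by have := Fin.le_def.mp hij; omega)
  have hge : ∀ i : Fin r, (i : ℕ) ≤ e i := by
    intro i
    have hr0 : 0 < r := by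
      have := i.2
      omega
    have := hgap ⟨0, hr0⟩ i (Fin.le_def.mpr (Nat.zero_le _))
    simp only at this
    omega
  set f : ℕ → ℕ := fun j => if h : j < r then e ⟨r - 1 - j, by omega⟩ - (r - 1 - j) else 0 with hf
  have hanti : Antitone f := by
    intro i j hij
    simp only [hf]
    by_cases hj : j < r
    · rw [dif_pos hj, dif_pos (by omega)]
      have h1 := hgap ⟨r - 1 - j, by omega⟩ ⟨r - 1 - i, by omega⟩ (Fin.le_def.mpr (by
        simp only
        omega))
      simp only at h1
      omega
    · rw [dif_neg hj]
      exact Nat.zero_le _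
  have hzero : ∀ j, r ≤ j → f j = 0 := fun j hj => dif_neg (by omega)
  refine ⟨ofAntitone f hanti r, ?_, ?_⟩
  · rw [← rowLen_eq_zero_iff, rowLen_ofAntitone hanti (hzero r le_rfl), hzero r le_rfl]
  · symm
    refine Finset.eq_of_subset_of_card_le (fun k hk => ?_) (by rw [card_betaSet])
    obtain ⟨j, -, rfl⟩ := Finset.mem_image.mp hk
    rw [rowLen_ofAntitone hanti (hzero r le_rfl)]
    have h1 := hge ⟨r - 1 - j, by omega⟩
    simp only at h1
    have h2 : f j + (r - 1 - (j : ℕ)) = e ⟨r - 1 - j, by omega⟩ := by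
      simp only [hf]
      rw [dif_pos j.2]
      omega
    rw [h2]
    exact Finset.orderEmbOfFin_mem _ _ _

theorem barQuotient_eq (hp : 0 < p) {i r : ℕ} (hi : 0 < i) (hη : η.colLen 0 ≤ r)
    (h : residueParts p i κ = (betaSet r η).val.map fun k => i + p * k) :
    barQuotient p κ i = η := by
  rw [barQuotient, if_neg hi.ne', h, Multiset.map_map, betaSet_val, Multiset.map_map]
  conv_rhs => rw [← ofParts_map_rowLen hη]
  congr 1
  refine Multiset.map_congr rfl fun j _ => ?_
  simp only [Function.comp_apply]
  have h1 : ((((Finset.univ : Finset (Fin r)).val.map fun j : Fin r =>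
      η.rowLen j + (r - 1 - (j : ℕ))).map fun k => i + p * k).filter
      (· < i + p * (η.rowLen j + (r - 1 - (j : ℕ))))).card = r - 1 - (j : ℕ) := by
    refine Eq.trans ?_ (card_filter_lt_betaSet r η j)
    rw [← betaSet_val, Multiset.filter_map, Multiset.card_map,
      Finset.card_def, Finset.filter_val]
    congr 1
    refine Multiset.filter_congr fun k _ => ?_
    simp only [Function.comp_apply]
    rw [Nat.add_lt_add_iff_left]
    exact Nat.mul_lt_mul_left hp
  rw [h1]
  have h3 : i + p * (η.rowLen j + (r - 1 - (j : ℕ))) - (r - 1 - (j : ℕ)) * p - i =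
      p * η.rowLen j := by
    rw [mul_add, mul_comm p (r - 1 - (j : ℕ))]
    omega
  rw [h3, Nat.mul_div_cancel_left _ hp]

theorem residueParts_eq (hκ : IsPStrict p κ) {i : ℕ} (hi : 0 < i) (hip : i < p) :
    (barQuotient p κ i).colLen 0 ≤ (residueParts p i κ).card ∧
      residueParts p i κ = (betaSet (residueParts p i κ).card (barQuotient p κ i)).val.map
        fun k => i + p * k := by
  obtain ⟨η, h1, h2⟩ := exists_eq_betaSet (runner p i κ)
  have h3 := residueParts_eq_runner hκ hi hip
  rw [card_runner hκ hi hip] at h1 h2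
  rw [h2] at h3
  rw [barQuotient_eq (by omega) hi h1 h3]
  exact ⟨h1, h3⟩

theorem dvd_of_mem_residueParts {a : ℕ} (ha : a ∈ residueParts p 0 κ) : p ∣ a :=
  (Nat.modEq_zero_iff_dvd).mp (Multiset.mem_filter.mp ha).2

theorem parts_barQuotient_zero (hp : 0 < p) :
    parts (barQuotient p κ 0) = (residueParts p 0 κ).map fun a => a / p := by
  rw [barQuotient, if_pos rfl, parts_ofParts]
  refine Multiset.filter_eq_self.mpr fun b hb => ?_
  obtain ⟨a, ha, rfl⟩ := Multiset.mem_map.mp hb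
  exact Nat.div_pos (Nat.le_of_dvd (pos_of_mem_parts (Multiset.mem_filter.mp ha).1)
    (dvd_of_mem_residueParts ha)) hp

theorem residueParts_zero_eq (hp : 0 < p) :
    residueParts p 0 κ = (parts (barQuotient p κ 0)).map fun b => p * b := by
  rw [parts_barQuotient_zero hp, Multiset.map_map]
  conv_lhs => rw [← Multiset.map_id (residueParts p 0 κ)]
  refine Multiset.map_congr rfl fun a ha => ?_
  exact (Nat.mul_div_cancel' (dvd_of_mem_residueParts ha)).symm

theorem barQuotient_zero_eq (hp : 0 < p)
    (h : residueParts p 0 κ = (parts η).map fun b => p * b) : barQuotient p κ 0 = η := by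
  refine parts_injective ?_
  rw [parts_barQuotient_zero hp, h, Multiset.map_map]
  conv_rhs => rw [← Multiset.map_id (parts η)]
  exact Multiset.map_congr rfl fun b _ => Nat.mul_div_cancel_left _ hp

theorem parts_eq_sum_residueParts (hodd : p = 2 * (p / 2) + 1)
    (h : ∀ a ∈ parts κ, a % p ≤ p / 2) :
    parts κ = residueParts p 0 κ + ∑ i : Fin (p / 2), residueParts p (i + 1) κ := by
  have hmod : ∀ a i : ℕ, i < p → (a ≡ i [MOD p] ↔ a % p = i) := fun a i hi => by
    rw [Nat.ModEq, Nat.mod_eq_of_lt hi]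
  refine Multiset.ext.mpr fun a => ?_
  rw [Multiset.count_add, Multiset.count_sum']
  simp only [residueParts, Multiset.count_filter]
  rcases Nat.eq_zero_or_pos ((parts κ).count a) with h0 | h0
  · simp [h0]
  have hle := h a (Multiset.count_pos.mp h0)
  rcases Nat.eq_zero_or_pos (a % p) with ha | ha
  · rw [if_pos ((hmod a 0 (by omega)).mpr ha), Finset.sum_eq_zero, add_zero]
    intro i _
    rw [if_neg]
    rw [hmod a _ (by omega)]
    omega
  · rw [if_neg (by rw [hmod a 0 (by omega)]; omega), zero_add,
      Finset.sum_eq_single (⟨a % p - 1, by omega⟩ : Fin (p / 2))]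
    · rw [if_pos]
      rw [hmod a _ (by simp only; omega)]
      simp only
      omega
    · intro i _ hi
      rw [if_neg]
      rw [hmod a _ (by omega)]
      intro hc
      exact hi (Fin.ext (by simp only; omega))
    · exact fun h => absurd (Finset.mem_univ _) h

theorem SameRunners.card_residueParts (h : SameRunners p ρ κ) (i : Fin (p / 2)) :
    (residueParts p (i + 1) κ).card = (residueParts p (i + 1) ρ).card :=
  h.2.2 _ (Nat.succ_pos _) i.2

/-- A partition is determined by its bar-quotient and its numbers of parts on the runners. -/
theorem SameRunners.eq_of_barQuotient_eq (hodd : p = 2 * (p / 2) + 1) {κ' : YoungDiagram}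
    (h : SameRunners p ρ κ) (h' : SameRunners p ρ κ')
    (h0 : barQuotient p κ 0 = barQuotient p κ' 0)
    (hq : ∀ i : Fin (p / 2), barQuotient p κ (i + 1) = barQuotient p κ' (i + 1)) : κ = κ' := by
  refine parts_injective ?_
  rw [parts_eq_sum_residueParts hodd h.2.1, parts_eq_sum_residueParts hodd h'.2.1,
    residueParts_zero_eq (by omega), h0, ← residueParts_zero_eq (by omega)]
  congr 1
  refine Finset.sum_congr rfl fun i _ => ?_
  have hi := i.2
  rw [(residueParts_eq h.1 (Nat.succ_pos _) (by omega)).2, h.card_residueParts, hq i,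
    ← h'.card_residueParts, ← (residueParts_eq h'.1 (Nat.succ_pos _) (by omega)).2]

theorem sum_map_add_mul (B : Finset ℕ) (i : ℕ) :
    (B.val.map fun k => i + p * k).sum = i * B.card + p * ∑ k ∈ B, k := by
  change ∑ k ∈ B, (i + p * k) = _
  rw [Finset.sum_add_distrib, Finset.sum_const, Finset.mul_sum, smul_eq_mul, mul_comm]

theorem SameRunners.card_eq (hodd : p = 2 * (p / 2) + 1) (h : SameRunners p ρ κ) :
    κ.card = p * ((barQuotient p κ 0).card + ∑ i : Fin (p / 2), (barQuotient p κ (i + 1)).card) +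
      ∑ i : Fin (p / 2), (((i : ℕ) + 1) * (residueParts p (i + 1) ρ).card +
        p * ∑ j : Fin (residueParts p (i + 1) ρ).card,
          ((residueParts p (i + 1) ρ).card - 1 - (j : ℕ))) := by
  have hsum : ∀ f : Fin (p / 2) → Multiset ℕ, (∑ i, f i).sum = ∑ i, (f i).sum := fun f =>
    map_sum (Multiset.sumAddMonoidHom : Multiset ℕ →+ ℕ) f Finset.univ
  rw [← sum_parts κ, parts_eq_sum_residueParts hodd h.2.1, Multiset.sum_add, hsum,
    residueParts_zero_eq (by omega), Multiset.sum_map_mul_left, Multiset.map_id', sum_parts,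
    mul_add, add_assoc, Finset.mul_sum, ← Finset.sum_add_distrib]
  congr 1
  refine Finset.sum_congr rfl fun i _ => ?_
  have hi := i.2
  have h1 := residueParts_eq h.1 (i := i + 1) (Nat.succ_pos _) (by omega)
  rw [h.card_residueParts] at h1
  rw [h1.2, sum_map_add_mul, sum_betaSet h1.1, card_betaSet]
  ring

theorem betaSet_bot (r : ℕ) : betaSet r ⊥ = Finset.range r := by
  refine Finset.eq_of_subset_of_card_le (fun k hk => ?_) (by rw [card_betaSet, Finset.card_range])
  obtain ⟨j, -, rfl⟩ := Finset.mem_image.mp hk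
  rw [rowLen_bot, Finset.mem_range]
  omega

theorem IsBarCore.barQuotient_eq_bot (hp : 0 < p) (hρ : IsBarCore p ρ) {i : ℕ} (hip : i < p) :
    barQuotient p ρ i = ⊥ := by
  rcases Nat.eq_zero_or_pos i with rfl | hi
  · rw [← card_eq_zero_iff, ← sum_parts, parts_barQuotient_zero hp,
      Multiset.eq_zero_of_forall_notMem (s := residueParts p 0 ρ)]
    · rfl
    · intro a ha
      have h1 := dvd_of_mem_residueParts ha
      have h2 := (Multiset.mem_filter.mp ha).1
      exact (hρ.sub_mem a h2 (Nat.le_of_dvd (pos_of_mem_parts h2) h1)).1 h1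
  · refine barQuotient_eq (r := (residueParts p i ρ).card) hp hi (colLen_bot_le _) ?_
    rw [betaSet_bot]
    have h : runner p i ρ = Finset.range (residueParts p i ρ).card := by
      symm
      refine Finset.eq_of_subset_of_card_le (fun k hk => ?_) (by
        rw [Finset.card_range, card_runner hρ.1 hi hip])
      rw [mem_runner hp]
      exact hρ.mem_of_lt hi hip (Finset.mem_range.mp hk)
    rw [← h]
    exact residueParts_eq_runner hρ.1 hi hip

variable {d : ℕ}

/-- The weight of a partition is the size of its bar-quotient. -/
theorem sum_card_barQuotient (hodd : p = 2 * (p / 2) + 1) (hd : 1 ≤ d) (hρ : IsBarCore p ρ)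
    (hR : IsRouquier p d ρ) (h : SameRunners p ρ κ) : κ.card = ρ.card + p * d ↔
    (barQuotient p κ 0).card + ∑ i : Fin (p / 2), (barQuotient p κ (i + 1)).card = d := by
  have h1 := h.card_eq hodd
  have h2 := (hρ.sameRunners hodd hd hR).card_eq hodd
  have h3 : ∀ i : Fin (p / 2), (barQuotient p ρ (i + 1)).card = 0 := fun i => by
    rw [hρ.barQuotient_eq_bot (by omega) (by omega), card_bot]
  rw [hρ.barQuotient_eq_bot (by omega) (by omega), card_bot, Finset.sum_congr rfl fun i _ => h3 i,
    Finset.sum_const_zero, add_zero, mul_zero, zero_add] at h2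
  rw [h1, h2, add_comm, Nat.add_left_cancel_iff]
  exact Nat.mul_right_inj (by omega)

theorem isStrict_barQuotient_zero (hp : 0 < p) (h : IsStrict κ) :
    IsStrict (barQuotient p κ 0) := by
  rw [IsStrict, parts_barQuotient_zero hp]
  refine Multiset.Nodup.map_on ?_ (Multiset.Nodup.filter _ h)
  intro a ha b hb hab
  rw [← Nat.mul_div_cancel' (dvd_of_mem_residueParts ha),
    ← Nat.mul_div_cancel' (dvd_of_mem_residueParts hb), hab]

/-- Every sequence of partitions of total size `d` whose zeroth member is strict is the
bar-quotient of a strict partition in the block: by the Rouquier condition there are enough parts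
on each runner. -/
theorem exists_barQuotient_eq (hodd : p = 2 * (p / 2) + 1) (hd : 1 ≤ d) (hρ : IsBarCore p ρ)
    (hR : IsRouquier p d ρ) {α : YoungDiagram} (hα : IsStrict α) (β : Fin (p / 2) → YoungDiagram)
    (hsum : α.card + ∑ i, (β i).card = d) :
    ∃ κ ∈ strictPartitions p ρ d, barQuotient p κ 0 = α ∧
      ∀ i : Fin (p / 2), barQuotient p κ (i + 1) = β i := by
  have hp : 0 < p := by omega
  set r : Fin (p / 2) → ℕ := fun i => (residueParts p (i + 1) ρ).card with hr
  have hcol : ∀ i, (β i).colLen 0 ≤ r i := fun i => by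
    have h1 := Finset.single_le_sum (f := fun i => (β i).card) (fun _ _ => Nat.zero_le _)
      (Finset.mem_univ i)
    have h2 := hR.le_card (i := i + 1) (Nat.succ_pos _) i.2
    have h3 := colLen_le_card (β i)
    simp only [hr]
    omega
  -- the parts on the zeroth runner and on the `(i + 1)`-st runner
  set M0 : Multiset ℕ := (parts α).map fun b => p * b with hM0
  set Mi : Fin (p / 2) → Multiset ℕ := fun i =>
    (betaSet (r i) (β i)).val.map fun k => (i + 1) + p * k with hMi
  have hmod0 : ∀ a ∈ M0, a % p = 0 ∧ 0 < a := by
    intro a ha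
    obtain ⟨b, hb, rfl⟩ := Multiset.mem_map.mp ha
    exact ⟨Nat.mul_mod_right p b, Nat.mul_pos hp (pos_of_mem_parts hb)⟩
  have hmodi : ∀ i, ∀ a ∈ Mi i, a % p = i + 1 ∧ 0 < a := by
    intro i a ha
    obtain ⟨k, -, rfl⟩ := Multiset.mem_map.mp ha
    have := i.2
    exact ⟨by rw [Nat.add_mul_mod_self_left, Nat.mod_eq_of_lt (by omega)], by omega⟩
  have hnodup0 : M0.Nodup := Multiset.Nodup.map (fun a b h => Nat.eq_of_mul_eq_mul_left hp h) hα
  have hnodupi : ∀ i, (Mi i).Nodup := fun i => Multiset.Nodup.map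
    (fun k k' h => Nat.eq_of_mul_eq_mul_left hp (Nat.add_left_cancel h)) (Finset.nodup _)
  set κ := ofParts (M0 + ∑ i, Mi i) with hκ
  have hmem : ∀ a, a ∈ M0 + ∑ i, Mi i ↔ a ∈ M0 ∨ ∃ i, a ∈ Mi i := by
    intro a
    rw [Multiset.mem_add, Multiset.mem_sum]
    simp
  have hparts : parts κ = M0 + ∑ i, Mi i := by
    rw [hκ, parts_ofParts]
    refine Multiset.filter_eq_self.mpr fun a ha => ?_
    rcases (hmem a).mp ha with h | ⟨i, h⟩
    · exact (hmod0 a h).2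
    · exact (hmodi i a h).2
  have hcount0 : ∀ a, a % p ≠ 0 → M0.count a = 0 := fun a ha =>
    Multiset.count_eq_zero.mpr fun h => ha (hmod0 a h).1
  have hcounti : ∀ (i : Fin (p / 2)) (a : ℕ), a % p ≠ i + 1 → (Mi i).count a = 0 := fun i a ha =>
    Multiset.count_eq_zero.mpr fun h => ha (hmodi i a h).1
  have hres0 : residueParts p 0 κ = M0 := by
    refine Multiset.ext.mpr fun a => ?_
    rw [residueParts, Multiset.count_filter, hparts, Multiset.count_add, Multiset.count_sum']
    split_ifs with h
    · have h' : a % p = 0 % p := h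
      rw [Nat.zero_mod] at h'
      rw [Finset.sum_eq_zero fun i _ => hcounti i a (by omega), add_zero]
    · refine (hcount0 a fun h' => h ?_).symm
      rw [Nat.ModEq, h', Nat.zero_mod]
  have hresi : ∀ i : Fin (p / 2), residueParts p (i + 1) κ = Mi i := by
    intro i
    have hi := i.2
    refine Multiset.ext.mpr fun a => ?_
    rw [residueParts, Multiset.count_filter, hparts, Multiset.count_add, Multiset.count_sum']
    split_ifs with h
    · have h' : a % p = (i + 1) % p := h
      rw [Nat.mod_eq_of_lt (show (i : ℕ) + 1 < p by omega)] at h'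
      rw [hcount0 a (by omega), zero_add, Finset.sum_eq_single i]
      · exact fun j _ hj => hcounti j a fun hc => hj (Fin.ext (by omega))
      · exact fun h => absurd (Finset.mem_univ _) h
    · refine (hcounti i a fun h' => h ?_).symm
      rw [Nat.ModEq, h', Nat.mod_eq_of_lt (by omega)]
  have hle : ∀ a ∈ parts κ, a % p ≤ p / 2 := by
    intro a ha
    rw [hparts] at ha
    rcases (hmem a).mp ha with h | ⟨i, h⟩
    · rw [(hmod0 a h).1]
      exact Nat.zero_le _
    · rw [(hmodi i a h).1]
      exact i.2
  have hstrict : IsStrict κ := by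
    rw [IsStrict, Multiset.nodup_iff_count_le_one]
    intro a
    rw [hparts, Multiset.count_add, Multiset.count_sum']
    have h0 := Multiset.nodup_iff_count_le_one.mp hnodup0 a
    by_cases ha : ∃ i : Fin (p / 2), a % p = i + 1
    · obtain ⟨i, hi⟩ := ha
      rw [hcount0 a (by omega), zero_add, Finset.sum_eq_single i]
      · exact Multiset.nodup_iff_count_le_one.mp (hnodupi i) a
      · exact fun j _ hj => hcounti j a fun hc => hj (Fin.ext (by omega))
      · exact fun h => absurd (Finset.mem_univ _) h
    · push Not at ha
      rwa [Finset.sum_eq_zero fun i _ => hcounti i a (ha i), add_zero]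
  have hq0 : barQuotient p κ 0 = α := barQuotient_zero_eq hp hres0
  have hqi : ∀ i : Fin (p / 2), barQuotient p κ (i + 1) = β i := fun i =>
    barQuotient_eq hp (Nat.succ_pos _) (hcol i) (hresi i)
  have hsame : SameRunners p ρ κ := by
    refine ⟨isPStrict_iff.mpr fun a _ => Multiset.nodup_iff_count_le_one.mp hstrict a, hle, ?_⟩
    intro i hi hip
    have h1 := hresi ⟨i - 1, by omega⟩
    have h2 : i - 1 + 1 = i := by omega
    simp only [hMi, hr, h2] at h1
    rw [h1, Multiset.card_map, ← Finset.card_def, card_betaSet]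
  refine ⟨κ, ⟨(mem_pStrictPartitions_iff hodd hd hρ hR).mpr ⟨hsame, ?_⟩, hstrict⟩, hq0, hqi⟩
  rw [sum_card_barQuotient hodd hd hρ hR hsame, hq0]
  simp only [hqi]
  exact hsum

theorem rowLen_le_card (η : YoungDiagram) (i : ℕ) : η.rowLen i ≤ η.card := by
  rcases Nat.eq_zero_or_pos (η.rowLen i) with h | h
  · omega
  · have hi : i < η.colLen 0 := by
      by_contra hc
      have := rowLen_eq_zero_iff.mpr (not_lt.mp hc)
      omega
    rw [card_eq_sum_rowLen (le_refl (η.colLen 0))]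
    exact Finset.single_le_sum (f := fun j : Fin (η.colLen 0) => η.rowLen j)
      (fun _ _ => Nat.zero_le _) (Finset.mem_univ ⟨i, hi⟩)

/-- The last component of the bar-quotient of a restricted partition is empty: if it is not, then
there is a part `(g + 1)p + ℓ` such that `gp + ℓ` is not a part, and being restricted provides a
part `(g + 1)p + j` with `j < ℓ`. By the Rouquier condition, the weights of the runners `ℓ` and `j`
then add up to more than `d`. -/
theorem barQuotient_eq_bot_of_restricted (hodd : p = 2 * (p / 2) + 1) (hp2 : 0 < p / 2)
    (hd : 1 ≤ d) (hρ : IsBarCore p ρ) (hR : IsRouquier p d ρ)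
    (hκ : κ ∈ restrictedPartitions p ρ d) : barQuotient p κ (p / 2) = ⊥ := by
  obtain ⟨hκ1, hres⟩ := hκ
  obtain ⟨hsame, hcard⟩ := (mem_pStrictPartitions_iff hodd hd hρ hR).mp hκ1
  have hwt := (sum_card_barQuotient hodd hd hρ hR hsame).mp hcard
  set ℓ := p / 2 with hℓ
  by_contra hne
  obtain ⟨hcol, hbeta⟩ := residueParts_eq hsame.1 hp2 (by omega)
  rw [hsame.2.2 ℓ hp2 le_rfl] at hcol hbeta
  have hrun := residueParts_eq_runner hsame.1 hp2 (show ℓ < p by omega)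
  have hinj : Function.Injective fun k => ℓ + p * k := fun k k' h =>
    Nat.eq_of_mul_eq_mul_left (by omega : 0 < p) (Nat.add_left_cancel h)
  have hB : runner p ℓ κ = betaSet (residueParts p ℓ ρ).card (barQuotient p κ ℓ) := by
    rw [hbeta] at hrun
    exact Finset.val_injective (Multiset.map_injective hinj hrun).symm
  set η := barQuotient p κ ℓ with hη
  set r := (residueParts p ℓ ρ).card with hr
  set h := η.colLen 0 with hh
  have hh0 : 0 < h := by
    by_contra hc
    refine hne (youngDiagram_ext_rowLen fun i => ?_)
    rw [rowLen_bot, rowLen_eq_zero_iff]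
    omega
  have hrow : 0 < η.rowLen (h - 1) := by
    by_contra hc
    have := rowLen_eq_zero_iff.mp (show η.rowLen (h - 1) = 0 by omega)
    omega
  -- the lowest part on the runner which is not in its lowest position
  set g := η.rowLen (h - 1) + (r - h) - 1 with hg
  have hmem : g + 1 ∈ runner p ℓ κ := by
    rw [hB]
    refine Finset.mem_image.mpr ⟨⟨h - 1, by omega⟩, Finset.mem_univ _, ?_⟩
    simp only
    omega
  have hnot : g ∉ runner p ℓ κ := by
    rw [hB]
    intro hc
    obtain ⟨j, -, hj⟩ := Finset.mem_image.mp hc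
    have hj2 := j.2
    rcases lt_or_ge (j : ℕ) h with hjh | hjh
    · have := η.rowLen_anti j (h - 1) (by omega)
      omega
    · have := rowLen_eq_zero_iff.mpr hjh
      omega
  rw [mem_runner (by omega)] at hmem hnot
  set a := ℓ + p * (g + 1) with ha
  have hag : a = ℓ + p * g + p := by
    rw [ha]
    ring
  -- the last row of length `a`
  obtain ⟨s, hs1, hs2⟩ : ∃ s, κ.rowLen s = a ∧ κ.rowLen (s + 1) < a := by
    have hex : ∃ s, κ.rowLen s < a :=
      ⟨κ.colLen 0, by rw [rowLen_eq_zero_iff.mpr le_rfl]; omega⟩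
    classical
    have hf := Nat.find_spec hex
    obtain ⟨t, ht⟩ : ∃ t, κ.rowLen t = a := by
      have : a ∈ κ.rowLens := by simpa [parts] using hmem
      rw [YoungDiagram.rowLens, List.mem_map] at this
      obtain ⟨t, -, ht⟩ := this
      exact ⟨t, ht⟩
    have htf : t < Nat.find hex := by
      by_contra hc
      have := κ.rowLen_anti _ _ (not_lt.mp hc)
      omega
    have hmin := Nat.find_min hex (show Nat.find hex - 1 < Nat.find hex by omega)
    have hle := κ.rowLen_anti t (Nat.find hex - 1) (by omega)
    refine ⟨Nat.find hex - 1, by omega, ?_⟩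
    rwa [Nat.sub_add_cancel (by omega)]
  set b := κ.rowLen (s + 1) with hb
  have hbparts : 0 < b → b ∈ parts κ := by
    intro hb0
    have h1 : s + 1 < κ.colLen 0 := by
      by_contra hc
      have := rowLen_eq_zero_iff.mpr (not_lt.mp hc)
      omega
    rw [parts, Multiset.mem_coe, YoungDiagram.rowLens, List.mem_map]
    exact ⟨s + 1, List.mem_range.mpr h1, rfl⟩
  have hbne : b ≠ ℓ + p * g := fun hc => hnot (hc ▸ hbparts (by omega))
  -- `κ` being restricted, the next row is longer than `a - p`
  have hblt : ℓ + p * g < b := by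
    have := hres s
    omega
  have hbmem := hbparts (by omega)
  have hbmod := hsame.2.1 b hbmem
  have hbdiv : b / p = g + 1 := by
    have h1 := Nat.mod_add_div b p
    have h2 : p * g < p * (b / p + 1) := by rw [mul_add]; omega
    have h3 : p * (b / p) < p * (g + 2) := by rw [mul_add]; omega
    have h4 := Nat.lt_of_mul_lt_mul_left h2
    have h5 := Nat.lt_of_mul_lt_mul_left h3
    have h6 : b / p ≠ g := fun hc => by
      rw [hc] at h1
      omega
    omega
  have hbeq := Nat.mod_add_div b p
  rw [hbdiv] at hbeq
  set j := b % p with hj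
  have hjl : j < ℓ := by omega
  have hηcard : h ≤ η.card := colLen_le_card η
  have hηle : η.card ≤ ∑ i : Fin ℓ, (barQuotient p κ (i + 1)).card := by
    have h1 := Finset.single_le_sum (f := fun i : Fin ℓ => (barQuotient p κ (i + 1)).card)
      (fun _ _ => Nat.zero_le _) (Finset.mem_univ (⟨ℓ - 1, by omega⟩ : Fin ℓ))
    simp only [Nat.sub_add_cancel hp2] at h1
    exact h1
  -- if `j = 0`, the part `b = p(g + 1)` and the weight of `η` add up to more than `d`
  rcases Nat.eq_zero_or_pos j with hj0 | hj0
  · have h1 : g + 1 ∈ parts (barQuotient p κ 0) := by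
      rw [parts_barQuotient_zero (by omega)]
      exact Multiset.mem_map.mpr ⟨b, Multiset.mem_filter.mpr ⟨hbmem, by
        rw [Nat.ModEq, ← hj, hj0, Nat.zero_mod]⟩, hbdiv⟩
    have h2 := Multiset.single_le_sum (fun _ _ => Nat.zero_le _) _ h1
    rw [sum_parts] at h2
    have h3 := hR.le_card hp2 le_rfl
    omega
  · obtain ⟨hcol', hbeta'⟩ := residueParts_eq hsame.1 hj0 (show j < p by omega)
    rw [hsame.2.2 j hj0 hjl.le] at hcol' hbeta'
    have h1 : b ∈ residueParts p j κ := Multiset.mem_filter.mpr ⟨hbmem, (Nat.mod_modEq b p).symm⟩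
    rw [hbeta'] at h1
    obtain ⟨k, hk, hkb⟩ := Multiset.mem_map.mp h1
    have h2 : k = g + 1 := Nat.eq_of_mul_eq_mul_left (by omega : 0 < p)
      (Nat.add_left_cancel (hkb.trans hbeq.symm))
    obtain ⟨t, -, ht⟩ := Finset.mem_image.mp (Finset.mem_val.mp hk)
    have h3 := rowLen_le_card (barQuotient p κ j) t
    have h4 : ∀ n, j + n ≤ ℓ → 0 < n → (residueParts p j ρ).card + d - 1 ≤
        (residueParts p (j + n) ρ).card := by
      intro n
      induction n with
      | zero => intro _ h; omega
      | succ n ih =>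
        intro hn _
        have h5 := hR.2 (j + (n + 1)) (by omega) hn
        rw [show j + (n + 1) - 1 = j + n by omega] at h5
        rcases Nat.eq_zero_or_pos n with rfl | hn0
        · exact h5
        · have := ih (by omega) hn0
          omega
    have h5 := h4 (ℓ - j) (by omega) (by omega)
    rw [Nat.add_sub_cancel' hjl.le] at h5
    have h6 : η.card + (barQuotient p κ j).card ≤
        ∑ i : Fin ℓ, (barQuotient p κ (i + 1)).card := by
      have hne' : (⟨ℓ - 1, by omega⟩ : Fin ℓ) ≠ ⟨j - 1, by omega⟩ := by
        rw [Ne, Fin.mk.injEq]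
        omega
      have h7 := Finset.sum_le_sum_of_subset (f := fun i : Fin ℓ => (barQuotient p κ (i + 1)).card)
        (Finset.subset_univ {(⟨ℓ - 1, by omega⟩ : Fin ℓ), ⟨j - 1, by omega⟩})
      rw [Finset.sum_pair hne'] at h7
      simp only [Nat.sub_add_cancel hp2, Nat.sub_add_cancel hj0] at h7
      exact h7
    have ht2 := t.2
    omega

end Quotients

/-! ### Sums over families of partitions -/

section Families

variable {n d : ℕ}

/-- The families of partitions of size at most `d`. -/
noncomputable def families (n d : ℕ) : Finset (Fin n → YoungDiagram) :=
  Fintype.piFinset fun _ => partitionsLE d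

theorem mem_families {f : Fin n → YoungDiagram} : f ∈ families n d ↔ ∀ i, (f i).card ≤ d := by
  simp [families]

/-- The quadruples of families of partitions of size at most `d`. -/
noncomputable def quadFamilies (n d : ℕ) : Finset ((Fin n → YoungDiagram) × (Fin n → YoungDiagram) ×
    (Fin n → YoungDiagram) × (Fin n → YoungDiagram)) :=
  families n d ×ˢ families n d ×ˢ families n d ×ˢ families n d

theorem prod_sum_families
    (f : Fin n → YoungDiagram → YoungDiagram → YoungDiagram → YoungDiagram → ℤ) :
    ∏ i, ∑ a ∈ partitionsLE d, ∑ b ∈ partitionsLE d, ∑ c ∈ partitionsLE d, ∑ e ∈ partitionsLE d,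
      f i a b c e = ∑ x ∈ quadFamilies n d,
        ∏ i, f i (x.1 i) (x.2.1 i) (x.2.2.1 i) (x.2.2.2 i) := by
  simp only [quadFamilies, families, Finset.prod_univ_sum, Finset.sum_product]

theorem sum_families_cons (G : (Fin (n + 1) → YoungDiagram) → ℤ) :
    ∑ f ∈ families (n + 1) d, G f =
      ∑ a ∈ partitionsLE d, ∑ f ∈ families n d, G (Fin.cons a f) := by
  rw [← Finset.sum_product']
  refine Finset.sum_bij' (fun f _ => (f 0, fun i => f i.succ))
    (fun x _ => (Fin.cons x.1 x.2 : Fin (n + 1) → YoungDiagram)) ?_ ?_ ?_ ?_ ?_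
  · intro f hf
    rw [mem_families] at hf
    rw [Finset.mem_product, mem_partitionsLE, mem_families]
    exact ⟨hf 0, fun i => hf i.succ⟩
  · intro x hx
    rw [Finset.mem_product, mem_partitionsLE, mem_families] at hx
    rw [mem_families]
    intro i
    refine Fin.cases ?_ (fun i => ?_) i
    · rw [Fin.cons_zero]
      exact hx.1
    · rw [Fin.cons_succ]
      exact hx.2 i
  · exact fun f _ => Fin.cons_self_tail f
  · intro x _
    simp
  · intro f _
    congr 1
    exact (Fin.cons_self_tail f).symm

theorem sum_families_snoc (G : (Fin (n + 1) → YoungDiagram) → ℤ) :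
    ∑ f ∈ families (n + 1) d, G f =
      ∑ f ∈ families n d, ∑ a ∈ partitionsLE d, G (Fin.snoc f a) := by
  rw [← Finset.sum_product']
  refine Finset.sum_bij' (fun f _ => (fun i => f i.castSucc, f (Fin.last n)))
    (fun x _ => (Fin.snoc x.1 x.2 : Fin (n + 1) → YoungDiagram)) ?_ ?_ ?_ ?_ ?_
  · intro f hf
    rw [mem_families] at hf
    rw [Finset.mem_product, mem_partitionsLE, mem_families]
    exact ⟨fun i => hf i.castSucc, hf _⟩
  · intro x hx
    rw [Finset.mem_product, mem_partitionsLE, mem_families] at hx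
    rw [mem_families]
    intro i
    refine Fin.lastCases ?_ (fun i => ?_) i
    · rw [Fin.snoc_last]
      exact hx.2
    · rw [Fin.snoc_castSucc]
      exact hx.1 i
  · exact fun f _ => Fin.snoc_init_self f
  · intro x _
    simp
  · intro f _
    congr 1
    exact (Fin.snoc_init_self f).symm

theorem ext_coe (f : Fin n → YoungDiagram) (i : Fin n) : ext f i = f i := by
  rw [ext, dif_pos i.2]

theorem ext_of_le (f : Fin n → YoungDiagram) {i : ℕ} (h : n ≤ i) : ext f i = ⊥ :=
  dif_neg (not_lt.mpr h)

theorem card_ext_le {f : Fin n → YoungDiagram} (hf : f ∈ families n d) (i : ℕ) :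
    (ext f i).card ≤ d := by
  rw [ext]
  split_ifs with h
  · exact mem_families.mp hf _
  · rw [card_bot]
    exact Nat.zero_le _

/-- The coefficient of `s_σ(x) s_τ(y)` in the Cauchy identity for Schur P-functions. -/
noncomputable def strictPairing (d : ℕ) (σ τ : YoungDiagram) : ℤ :=
  ∑ a ∈ partitionsLE d, ∑ b ∈ partitionsLE d, lr σ {a.transpose, b} * lr τ {a, b}

/-- The scalar product of `s_σ s_τ` and `s_σ' s_τ'`. -/
noncomputable def schurPairing (d : ℕ) (σ τ σ' τ' : YoungDiagram) : ℤ :=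
  ∑ a ∈ partitionsLE d, ∑ b ∈ partitionsLE d, ∑ c ∈ partitionsLE d, ∑ e ∈ partitionsLE d,
    lr σ {a, b} * lr τ {c, e} * lr σ' {a, c} * lr τ' {b, e}

theorem sum_partitionsLE_transpose (f : YoungDiagram → ℤ) :
    ∑ a ∈ partitionsLE d, f a.transpose = ∑ a ∈ partitionsLE d, f a := by
  refine Finset.sum_bij' (fun a _ => a.transpose) (fun a _ => a.transpose) ?_ ?_ ?_ ?_ ?_
  · intro a ha
    rwa [mem_partitionsLE, card_transpose, ← mem_partitionsLE]
  · intro a ha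
    rwa [mem_partitionsLE, card_transpose, ← mem_partitionsLE]
  · exact fun a _ => a.transpose_transpose
  · exact fun a _ => a.transpose_transpose
  · exact fun _ _ => rfl

theorem schurPairing_bot (τ τ' : YoungDiagram) :
    schurPairing d ⊥ τ ⊥ τ' = ∑ e ∈ partitionsLE d, lr τ {⊥, e} * lr τ' {⊥, e} := by
  have hzero : ∀ a b : YoungDiagram, a ≠ ⊥ ∨ b ≠ ⊥ → lr ⊥ {a, b} = 0 := by
    intro a b hab
    by_contra h
    have h1 := card_eq_of_lr_pair_ne_zero h
    rw [card_bot] at h1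
    rcases hab with h2 | h2
    · exact h2 (card_eq_zero_iff.mp (by omega))
    · exact h2 (card_eq_zero_iff.mp (by omega))
  have hone : lr ⊥ {⊥, ⊥} = 1 := by rw [lr_bot_left, if_pos rfl]
  have hbot : (⊥ : YoungDiagram) ∈ partitionsLE d := by
    rw [mem_partitionsLE, card_bot]
    exact Nat.zero_le _
  rw [schurPairing, Finset.sum_eq_single ⊥, Finset.sum_eq_single ⊥, Finset.sum_eq_single ⊥]
  · exact Finset.sum_congr rfl fun e _ => by rw [hone]; ring
  · intro c _ hc
    refine Finset.sum_eq_zero fun e _ => ?_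
    rw [hzero ⊥ c (Or.inr hc)]
    ring
  · exact fun h => absurd hbot h
  · intro b _ hb
    refine Finset.sum_eq_zero fun c _ => Finset.sum_eq_zero fun e _ => ?_
    rw [hzero ⊥ b (Or.inr hb)]
    ring
  · exact fun h => absurd hbot h
  · intro a _ ha
    refine Finset.sum_eq_zero fun b _ => Finset.sum_eq_zero fun c _ =>
      Finset.sum_eq_zero fun e _ => ?_
    rw [hzero a b (Or.inl ha)]
    ring
  · exact fun h => absurd hbot h

theorem schurPairing_eq (σ τ σ' τ' : YoungDiagram) :
    ∑ φ ∈ partitionsLE d, ∑ ψ ∈ partitionsLE d, ∑ χ ∈ partitionsLE d, ∑ ω ∈ partitionsLE d,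
      lr σ {φ, χ} * lr σ' {φ, ψ} * (lr τ {ψ, ω.transpose} * lr τ' {χ, ω.transpose}) =
      schurPairing d σ τ σ' τ' := by
  rw [schurPairing]
  refine Finset.sum_congr rfl fun φ _ => ?_
  rw [Finset.sum_comm]
  refine Finset.sum_congr rfl fun χ _ => Finset.sum_congr rfl fun ψ _ => ?_
  rw [sum_partitionsLE_transpose fun e => lr σ {φ, χ} * lr σ' {φ, ψ} *
    (lr τ {ψ, e} * lr τ' {χ, e})]
  refine Finset.sum_congr rfl fun e _ => ?_
  ring

theorem strictPairing_eq [DecidableEq YoungDiagram] (σ σ' : YoungDiagram) :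
    ∑ φ ∈ partitionsLE d, ∑ ψ ∈ partitionsLE d, ∑ χ ∈ partitionsLE d,
      (if χ = ψ.transpose then lr σ {φ, χ} * lr σ' {φ, ψ} else 0) = strictPairing d σ σ' := by
  rw [strictPairing, Finset.sum_comm]
  refine Finset.sum_congr rfl fun ψ hψ => Finset.sum_congr rfl fun φ _ => ?_
  rw [Finset.sum_ite_eq', if_pos, lr_pair_comm σ, lr_pair_comm σ']
  rwa [mem_partitionsLE, card_transpose, ← mem_partitionsLE]

/-- The sum over the quadruples `φ, ψ, χ, ω` factors over the indices: `φ, χ, ψ` at `i + 1` and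
`ω` at `i` occur together, while `φ, ψ` and `χ = ψ'` at `0` make up a factor of their own. -/
theorem sum_quadFamilies_eq [DecidableEq YoungDiagram] {k : ℕ}
    (σ σ' τ τ' : Fin (k + 1) → YoungDiagram) :
    ∑ x ∈ (quadFamilies (k + 1) d).filter fun x => x.2.2.1 0 = (x.2.1 0).transpose,
      ∏ i, (lr (σ i) {x.1 i, x.2.2.1 i} * lr (σ' i) {x.1 i, x.2.1 i} *
        (lr (τ i) {ext x.2.1 (i + 1), (x.2.2.2 i).transpose} *
          lr (τ' i) {ext x.2.2.1 (i + 1), (x.2.2.2 i).transpose})) =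
      strictPairing d (σ 0) (σ' 0) *
        ∏ i : Fin (k + 1), schurPairing d (ext σ (i + 1)) (τ i) (ext σ' (i + 1)) (τ' i) := by
  have hext : ∀ (f : Fin (k + 1) → YoungDiagram) (i : Fin k),
      ext f ((i.castSucc : Fin (k + 1)) + 1 : ℕ) = f i.succ := fun f i => ext_coe f i.succ
  have hlast : ∀ f : Fin (k + 1) → YoungDiagram, ext f ((Fin.last k : Fin (k + 1)) + 1 : ℕ) = ⊥ :=
    fun f => ext_of_le f le_rfl
  set U : YoungDiagram → YoungDiagram → YoungDiagram → ℤ := fun a b c =>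
    if c = b.transpose then lr (σ 0) {a, c} * lr (σ' 0) {a, b} else 0 with hU
  set f : Fin k → YoungDiagram → YoungDiagram → YoungDiagram → YoungDiagram → ℤ :=
    fun i φ ψ χ ω => lr (σ i.succ) {φ, χ} * lr (σ' i.succ) {φ, ψ} *
      (lr (τ i.castSucc) {ψ, ω.transpose} * lr (τ' i.castSucc) {χ, ω.transpose}) with hf
  set E : ℤ := ∑ e ∈ partitionsLE d, lr (τ (Fin.last k)) {⊥, e.transpose} *
    lr (τ' (Fin.last k)) {⊥, e.transpose} with hE
  have hterm : ∀ (a b c : YoungDiagram) (φ ψ χ : Fin k → YoungDiagram),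
      (∑ ω ∈ families k d, ∑ e ∈ partitionsLE d,
        if c = b.transpose then ∏ i : Fin (k + 1),
          (lr (σ i) {(Fin.cons a φ : Fin (k + 1) → YoungDiagram) i,
              (Fin.cons c χ : Fin (k + 1) → YoungDiagram) i} *
            lr (σ' i) {(Fin.cons a φ : Fin (k + 1) → YoungDiagram) i,
              (Fin.cons b ψ : Fin (k + 1) → YoungDiagram) i} *
            (lr (τ i) {ext (Fin.cons b ψ : Fin (k + 1) → YoungDiagram) (i + 1),
              ((Fin.snoc ω e : Fin (k + 1) → YoungDiagram) i).transpose} *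
            lr (τ' i) {ext (Fin.cons c χ : Fin (k + 1) → YoungDiagram) (i + 1),
              ((Fin.snoc ω e : Fin (k + 1) → YoungDiagram) i).transpose})) else 0) =
      U a b c * ((∑ ω ∈ families k d, ∏ i, f i (φ i) (ψ i) (χ i) (ω i)) * E) := by
    intro a b c φ ψ χ
    rw [hE, Finset.sum_mul_sum, Finset.mul_sum]
    refine Finset.sum_congr rfl fun ω _ => ?_
    rw [Finset.mul_sum]
    refine Finset.sum_congr rfl fun e _ => ?_
    simp only [hU]
    split_ifs with h
    · rw [Finset.prod_mul_distrib, Fin.prod_univ_succ, Fin.prod_univ_castSucc]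
      simp only [hext, hlast, Fin.cons_zero, Fin.cons_succ, Fin.snoc_castSucc, Fin.snoc_last]
      simp only [hf, Finset.prod_mul_distrib]
      ring
    · rw [zero_mul]
  have hB : ∏ i : Fin (k + 1), schurPairing d (ext σ (i + 1)) (τ i) (ext σ' (i + 1)) (τ' i) =
      (∑ φ ∈ families k d, ∑ ψ ∈ families k d, ∑ χ ∈ families k d, ∑ ω ∈ families k d,
        ∏ i, f i (φ i) (ψ i) (χ i) (ω i)) * E := by
    rw [Fin.prod_univ_castSucc]
    simp only [hext, hlast]
    rw [schurPairing_bot, ← sum_partitionsLE_transpose]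
    congr 1
    simp only [← schurPairing_eq]
    rw [prod_sum_families, quadFamilies]
    simp only [Finset.sum_product]
    rfl
  rw [hB, ← strictPairing_eq, Finset.sum_filter, quadFamilies]
  simp only [Finset.sum_product]
  rw [Finset.sum_congr rfl fun φ _ => Finset.sum_congr rfl fun ψ _ => Finset.sum_congr rfl
    fun χ _ => sum_families_snoc _]
  simp only [sum_families_cons (n := k), Fin.cons_zero]
  simp only [hterm]
  simp only [← Finset.sum_mul_sum, ← Finset.sum_mul]
  rfl

end Families

/-! ### The decomposition sums -/

section Decomposition

variable {n d : ℕ}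

theorem lr_four_eq {κ φ χ ψ ω : YoungDiagram} (hκ : κ.card ≤ d) :
    lr κ {φ, χ, ψ.transpose, ω} = ∑ s ∈ partitionsLE d, ∑ t ∈ partitionsLE d,
      lr κ {s, t.transpose} * lr s {φ, χ} * lr t {ψ, ω.transpose} := by
  have hM : ({φ, χ, ψ.transpose, ω} : Multiset YoungDiagram) = {φ, χ} + {ψ.transpose, ω} := rfl
  have ht : ∀ t, lr t {ψ, ω.transpose} = lr t.transpose {ψ.transpose, ω} := fun t => by
    rw [← lr_transpose t, YoungDiagram.transpose_transpose]
  by_cases hsize : φ.card + χ.card + ψ.card + ω.card = κ.card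
  · rw [hM, lr_add κ {φ, χ} {ψ.transpose, ω} (m := d)
      (by simp [totalSize, card_transpose]; omega)]
    refine Finset.sum_congr rfl fun s _ => ?_
    rw [← sum_partitionsLE_transpose]
    exact Finset.sum_congr rfl fun t _ => by rw [ht]
  · have h0 : lr κ {φ, χ, ψ.transpose, ω} = 0 := by
      by_contra h
      have := card_eq_of_lr_ne_zero h
      rw [hM] at this
      simp [totalSize, card_transpose] at this
      omega
    rw [h0]
    symm
    refine Finset.sum_eq_zero fun s _ => Finset.sum_eq_zero fun t _ => ?_
    by_contra h
    have h1 := card_eq_of_lr_pair_ne_zero (left_ne_zero_of_mul (left_ne_zero_of_mul h))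
    have h2 := card_eq_of_lr_pair_ne_zero (right_ne_zero_of_mul (left_ne_zero_of_mul h))
    have h3 := card_eq_of_lr_pair_ne_zero (right_ne_zero_of_mul h)
    rw [card_transpose] at h1 h3
    omega

/-- The term of the decomposition sum of `λ` and `μ` at `σ, τ`, in terms of the zeroth component
`α` and the further components `β` of the bar-quotient of `λ`, and the bar-quotient `m` of `μ`. -/
noncomputable def decompTerm (α : YoungDiagram) (β m σ τ : Fin n → YoungDiagram) : ℤ :=
  (invKostka α (ext σ 0)).eval (-1) *
    ∏ i : Fin n, (lr (β i) {ext σ (i + 1), τ i} * lr (m i) {σ i, (τ i).transpose})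

theorem mem_families_of_decompTerm_ne_zero {α : YoungDiagram} {β m σ τ : Fin n → YoungDiagram}
    (hm : ∀ i, (m i).card ≤ d) (h : decompTerm α β m σ τ ≠ 0) :
    σ ∈ families n d ∧ τ ∈ families n d := by
  have h1 : ∀ i, (m i).card = (σ i).card + (τ i).card := fun i => by
    have h2 := Finset.prod_ne_zero_iff.mp (right_ne_zero_of_mul h) i (Finset.mem_univ i)
    have h3 := card_eq_of_lr_pair_ne_zero (right_ne_zero_of_mul h2)
    rwa [card_transpose] at h3
  constructor <;>
  · rw [mem_families]
    intro i
    have := h1 i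
    have := hm i
    omega

theorem card_add_sum_card_of_decompTerm_ne_zero {α : YoungDiagram}
    {β m σ τ : Fin n → YoungDiagram} (h : decompTerm α β m σ τ ≠ 0) :
    α.card + ∑ i, (β i).card = ∑ i, (m i).card := by
  have hprod := Finset.prod_ne_zero_iff.mp (right_ne_zero_of_mul h)
  have h0 : (ext σ 0).card = α.card := card_eq_of_invKostka_ne_zero fun h0 => by
    refine left_ne_zero_of_mul h ?_
    rw [h0, Polynomial.eval_zero]
  have h1 : ∀ i, (β i).card = (ext σ (i + 1)).card + (τ i).card := fun i =>
    card_eq_of_lr_pair_ne_zero (left_ne_zero_of_mul (hprod i (Finset.mem_univ i)))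
  have h2 : ∀ i : Fin n, (m i).card = (ext σ i).card + (τ i).card := fun i => by
    have h3 := card_eq_of_lr_pair_ne_zero (right_ne_zero_of_mul (hprod i (Finset.mem_univ i)))
    rwa [card_transpose, ← ext_coe σ i] at h3
  rw [Finset.sum_congr rfl fun i _ => h1 i, Finset.sum_congr rfl fun i _ => h2 i,
    Finset.sum_add_distrib, Finset.sum_add_distrib, ← add_assoc, ← h0,
    Fin.sum_univ_eq_sum_range (fun i => (ext σ (i + 1)).card) n,
    Fin.sum_univ_eq_sum_range (fun i => (ext σ i).card) n]
  congr 1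
  have h4 := Finset.sum_range_succ (fun i => (ext σ i).card) n
  rw [Finset.sum_range_succ', ext_of_le σ le_rfl, card_bot] at h4
  omega

theorem finsum_decompTerm {α : YoungDiagram} {β m : Fin n → YoungDiagram}
    (hm : ∀ i, (m i).card ≤ d) :
    ∑ᶠ στ : (Fin n → YoungDiagram) × (Fin n → YoungDiagram), decompTerm α β m στ.1 στ.2 =
      ∑ σ ∈ families n d, ∑ τ ∈ families n d, decompTerm α β m σ τ := by
  rw [← Finset.sum_product']
  refine finsum_eq_sum_of_support_subset _ fun στ h => ?_
  rw [Finset.mem_coe, Finset.mem_product]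
  exact mem_families_of_decompTerm_ne_zero hm h

/-- The common value of both sides of the theorem: summing over `λ` first, the sums over the
components of the bar-quotient of `λ` become the pairings. -/
noncomputable def pairingSum (d : ℕ) (m m' : Fin n → YoungDiagram) : ℤ :=
  ∑ x ∈ quadFamilies n d, (∏ i, (lr (m i) {x.1 i, (x.2.2.1 i).transpose} *
      lr (m' i) {x.2.1 i, (x.2.2.2 i).transpose})) *
    (strictPairing d (ext x.1 0) (ext x.2.1 0) *
      ∏ i : Fin n, schurPairing d (ext x.1 (i + 1)) (x.2.2.1 i) (ext x.2.1 (i + 1)) (x.2.2.2 i))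

theorem sum_decompTerm_mul [DecidablePred IsStrict] (m m' : Fin n → YoungDiagram) :
    ∑ α ∈ (partitionsLE (2 * d)).filter IsStrict, ∑ β ∈ families n (2 * d),
      2 ^ height α * (∑ σ ∈ families n d, ∑ τ ∈ families n d, decompTerm α β m σ τ) *
        (∑ σ ∈ families n d, ∑ τ ∈ families n d, decompTerm α β m' σ τ) =
      pairingSum d m m' := by
  have h1 : ∀ (α : YoungDiagram) (β : Fin n → YoungDiagram),
      2 ^ height α * (∑ σ ∈ families n d, ∑ τ ∈ families n d, decompTerm α β m σ τ) *
        (∑ σ ∈ families n d, ∑ τ ∈ families n d, decompTerm α β m' σ τ) =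
      ∑ x ∈ quadFamilies n d, (∏ i, (lr (m i) {x.1 i, (x.2.2.1 i).transpose} *
        lr (m' i) {x.2.1 i, (x.2.2.2 i).transpose})) *
        ((2 ^ height α * (invKostka α (ext x.1 0)).eval (-1) *
          (invKostka α (ext x.2.1 0)).eval (-1)) *
        ∏ i : Fin n, (lr (β i) {ext x.1 (i + 1), x.2.2.1 i} *
          lr (β i) {ext x.2.1 (i + 1), x.2.2.2 i})) := by
    intro α β
    rw [mul_assoc, Finset.sum_mul_sum, Finset.mul_sum, quadFamilies]
    simp only [Finset.sum_product]
    refine Finset.sum_congr rfl fun σ _ => ?_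
    rw [Finset.mul_sum]
    refine Finset.sum_congr rfl fun σ' _ => ?_
    rw [Finset.sum_mul_sum, Finset.mul_sum]
    refine Finset.sum_congr rfl fun τ _ => ?_
    rw [Finset.mul_sum]
    refine Finset.sum_congr rfl fun τ' _ => ?_
    rw [decompTerm, decompTerm]
    simp only [Finset.prod_mul_distrib]
    ring
  simp only [h1]
  rw [Finset.sum_congr rfl fun α _ => Finset.sum_comm, Finset.sum_comm, pairingSum]
  refine Finset.sum_congr rfl fun x hx => ?_
  simp only [quadFamilies, Finset.mem_product] at hx
  obtain ⟨hσ, hσ', hτ, hτ'⟩ := hx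
  simp only [← Finset.mul_sum]
  rw [← Finset.sum_mul]
  congr 2
  · exact sum_strict_invKostka (card_ext_le hσ 0) (card_ext_le hσ' 0) (by omega)
  · rw [families, ← Finset.prod_univ_sum (fun _ => partitionsLE (2 * d)) fun (i : Fin n) κ =>
      lr κ {ext x.1 (i + 1), x.2.2.1 i} * lr κ {ext x.2.1 (i + 1), x.2.2.2 i}]
    refine Finset.prod_congr rfl fun i _ => ?_
    exact sum_lr_mul_lr _ _ _ _ (card_ext_le hσ _) (mem_families.mp hτ i) (card_ext_le hσ' _)
      (mem_families.mp hτ' i) le_rfl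

theorem sum_lr_four_mul (hn : 0 < n) [DecidableEq YoungDiagram] {m m' : Fin n → YoungDiagram}
    (hm : ∀ i, (m i).card ≤ d) (hm' : ∀ i, (m' i).card ≤ d) :
    ∑ x ∈ (quadFamilies n d).filter fun x => ext x.2.2.1 0 = (ext x.2.1 0).transpose,
      ∏ i, (lr (m i) {x.1 i, x.2.2.1 i, (ext x.2.1 (i + 1)).transpose, x.2.2.2 i} *
        lr (m' i) {x.1 i, x.2.1 i, (ext x.2.2.1 (i + 1)).transpose, x.2.2.2 i}) =
      pairingSum d m m' := by
  obtain ⟨k, rfl⟩ : ∃ k, n = k + 1 := ⟨n - 1, by omega⟩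
  have hprod : ∀ x : (Fin (k + 1) → YoungDiagram) × (Fin (k + 1) → YoungDiagram) ×
      (Fin (k + 1) → YoungDiagram) × (Fin (k + 1) → YoungDiagram),
      ∏ i, (lr (m i) {x.1 i, x.2.2.1 i, (ext x.2.1 (i + 1)).transpose, x.2.2.2 i} *
        lr (m' i) {x.1 i, x.2.1 i, (ext x.2.2.1 (i + 1)).transpose, x.2.2.2 i}) =
      ∑ y ∈ quadFamilies (k + 1) d, (∏ i, (lr (m i) {y.1 i, (y.2.2.1 i).transpose} *
        lr (m' i) {y.2.1 i, (y.2.2.2 i).transpose})) *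
        ∏ i, (lr (y.1 i) {x.1 i, x.2.2.1 i} * lr (y.2.1 i) {x.1 i, x.2.1 i} *
        (lr (y.2.2.1 i) {ext x.2.1 (i + 1), (x.2.2.2 i).transpose} *
          lr (y.2.2.2 i) {ext x.2.2.1 (i + 1), (x.2.2.2 i).transpose})) := by
    intro x
    simp only [← Finset.prod_mul_distrib]
    rw [← prod_sum_families fun i s s' t t' => lr (m i) {s, t.transpose} *
      lr (m' i) {s', t'.transpose} * (lr s {x.1 i, x.2.2.1 i} * lr s' {x.1 i, x.2.1 i} *
        (lr t {ext x.2.1 (i + 1), (x.2.2.2 i).transpose} *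
          lr t' {ext x.2.2.1 (i + 1), (x.2.2.2 i).transpose}))]
    refine Finset.prod_congr rfl fun i _ => ?_
    rw [lr_four_eq (hm i), lr_four_eq (hm' i), Finset.sum_mul_sum]
    refine Finset.sum_congr rfl fun s _ => Finset.sum_congr rfl fun s' _ => ?_
    rw [Finset.sum_mul_sum]
    refine Finset.sum_congr rfl fun t _ => Finset.sum_congr rfl fun t' _ => ?_
    ring
  simp only [hprod]
  rw [Finset.sum_comm, pairingSum]
  refine Finset.sum_congr rfl fun y _ => ?_
  rw [← Finset.mul_sum]
  congr 1
  exact sum_quadFamilies_eq y.1 y.2.1 y.2.2.1 y.2.2.2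

end Decomposition

/-! ### The Cartan matrix -/

section Cartan

variable {p d : ℕ} {ρ : YoungDiagram}

theorem decompSum_eq (p : ℕ) (lam mu : YoungDiagram) :
    decompSum p lam mu = ∑ᶠ στ : (Fin (p / 2) → YoungDiagram) × (Fin (p / 2) → YoungDiagram),
      decompTerm (barQuotient p lam 0) (fun i => barQuotient p lam (i + 1))
        (fun i => barQuotient p mu i) στ.1 στ.2 := rfl

theorem Dcirc_mul_D (p : ℕ) (lam mu nu : YoungDiagram) : Dcirc p lam mu * D p lam nu =
    2 ^ height (barQuotient p lam 0) * decompSum p lam mu * decompSum p lam nu := by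
  have h : parity lam < 2 := Nat.mod_lt _ (by norm_num)
  -- the exponents add up to the height, whatever the parity is
  have h2 : height (barQuotient p lam 0) = (height (barQuotient p lam 0) + parity lam) / 2 +
      (height (barQuotient p lam 0) + 1 - parity lam) / 2 := by omega
  rw [Dcirc, D]
  conv_rhs => rw [h2, pow_add]
  ring

theorem sum_card_of_restricted (hodd : p = 2 * (p / 2) + 1) (hp2 : 0 < p / 2) (hd : 1 ≤ d)
    (hρ : IsBarCore p ρ) (hR : IsRouquier p d ρ) {mu : YoungDiagram}
    (hmu : mu ∈ restrictedPartitions p ρ d) : ∑ i : Fin (p / 2), (barQuotient p mu i).card = d := by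
  obtain ⟨h1, h2⟩ := (mem_pStrictPartitions_iff hodd hd hρ hR).mp hmu.1
  have h3 := (sum_card_barQuotient hodd hd hρ hR h1).mp h2
  have h4 := Finset.sum_range_succ (fun i => (barQuotient p mu i).card) (p / 2)
  rw [Finset.sum_range_succ', barQuotient_eq_bot_of_restricted hodd hp2 hd hρ hR hmu,
    card_bot] at h4
  rw [Fin.sum_univ_eq_sum_range (fun i => (barQuotient p mu (i + 1)).card)] at h3
  rw [Fin.sum_univ_eq_sum_range (fun i => (barQuotient p mu i).card)]
  omega

theorem unadjustedCartan_eq (hodd : p = 2 * (p / 2) + 1) (hp2 : 0 < p / 2) (hd : 1 ≤ d)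
    (hρ : IsBarCore p ρ) (hR : IsRouquier p d ρ) {mu nu : YoungDiagram}
    (hmu : mu ∈ restrictedPartitions p ρ d) (hnu : nu ∈ restrictedPartitions p ρ d) :
    unadjustedCartan p ρ d mu nu =
      pairingSum d (fun i : Fin (p / 2) => barQuotient p mu i) fun i => barQuotient p nu i := by
  classical
  have hsum := sum_card_of_restricted hodd hp2 hd hρ hR hmu
  have hle : ∀ mu ∈ restrictedPartitions p ρ d, ∀ i : Fin (p / 2),
      (barQuotient p mu i).card ≤ d := fun mu hmu i => by
    rw [← sum_card_of_restricted hodd hp2 hd hρ hR hmu]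
    exact Finset.single_le_sum (f := fun i : Fin (p / 2) => (barQuotient p mu i).card)
      (fun _ _ => Nat.zero_le _) (Finset.mem_univ i)
  set G : YoungDiagram × (Fin (p / 2) → YoungDiagram) → ℤ := fun x => 2 ^ height x.1 *
    (∑ σ ∈ families (p / 2) d, ∑ τ ∈ families (p / 2) d,
      decompTerm x.1 x.2 (fun i => barQuotient p mu i) σ τ) *
    (∑ σ ∈ families (p / 2) d, ∑ τ ∈ families (p / 2) d,
      decompTerm x.1 x.2 (fun i => barQuotient p nu i) σ τ) with hG
  -- the bound `2 * d` is the one required by the pairings; larger sizes than `d` contribute zero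
  set T := ((partitionsLE (2 * d)).filter IsStrict) ×ˢ families (p / 2) (2 * d) with hT
  set T' := T.filter fun x => x.1.card + ∑ i, (x.2 i).card = d with hT'
  have hmem : ∀ x, x ∈ T' ↔ IsStrict x.1 ∧ x.1.card + ∑ i, (x.2 i).card = d := by
    intro x
    rw [hT', hT, Finset.mem_filter, Finset.mem_product, Finset.mem_filter, mem_partitionsLE,
      mem_families]
    constructor
    · exact fun h => ⟨h.1.1.2, h.2⟩
    · rintro ⟨h1, h2⟩
      refine ⟨⟨⟨by omega, h1⟩, fun i => ?_⟩, h2⟩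
      have h3 := Finset.single_le_sum (f := fun i => (x.2 i).card) (fun _ _ => Nat.zero_le _)
        (Finset.mem_univ i)
      omega
  have hbij : Set.BijOn (fun lam => (barQuotient p lam 0, fun i : Fin (p / 2) =>
      barQuotient p lam (i + 1))) (strictPartitions p ρ d) (T' : Set _) := by
    refine ⟨fun lam hlam => ?_, fun lam hlam lam' hlam' h => ?_, fun x hx => ?_⟩
    · obtain ⟨h1, h2⟩ := (mem_pStrictPartitions_iff hodd hd hρ hR).mp hlam.1
      rw [Finset.mem_coe, hmem]
      exact ⟨isStrict_barQuotient_zero (by omega) hlam.2,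
        (sum_card_barQuotient hodd hd hρ hR h1).mp h2⟩
    · obtain ⟨h1, -⟩ := (mem_pStrictPartitions_iff hodd hd hρ hR).mp hlam.1
      obtain ⟨h1', -⟩ := (mem_pStrictPartitions_iff hodd hd hρ hR).mp hlam'.1
      obtain ⟨h2, h3⟩ := Prod.mk.inj h
      exact h1.eq_of_barQuotient_eq hodd h1' h2 fun i => congrFun h3 i
    · rw [Finset.mem_coe, hmem] at hx
      obtain ⟨κ, hκ, h0, h1⟩ := exists_barQuotient_eq hodd hd hρ hR hx.1 x.2 hx.2
      exact ⟨κ, hκ, Prod.ext h0 (funext h1)⟩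
  rw [unadjustedCartan, finsum_mem_eq_of_bijOn (g := G) _ hbij, finsum_mem_coe_finset,
    ← sum_decompTerm_mul, ← Finset.sum_product']
  · refine Finset.sum_subset (Finset.filter_subset _ _) fun x hx hx' => ?_
    by_contra h
    refine hx' (Finset.mem_filter.mpr ⟨hx, ?_⟩)
    obtain ⟨σ, -, h1⟩ := Finset.exists_ne_zero_of_sum_ne_zero
      (right_ne_zero_of_mul (left_ne_zero_of_mul h))
    obtain ⟨τ, -, h2⟩ := Finset.exists_ne_zero_of_sum_ne_zero h1
    rw [card_add_sum_card_of_decompTerm_ne_zero h2, hsum]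
  · intro lam _
    rw [Dcirc_mul_D, decompSum_eq, decompSum_eq, finsum_decompTerm (hle mu hmu),
      finsum_decompTerm (hle nu hnu)]

end Cartan

end SpinRoCK

theorem mainTheorem4 (p : ℕ) (hp : p.Prime) (hp2 : p ≠ 2) (d : ℕ) (hd : 1 ≤ d)
    (ρ : YoungDiagram) (hρ : SpinRoCK.IsBarCore p ρ) (hR : SpinRoCK.IsRouquier p d ρ)
    (mu nu : YoungDiagram) (hmu : mu ∈ SpinRoCK.restrictedPartitions p ρ d)
    (hnu : nu ∈ SpinRoCK.restrictedPartitions p ρ d) :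
    let S : Set (SpinRoCK.PartitionQuad (p / 2)) :=
      {x | SpinRoCK.ext x.χ 0 = (SpinRoCK.ext x.ψ 0).transpose}
    let F : SpinRoCK.PartitionQuad (p / 2) → ℤ := fun x =>
      ∏ i : Fin (p / 2),
        (SpinRoCK.lr (SpinRoCK.barQuotient p mu i)
            {x.φ i, x.χ i, (SpinRoCK.ext x.ψ (i + 1)).transpose, x.ω i} *
          SpinRoCK.lr (SpinRoCK.barQuotient p nu i)
            {x.φ i, x.ψ i, (SpinRoCK.ext x.χ (i + 1)).transpose, x.ω i})
    (S ∩ Function.support F).Finite ∧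
      SpinRoCK.unadjustedCartan p ρ d mu nu = ∑ᶠ x ∈ S, F x := by
  intro S F
  classical
  have hodd : p = 2 * (p / 2) + 1 := by
    have := hp.eq_two_or_odd
    omega
  have hn : 0 < p / 2 := by
    have := hp.two_le
    omega
  have hle : ∀ mu ∈ SpinRoCK.restrictedPartitions p ρ d, ∀ i : Fin (p / 2),
      (SpinRoCK.barQuotient p mu i).card ≤ d := fun mu hmu i => by
    rw [← SpinRoCK.sum_card_of_restricted hodd hn hd hρ hR hmu]
    exact Finset.single_le_sum (f := fun i : Fin (p / 2) => (SpinRoCK.barQuotient p mu i).card)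
      (fun _ _ => Nat.zero_le _) (Finset.mem_univ i)
  set e : (Fin (p / 2) → YoungDiagram) × (Fin (p / 2) → YoungDiagram) ×
      (Fin (p / 2) → YoungDiagram) × (Fin (p / 2) → YoungDiagram) →
      SpinRoCK.PartitionQuad (p / 2) := fun y => ⟨y.1, y.2.1, y.2.2.1, y.2.2.2⟩ with he
  have hinj : Function.Injective e := by
    rintro ⟨a, b, c, f⟩ ⟨a', b', c', f'⟩ h
    simpa [he] using h
  set B := ((SpinRoCK.quadFamilies (p / 2) d).filter fun y =>
    SpinRoCK.ext y.2.2.1 0 = (SpinRoCK.ext y.2.1 0).transpose).image e with hB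
  have hsupp : S ∩ Function.support F ⊆ (B : Set (SpinRoCK.PartitionQuad (p / 2))) := by
    rintro x ⟨hx, hF⟩
    have h1 : ∀ i, (x.φ i).card ≤ d ∧ (x.ψ i).card ≤ d ∧ (x.χ i).card ≤ d ∧
        (x.ω i).card ≤ d := by
      intro i
      have h2 := Finset.prod_ne_zero_iff.mp hF i (Finset.mem_univ i)
      have h3 := SpinRoCK.card_eq_of_lr_ne_zero (left_ne_zero_of_mul h2)
      have h4 := SpinRoCK.card_eq_of_lr_ne_zero (right_ne_zero_of_mul h2)
      have h5 := hle mu hmu i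
      have h6 := hle nu hnu i
      simp only [SpinRoCK.totalSize, Multiset.insert_eq_cons, Multiset.map_cons,
        Multiset.map_singleton, Multiset.sum_cons, Multiset.sum_singleton] at h3 h4
      omega
    rw [hB, Finset.coe_image]
    refine ⟨(x.φ, x.ψ, x.χ, x.ω), ?_, rfl⟩
    rw [Finset.mem_coe, Finset.mem_filter]
    refine ⟨?_, hx⟩
    simp only [SpinRoCK.quadFamilies, Finset.mem_product, SpinRoCK.mem_families]
    exact ⟨fun i => (h1 i).1, fun i => (h1 i).2.1, fun i => (h1 i).2.2.1, fun i => (h1 i).2.2.2⟩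
  have hBS : (B : Set (SpinRoCK.PartitionQuad (p / 2))) ⊆ S := by
    intro x hx
    obtain ⟨y, hy, rfl⟩ := Finset.mem_image.mp (Finset.mem_coe.mp hx)
    exact (Finset.mem_filter.mp hy).2
  refine ⟨B.finite_toSet.subset hsupp, ?_⟩
  rw [SpinRoCK.unadjustedCartan_eq hodd hn hd hρ hR hmu hnu,
    finsum_mem_eq_sum_of_inter_support_eq (t := B) F, hB,
    Finset.sum_image fun _ _ _ _ h => hinj h]
  · exact (SpinRoCK.sum_lr_four_mul hn (hle mu hmu) (hle nu hnu)).symm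
  · exact Set.Subset.antisymm (fun x hx => ⟨hsupp hx, hx.2⟩) fun x hx => ⟨hBS hx.1, hx.2⟩
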